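/- **Conventions.** For a finite sequence $S$, $|S|$ is its length and $\|S\|$ its number of distinct symbols. Write $\sigma\prec S$ if some injective renaming of the symbols of $\sigma$ is a (not necessarily contiguous) subsequence of $S$. $S$ is $r$-sparse if distinct occurrences of the same symbol are at distance at least $r$. Let $$\operatorname{Ex}(\sigma,n)=\max\{|S| : \sigma\nprec S,\ \|S\|=n,\ S\text{ is }\|\sigma\|\text{-sparse}\}$$ (with value $0$ if no such $S$ exists), $\lambda_s(n)=\operatorname{Ex}(abab\cdots,n)$ with $abab\cdots$ of length $s+2$, and $$Z_l=1\,2\cdots(l{+}1)\;l\cdots 1\;2\cdots(l{+}1)\;l\cdots 1\;2\cdots (l{+}1).$$ Let $a_{1,j}=2^j$ for $j\ge1$, $a_{i,1}=2$ for $i\ge 2$, $a_{i,j}=w\,a_{i-1,w}$ with $w=a_{i,j-1}$ for $i,j\ge2$; let $\alpha(n,m)=\min\{i\ge 1: a_{i,j}\ge m,\ j=\max\{\lceil n/m\rceil,3\}\}$ and $\alpha(n)=\alpha(n,n)$. A set $\mathcal A$ of sequences is *cofinal* if for every sequence $\sigma$ there is $\sigma'\in\mathcal A$ with $\operatorname{Ex}(\sigma,n)=o(\operatorname{Ex}(\sigma',n))$.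 **Class II sequences.** A pattern $\pi=\pi_1\cdots\pi_{|\pi|}\in\{\nearrow,\searrow\}^*$ has even length at least 2, starts with $\nearrow$, and its reversal equals its flip $\tilde\pi$ (every diagonal exchanged for the other one). $\pi^-$ is $\pi$ without its first and last diagonal. Sequences are divided into blocks of distinct symbols and kept in canonical form (symbols renamed $1,2,\dots$ in order of first appearance). $b(T)$ is the number of blocks of $T$. $T\circ T'$ replaces each block $(c_1\cdots c_{\|T'\|})$ of $T$ with the copy of $T'$ under $p\mapsto c_p$. If the blocks of $T$ have length $b(T')$, then the preshuffle (postshuffle) of $T$ with $T'$ is formed by taking one copy of $T'$ for each block of $T$, over disjoint alphabets, concatenating them, and inserting, for all $p$ and $q$, the $p$-th symbol of the $q$-th block of $T$ at the beginning (end) of the $p$-th block of the $q$-th copy. With $t=(|\pi|-2)/2$ and $\mu_{\pi,i}=2^{\binom{i+t-1}{t}}$, define $U_\pi(i,j)$ for $i\ge0$, $j\ge1$ by - $U_{\nearrow\searrow}(i,j)=(1\,2\cdots j)(j\cdots 2\,1)$ for all $i$; - $U_\pi(0,j)=(1\,2\cdots j)$ and $U_\pi(i,1)=(1)^{\mu_{\pi,i}}$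 for $|\pi|>2$; - for $|\pi|>2$, $i\ge1$, $j\ge2$: let $U_{\rm bot}=U_\pi(i,j-1)$. If $\pi_2\pi_{|\pi|-1}=\nearrow\searrow$, let $U_{\rm mid}=U_{\pi^-}(i,b(U_{\rm bot}))$; if $\pi_2\pi_{|\pi|-1}=\searrow\nearrow$, let $U_{\rm mid}=U_{\widetilde{\pi^-}}(i,b(U_{\rm bot}))$. Let $U_{\rm top}=U_\pi(i-1,\|U_{\rm mid}\|)$. Then $U_\pi(i,j)$ is the preshuffle in the first case, and the postshuffle in the second, of $U_{\rm top}\circ U_{\rm mid}$ with $U_{\rm bot}$. **Theorem.** 1. For every $k\ge0$, with $\pi=\nearrow^{k+1}\searrow\nearrow\searrow^{k+1}$, we have $Z_{3^k}\nprec U_\pi(i,j)$ for all $i\ge 0$, $j\ge1$. 2. For every $k\ge0$, $\operatorname{Ex}(Z_{3^k},n)>n\cdot 2^{(1+o(1))\alpha^{k+1}(n)/(k+1)!}$; that is, there is $\varepsilon_k:\mathbb N\to\mathbb R$ with $\varepsilon_k(n)\to0$ such that $\operatorname{Ex}(Z_{3^k},n)>n\cdot 2^{(1+\varepsilon_k(n))\,\alpha(n)^{k+1}/(k+1)!}$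 for all $n\ge1$. 3. The set $\{Z_l: l\ge1\}$ of zig-zag patterns is cofinal. In particular these patterns are not tied to order-4 Davenport-Schinzel sequences: there is $l\ge 1$ with $\lambda_4(n)=o(\operatorname{Ex}(Z_l,n))$. -/

import Mathlib

namespace ZigZag

/-! ### Sequences, containment, sparseness and extremal functions -/

/-- `‖S‖`: the number of distinct symbols of `S`. -/
def numSym (S : List ℕ) : ℕ := S.toFinset.card

/-- `σ ≺ S`: some injective renaming of the symbols of `σ` is a (not necessarily contiguous)
subsequence of `S`. -/
def Contained (σ S : List ℕ) : Prop :=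
  ∃ f : ℕ → ℕ, Set.InjOn f {a | a ∈ σ} ∧ (σ.map f).Sublist S

/-- `S` is `r`-sparse: two different occurrences of the same symbol are at distance at least `r`. -/
def Sparse (r : ℕ) (S : List ℕ) : Prop :=
  ∀ (i j : ℕ) (hi : i < S.length) (hj : j < S.length), i < j → S[i] = S[j] → r ≤ j - i

/-- The lengths of the `σ`-free, `‖σ‖`-sparse sequences with exactly `n` distinct symbols. -/
def admissibleLengths (σ : List ℕ) (n : ℕ) : Set ℕ :=
  {L | ∃ S : List ℕ, ¬ Contained σ S ∧ numSym S = n ∧ Sparse (numSym σ) S ∧ S.length = L}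

/-- The set of lengths in the definition of `Ex` is bounded: cut `S` into chunks of length `‖σ‖`,
which consist of distinct symbols; if some chunk is repeated more than `|σ|` times, then `σ ≺ S`. -/
theorem bddAbove_admissibleLengths (σ : List ℕ) (n : ℕ) :
    BddAbove (admissibleLengths σ n) := by
  classical
  set r := numSym σ with hr
  refine ⟨r * (n ^ r * σ.length + 1), ?_⟩
  rintro L ⟨S, hfree, hn, hsp, rfl⟩
  by_contra hlt
  push Not at hlt
  apply hfree
  set N := n ^ r * σ.length + 1 with hN
  have hpos : ∀ (q : Fin N) (p : Fin r), q.1 * r + p.1 < S.length := by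
    intro q p
    have h1 : (q.1 + 1) * r ≤ N * r := Nat.mul_le_mul_right r q.2
    have h2 := p.2
    have h3 : r * N = N * r := Nat.mul_comm _ _
    have h4 : (q.1 + 1) * r = q.1 * r + r := by ring
    omega
  let chunk : Fin N → (Fin r → {x // x ∈ S.toFinset}) := fun q p =>
    ⟨S[q.1 * r + p.1]'(hpos q p), by simp⟩
  have hcard : Fintype.card (Fin r → {x // x ∈ S.toFinset}) * σ.length < Fintype.card (Fin N) := by
    have : Fintype.card {x // x ∈ S.toFinset} = n := by
      rw [Fintype.card_coe]; exact hn
    rw [Fintype.card_fun, this, Fintype.card_fin, Fintype.card_fin]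
    omega
  obtain ⟨w, hw⟩ := Fintype.exists_lt_card_fiber_of_mul_lt_card chunk hcard
  set Q : Finset (Fin N) := Finset.univ.filter fun q => chunk q = w with hQ
  obtain ⟨q0, hq0⟩ : Q.Nonempty := Finset.card_pos.mp (by omega)
  have hwinj : Function.Injective w := by
    have key : ∀ p p' : Fin r, p < p' → w p ≠ w p' := by
      intro p p' hpp h
      have hc : chunk q0 = w := (Finset.mem_filter.mp hq0).2
      rw [← hc] at h
      have h' : S[q0.1 * r + p.1]'(hpos q0 p) = S[q0.1 * r + p'.1]'(hpos q0 p') :=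
        congrArg Subtype.val h
      have := hsp _ _ (hpos q0 p) (hpos q0 p') (by have : p.1 < p'.1 := hpp; omega) h'
      have := p'.2
      omega
    intro p p' h
    rcases lt_trichotomy p p' with h1 | h1 | h1
    · exact absurd h (key _ _ h1)
    · exact h1
    · exact absurd h.symm (key _ _ h1)
  let e : {x // x ∈ σ.toFinset} ≃ Fin r :=
    Fintype.equivFinOfCardEq (by rw [Fintype.card_coe]; rfl)
  let f : ℕ → ℕ := fun a => if h : a ∈ σ.toFinset then (w (e ⟨a, h⟩)).1 else 0
  refine ⟨f, ?_, ?_⟩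
  · intro a ha b hb hab
    have ha' : a ∈ σ.toFinset := List.mem_toFinset.mpr ha
    have hb' : b ∈ σ.toFinset := List.mem_toFinset.mpr hb
    simp only [f, ha', hb', dif_pos] at hab
    have := e.injective (hwinj (Subtype.ext hab))
    exact congrArg Subtype.val this
  · let g : Fin σ.length ↪o Fin N := (Fin.castLEOrderEmb hw.le).trans (Q.orderEmbOfFin rfl)
    have hgQ : ∀ t, chunk (g t) = w := fun t =>
      (Finset.mem_filter.mp (Q.orderEmbOfFin_mem rfl (Fin.castLE hw.le t))).2
    have hmem : ∀ t : Fin σ.length, σ[t.1] ∈ σ.toFinset := fun t => by simp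
    let pos : Fin σ.length → ℕ := fun t => (g t).1 * r + (e ⟨σ[t.1], hmem t⟩).1
    have hposlt : ∀ t, pos t < S.length := fun t => hpos _ _
    have hmono : StrictMono pos := by
      intro t t' htt
      have h1 : (g t).1 < (g t').1 := g.strictMono htt
      have h2 := (e ⟨σ[t.1], hmem t⟩).2
      have h3 : ((g t).1 + 1) * r ≤ (g t').1 * r := Nat.mul_le_mul_right r h1
      have h4 : ((g t).1 + 1) * r = (g t).1 * r + r := by ring
      simp only [pos]
      omega
    rw [List.sublist_iff_exists_fin_orderEmbedding_get_eq]
    refine ⟨OrderEmbedding.ofStrictMono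
      (fun t => ⟨pos (Fin.cast (by simp) t), hposlt _⟩) ?_, ?_⟩
    · intro t t' htt
      exact hmono (by simpa using htt)
    · intro t
      have hc := congrFun (hgQ (Fin.cast (by simp) t)) (e ⟨σ[t.1]'(by simpa using t.2), by simp⟩)
      have hc' := congrArg Subtype.val hc
      simp only [List.get_eq_getElem, List.getElem_map]
      have hm : σ[t.1]'(by simpa using t.2) ∈ σ.toFinset := by simp
      simp only [f, hm, dif_pos]
      exact hc'.symm

/-- `Ex(σ, n)`: the maximum length of a `σ`-free, `‖σ‖`-sparse sequence with `n` distinct symbols.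
The set of lengths is always bounded, see `bddAbove_admissibleLengths`; the value is `0` if there is
no such sequence at all. -/
noncomputable def Ex (σ : List ℕ) (n : ℕ) : ℕ := sSup (admissibleLengths σ n)

/-- The alternating sequence `abab⋯` of length `m`. -/
def alternating (m : ℕ) : List ℕ := (List.range m).map (fun p => p % 2)

/-- The extremal function of order-`s` Davenport-Schinzel sequences. -/
noncomputable def DS (s n : ℕ) : ℕ := Ex (alternating (s + 2)) n

/-- A set of forbidden sequences is cofinal if every `Ex(σ, ·)` is little-o of `Ex(σ', ·)` for some
member `σ'` of the set. -/
def CofinalForbidden (A : Set (List ℕ)) : Prop :=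
  ∀ σ : List ℕ, ∃ σ' ∈ A,
    (fun n : ℕ => (Ex σ n : ℝ)) =o[Filter.atTop] (fun n : ℕ => (Ex σ' n : ℝ))

/-- `1 2 ⋯ j`. -/
def ascending (j : ℕ) : List ℕ := List.range' 1 j

/-- `j ⋯ 2 1`. -/
def descending (j : ℕ) : List ℕ := (ascending j).reverse

/-- `Z_k = 1 2 ⋯ (k+1) k ⋯ 1 2 ⋯ (k+1) k ⋯ 1 2 ⋯ (k+1)`. -/
def Z (k : ℕ) : List ℕ :=
  ascending (k + 1) ++ descending k ++ List.range' 2 k ++ descending k ++ List.range' 2 k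

/-! ### Ackermann's function and its inverse -/

/-- `a_{1,j} = 2^j`, `a_{i,1} = 2` for `i ≥ 2`, and `a_{i,j} = w * a_{i-1,w}` with `w = a_{i,j-1}`
for `i, j ≥ 2` (the values at `i = 0`, and at `j = 0` for `i ≥ 2`, are not used). -/
def ackermannTable : ℕ → ℕ → ℕ
  | 0, _ => 0
  | 1, j => 2 ^ j
  | _ + 2, 0 => 0
  | _ + 2, 1 => 2
  | i + 2, j + 2 => ackermannTable (i + 2) (j + 1) *
      ackermannTable (i + 1) (ackermannTable (i + 2) (j + 1))
  termination_by i j => (i, j)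

/-- `α(n,m) = min {i ≥ 1 | a_{i,j} ≥ m}` with `j = max(⌈n/m⌉, 3)`. -/
noncomputable def alphaTwo (n m : ℕ) : ℕ :=
  sInf {i : ℕ | 1 ≤ i ∧ m ≤ ackermannTable i (max ⌈(n : ℚ) / (m : ℚ)⌉₊ 3)}

/-- `α(n) = α(n,n)`. -/
noncomputable def alpha (n : ℕ) : ℕ := alphaTwo n n

/-! ### Blocked sequences, composition and shuffling -/

/-- A sequence over `α` partitioned into blocks. -/
abbrev Blocked (α : Type) := List (List α)

/-- The canonical form: symbols are renamed `1, 2, 3, …` in the order of first appearance. The new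
name of `a` is one plus the number of distinct symbols that occur before the first `a`. -/
def canonical {α : Type} [DecidableEq α] (T : Blocked α) : Blocked ℕ :=
  T.map fun B => B.map fun a =>
    (T.flatten.take (T.flatten.idxOf a)).toFinset.card + 1

/-- `T(B)`: the copy of `T`, a sequence over `{1, …, |B|}`, under the renaming `k ↦ B_k`. -/
def substitute (T : Blocked ℕ) (B : List ℕ) : Blocked ℕ :=
  T.map fun C => C.map fun k => B.getD (k - 1) 0

/-- `T_top ∘ T_mid`: every block `B` of `T_top` is replaced with `T_mid(B)`. -/
def compose (top mid : Blocked ℕ) : Blocked ℕ :=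
  top.flatMap fun B => substitute mid B

/-- The preshuffle of `sub` with `bot`: the `p`-th symbol of the `q`-th block of `sub` is inserted at
the beginning of the `p`-th block of the `q`-th copy of `bot`. The symbol `b` of the `q`-th copy of
`bot` is `Sum.inr (q, b)`, so that the copies have disjoint alphabets. -/
def preshuffle (sub bot : Blocked ℕ) : Blocked (ℕ ⊕ ℕ × ℕ) :=
  sub.zipIdx.flatMap fun Bq =>
    List.zipWith (fun a L => Sum.inl a :: L.map fun b => Sum.inr (Bq.2, b)) Bq.1 bot

/-- The postshuffle: as `preshuffle`, but with insertion at the end of the block. -/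
def postshuffle (sub bot : Blocked ℕ) : Blocked (ℕ ⊕ ℕ × ℕ) :=
  sub.zipIdx.flatMap fun Bq =>
    List.zipWith (fun a L => (L.map fun b => Sum.inr (Bq.2, b)) ++ [Sum.inl a]) Bq.1 bot

/-! ### Class II sequences -/

/-- The diagonals `↗` and `↘`. -/
inductive Diag
  | up
  | down
  deriving DecidableEq

/-- Reversal of the direction of a diagonal. -/
def Diag.flip : Diag → Diag
  | .up => .down
  | .down => .up

/-- `π⁻`: the pattern without its first and last diagonal. -/
def truncation (π : List Diag) : List Diag := π.tail.dropLast

/-- The multiplicity `μ_{π,i} = 2 ^ C(i+t-1, t)`, where `t = (|π|-2)/2`. -/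
def multiplicity (π : List Diag) (i : ℕ) : ℕ :=
  2 ^ (i + (π.length - 2) / 2 - 1).choose ((π.length - 2) / 2)

/-- The Class II sequence `U_π(i,j)`, for `i ≥ 0`, `j ≥ 1` and a pattern `π` of even length that
starts with `↗` and whose reversal is its flip. For such `π`, of length greater than `2`, the second
and the last but one diagonal are either `↗, ↘` or `↘, ↗`. -/
def U (π : List Diag) (i j : ℕ) : Blocked ℕ :=
  if π.length ≤ 2 then [ascending j, descending j]
  else if i = 0 then [ascending j]
  else if j ≤ 1 then List.replicate (multiplicity π i) [1]
  else if π[1]? = some .up ∧ π[π.length - 2]? = some .down then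
    let bot := U π i (j - 1)
    let mid := U (truncation π) i bot.length
    let top := U π (i - 1) (numSym mid.flatten)
    canonical (preshuffle (compose top mid) bot)
  else if π[1]? = some .down ∧ π[π.length - 2]? = some .up then
    let bot := U π i (j - 1)
    let mid := U ((truncation π).map Diag.flip) i bot.length
    let top := U π (i - 1) (numSym mid.flatten)
    canonical (postshuffle (compose top mid) bot)
  else []
  termination_by (π.length, i, j)
  decreasing_by
    all_goals first
      | exact Prod.Lex.left _ _ (by
          simp only [truncation, List.length_map, List.length_dropLast, List.length_tail]; omega)
      | exact Prod.Lex.right _ (Prod.Lex.left _ _ (by omega))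
      | exact Prod.Lex.right _ (Prod.Lex.right _ (by omega))

/-- `↗^{k+1} ↘ ↗ ↘^{k+1}`. -/
def zPattern (k : ℕ) : List Diag :=
  List.replicate (k + 1) .up ++ [.down, .up] ++ List.replicate (k + 1) .down

end ZigZag

namespace ZigZag

/-! ### Ackermann's function -/

/-! The argument confronts a lower bound for `Ex (Z (3 ^ k))`, obtained from `U (zPattern k)`, with
an upper bound for `Ex σ` valid for every `σ`.

Avoidance (`not_contained_U`) follows the recursive construction. A zig-zag in a shuffle of a
composition with bottom copies uses either only top symbols or only symbols of one bottom copy,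
because a top symbol meets each copy once (`embeds_of_embeds_shuffle`). In a composition `top ∘
mid`, either no two of its symbols share a block of `top`, and then it lives in `top`; or two
symbols do, and then nesting of the blocks of `top` forces a long stretch of the zig-zag into one
copy of `mid` (`embeds_or_inBlock_of_compose`). For `k ≥ 1` this stretch still yields a zig-zag on
about a third of the symbols, the lost pass being replaced by first occurrences in canonical order
(`InBlock.embeds`); this is the source of `3 ^ k`. For `k = 0` the middle sequence `1 ⋯ j j ⋯ 1` is
too poor for any such stretch.

Size: blocks of `U (zPattern k) i j` have `j` distinct symbols, and average multiplicity is `2 ^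
(i+k choose k+1)` by Pascal's rule. The number of symbols stays below an Ackermann value in row `i +
k + 2` (`size_U_le`), so for a fixed `j` one may take `i = α(n) - O(1)`. Thinning to a sparse
sequence and repeating over disjoint alphabets costs only constant factors
(`exists_mul_two_pow_choose_le_Ex`).

Upper bound: a formation, that is `|σ|` consecutive intervals each containing the same `‖σ‖`
symbols, contains `σ`. Sequences without formations of length `s + 1` are bounded by splitting into
groups, separating local from global symbols and contracting the groups (`weight_recurrence`,
`weight_le_levelCoeff`). Passing from blocked to sparse sequences gives `Ex σ n ≤ n * 2 ^ (C * (α(n)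
+ 1) ^ s)` (`exists_Ex_le`). As the lower bound has exponent of order `α(n) ^ (k+1)`, the choice `k
= s` gives cofinality, and `λ_4` is a special case. -/

theorem ackermannTable_one_right (i : ℕ) : ackermannTable (i + 1) 1 = 2 := by
  cases i <;> simp [ackermannTable]

theorem ackermannTable_succ_succ (i j : ℕ) (hj : 1 ≤ j) :
    ackermannTable (i + 2) (j + 1) =
      ackermannTable (i + 2) j * ackermannTable (i + 1) (ackermannTable (i + 2) j) := by
  obtain ⟨j, rfl⟩ := Nat.exists_eq_add_of_le' hj
  rw [ackermannTable]

theorem two_pow_le_ackermannTable (i j : ℕ) (hj : 1 ≤ j) :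
    2 ^ j ≤ ackermannTable (i + 1) j := by
  induction i generalizing j with
  | zero => simp [ackermannTable]
  | succ i ih =>
    induction j, hj using Nat.le_induction with
    | base => simp [ackermannTable_one_right]
    | succ j hj ihj =>
      rw [ackermannTable_succ_succ i j hj]
      set w := ackermannTable (i + 2) j with hw
      have h1 : 1 ≤ w := le_trans Nat.one_le_two_pow ihj
      have h2 := ih w h1
      have h3 : 2 ≤ 2 ^ w := by
        calc 2 = 2 ^ 1 := rfl
          _ ≤ 2 ^ w := Nat.pow_le_pow_right (by norm_num) h1
      calc 2 ^ (j + 1) = 2 ^ j * 2 := pow_succ _ _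
        _ ≤ w * ackermannTable (i + 1) w := Nat.mul_le_mul ihj (h3.trans h2)

theorem lt_ackermannTable (i j : ℕ) (hj : 1 ≤ j) : j < ackermannTable (i + 1) j :=
  lt_of_lt_of_le Nat.lt_two_pow_self (two_pow_le_ackermannTable i j hj)

theorem two_le_ackermannTable (i j : ℕ) (hj : 1 ≤ j) : 2 ≤ ackermannTable (i + 1) j :=
  le_trans (by simpa using Nat.pow_le_pow_right (n := 2) (by norm_num) hj)
    (two_pow_le_ackermannTable i j hj)

theorem one_le_ackermannTable (i j : ℕ) (hj : 1 ≤ j) : 1 ≤ ackermannTable (i + 2) j :=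
  one_le_two.trans (two_le_ackermannTable (i + 1) j hj)

theorem ackermannTable_lt_succ_right (i j : ℕ) (hj : 1 ≤ j) :
    ackermannTable (i + 1) j < ackermannTable (i + 1) (j + 1) := by
  cases i with
  | zero => simpa [ackermannTable] using Nat.pow_lt_pow_right (a := 2) (by norm_num) (Nat.lt_succ_self j)
  | succ i =>
    rw [ackermannTable_succ_succ i j hj]
    have h1 := one_le_ackermannTable i j hj
    have h2 := two_le_ackermannTable i (ackermannTable (i + 2) j) h1
    nlinarith

theorem ackermannTable_mono_right (i : ℕ) {j j' : ℕ} (hj : 1 ≤ j) (hjj : j ≤ j') :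
    ackermannTable (i + 1) j ≤ ackermannTable (i + 1) j' := by
  induction j', hjj using Nat.le_induction with
  | base => exact le_rfl
  | succ j' hjj ih => exact ih.trans (ackermannTable_lt_succ_right i j' (hj.trans hjj)).le

theorem ackermannTable_comp_le (i j : ℕ) (hj : 1 ≤ j) :
    ackermannTable (i + 1) (ackermannTable (i + 2) j) ≤ ackermannTable (i + 2) (j + 1) := by
  rw [ackermannTable_succ_succ i j hj]
  exact Nat.le_mul_of_pos_left _ (one_le_ackermannTable i j hj)

theorem ackermannTable_le_succ_left (i j : ℕ) (hj : 1 ≤ j) :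
    ackermannTable (i + 1) j ≤ ackermannTable (i + 2) j := by
  cases j with
  | zero => omega
  | succ j =>
    rcases Nat.eq_zero_or_pos j with rfl | hj'
    · simp [ackermannTable_one_right]
    · exact (ackermannTable_mono_right i (by omega) (lt_ackermannTable (i + 1) j hj')).trans
        (ackermannTable_comp_le i j hj')

theorem ackermannTable_mono_left {i i' : ℕ} (j : ℕ) (hj : 1 ≤ j) (h : i ≤ i') :
    ackermannTable (i + 1) j ≤ ackermannTable (i' + 1) j := by
  induction i', h using Nat.le_induction with
  | base => exact le_rfl
  | succ i' h ih => exact ih.trans (ackermannTable_le_succ_left i' j hj)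

theorem two_pow_mul_le_ackermannTable (i j : ℕ) (hj : 1 ≤ j) :
    ackermannTable (i + 2) j * 2 ^ ackermannTable (i + 2) j ≤ ackermannTable (i + 2) (j + 1) := by
  rw [ackermannTable_succ_succ i j hj]
  exact Nat.mul_le_mul_left _ (two_pow_le_ackermannTable i _
    (one_le_ackermannTable i j hj))

theorem sq_le_ackermannTable (i j : ℕ) (hj : 1 ≤ j) :
    ackermannTable (i + 2) j ^ 2 ≤ ackermannTable (i + 2) (j + 1) := by
  refine le_trans ?_ (two_pow_mul_le_ackermannTable i j hj)
  rw [sq]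
  exact Nat.mul_le_mul_left _ Nat.lt_two_pow_self.le

theorem ackermannTable_two_right (i : ℕ) : ackermannTable (i + 1) 2 = 2 ^ (i + 2) := by
  induction i with
  | zero => simp [ackermannTable]
  | succ i ih =>
    rw [ackermannTable_succ_succ i 1 le_rfl, ackermannTable_one_right, ih]
    ring

/-- Going up one row at column 3 absorbs any argument up to `2 ^ (i + 3)`, the entry of that row in
column 2. This trades a constant column for a constant shift of `α`. -/
theorem ackermannTable_le_three (i j : ℕ) (hj : 1 ≤ j) (h : j ≤ 2 ^ (i + 3)) :
    ackermannTable (i + 1) j ≤ ackermannTable (i + 2) 3 := by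
  refine le_trans ?_ (ackermannTable_comp_le i 2 (by norm_num))
  rw [ackermannTable_two_right]
  exact ackermannTable_mono_right i hj h

theorem lt_ackermannTable_three (i : ℕ) : i < ackermannTable (i + 1) 3 := by
  have h1 := ackermannTable_lt_succ_right i 2 (by norm_num)
  rw [ackermannTable_two_right] at h1
  have h2 : i + 2 < 2 ^ (i + 2) := Nat.lt_two_pow_self
  exact lt_trans (by omega) h1

/-! ### The inverse function -/

/-- On the diagonal the ratio is 1, so the maximum with 3 always selects column 3. -/
theorem alpha_eq (n : ℕ) (hn : 1 ≤ n) :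
    alpha n = sInf {i : ℕ | 1 ≤ i ∧ n ≤ ackermannTable i 3} := by
  have hn' : (n : ℚ) ≠ 0 := by positivity
  unfold alpha alphaTwo
  simp [div_self hn']

theorem alpha_spec (n : ℕ) (hn : 1 ≤ n) : 1 ≤ alpha n ∧ n ≤ ackermannTable (alpha n) 3 := by
  rw [alpha_eq n hn]
  exact Nat.sInf_mem (s := {i : ℕ | 1 ≤ i ∧ n ≤ ackermannTable i 3})
    ⟨n + 1, by omega, (lt_ackermannTable_three n).le⟩

theorem ackermannTable_lt_of_lt_alpha {n i : ℕ} (hn : 1 ≤ n) (hi : i + 1 < alpha n) :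
    ackermannTable (i + 1) 3 < n := by
  rw [alpha_eq n hn] at hi
  by_contra h
  exact Nat.notMem_of_lt_sInf hi ⟨by omega, not_lt.mp h⟩

theorem tendsto_alpha_atTop : Filter.Tendsto alpha Filter.atTop Filter.atTop := by
  rw [Filter.tendsto_atTop]
  intro b
  filter_upwards [Filter.eventually_gt_atTop (ackermannTable (b + 1) 3)] with n hn
  by_contra h
  obtain ⟨h1, h2⟩ := alpha_spec n (by omega)
  obtain ⟨i, hi⟩ := Nat.exists_eq_add_of_le' h1
  rw [hi] at h2 h
  have := ackermannTable_mono_left (i := i) (i' := b) 3 (by norm_num) (by omega)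
  omega

/-! ### Formations in sequences of finite sets -/

/-- The symbols occurring in the blocks `T p` with `lo ≤ p < hi`. -/
def symbolsIn (T : ℕ → Finset ℕ) (lo hi : ℕ) : Finset ℕ := (Finset.Ico lo hi).biUnion T

/-- The total size of the blocks `T p` with `lo ≤ p < hi`. -/
def weight (T : ℕ → Finset ℕ) (lo hi : ℕ) : ℕ := ∑ p ∈ Finset.Ico lo hi, (T p).card

/-- The blocks of `T` restricted to the symbols in `Y`. -/
def restrict (T : ℕ → Finset ℕ) (Y : Finset ℕ) (p : ℕ) : Finset ℕ := T p ∩ Y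

/-- The interval `[lo, hi)` can be cut into `s` consecutive intervals such that each of them meets
every symbol of `X`. -/
def HasFormation (T : ℕ → Finset ℕ) (X : Finset ℕ) (s lo hi : ℕ) : Prop :=
  ∃ c : ℕ → ℕ, Monotone c ∧ lo ≤ c 0 ∧ c s ≤ hi ∧
    ∀ t < s, ∀ x ∈ X, ∃ p, c t ≤ p ∧ p < c (t + 1) ∧ x ∈ T p

/-- There is no formation of length `s` on `r` symbols. -/
def FormationFree (T : ℕ → Finset ℕ) (r s lo hi : ℕ) : Prop :=
  ∀ X : Finset ℕ, X.card = r → ¬ HasFormation T X s lo hi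

theorem mem_symbolsIn {T : ℕ → Finset ℕ} {lo hi x : ℕ} :
    x ∈ symbolsIn T lo hi ↔ ∃ p, lo ≤ p ∧ p < hi ∧ x ∈ T p := by
  simp [symbolsIn, and_assoc]

theorem symbolsIn_mono {T : ℕ → Finset ℕ} {lo lo' hi hi' : ℕ} (h : lo' ≤ lo) (h' : hi ≤ hi') :
    symbolsIn T lo hi ⊆ symbolsIn T lo' hi' := by
  intro x
  simp only [mem_symbolsIn]
  rintro ⟨p, h1, h2, h3⟩
  exact ⟨p, by omega, by omega, h3⟩

theorem HasFormation.of_subset {T T' : ℕ → Finset ℕ} {X : Finset ℕ} {s lo hi : ℕ}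
    (h : HasFormation T X s lo hi) (hT : ∀ p, T p ⊆ T' p) : HasFormation T' X s lo hi := by
  obtain ⟨c, h1, h2, h3, h4⟩ := h
  refine ⟨c, h1, h2, h3, fun t ht x hx => ?_⟩
  obtain ⟨p, hp1, hp2, hp3⟩ := h4 t ht x hx
  exact ⟨p, hp1, hp2, hT p hp3⟩

theorem HasFormation.mono {T : ℕ → Finset ℕ} {X : Finset ℕ} {s lo hi lo' hi' : ℕ}
    (h : HasFormation T X s lo hi) (h' : lo' ≤ lo) (h'' : hi ≤ hi') :
    HasFormation T X s lo' hi' := by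
  obtain ⟨c, h1, h2, h3, h4⟩ := h
  exact ⟨c, h1, by omega, by omega, h4⟩

theorem FormationFree.mono {T : ℕ → Finset ℕ} {r s lo hi lo' hi' : ℕ}
    (h : FormationFree T r s lo' hi') (h' : lo' ≤ lo) (h'' : hi ≤ hi') :
    FormationFree T r s lo hi :=
  fun X hX hf => h X hX (hf.mono h' h'')

theorem FormationFree.restrict {T : ℕ → Finset ℕ} {r s lo hi : ℕ}
    (h : FormationFree T r s lo hi) (Y : Finset ℕ) : FormationFree (restrict T Y) r s lo hi :=
  fun X hX hf => h X hX (hf.of_subset fun _ => Finset.inter_subset_left)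

theorem HasFormation.append {T : ℕ → Finset ℕ} {X : Finset ℕ} {s lo mid hi : ℕ}
    (h : HasFormation T X s lo mid) (hm : mid ≤ hi) (hX : X ⊆ symbolsIn T mid hi) :
    HasFormation T X (s + 1) lo hi := by
  obtain ⟨c, h1, h2, h3, h4⟩ := h
  refine ⟨fun t => if t ≤ s then c t else hi, ?_, by simpa using h2, by simp, fun t ht x hx => ?_⟩
  · intro t t' htt
    by_cases ht' : t' ≤ s
    · simpa [ht', htt.trans ht'] using h1 htt
    · by_cases ht : t ≤ s
      · simpa [ht, ht'] using ((h1 ht).trans h3).trans hm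
      · simp [ht, ht']
  · rcases Nat.lt_or_ge t s with hts | hts
    · obtain ⟨p, hp⟩ := h4 t hts x hx
      exact ⟨p, by simpa [hts.le, Nat.succ_le_of_lt hts] using hp⟩
    · obtain rfl : t = s := by omega
      obtain ⟨p, hp1, hp2, hp3⟩ := mem_symbolsIn.mp (hX hx)
      exact ⟨p, by simpa using h3.trans hp1, by simpa using hp2, hp3⟩

theorem HasFormation.prepend {T : ℕ → Finset ℕ} {X : Finset ℕ} {s lo mid hi : ℕ}
    (h : HasFormation T X s mid hi) (hm : lo ≤ mid) (hX : X ⊆ symbolsIn T lo mid) :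
    HasFormation T X (s + 1) lo hi := by
  obtain ⟨c, h1, h2, h3, h4⟩ := h
  refine ⟨fun t => if t = 0 then lo else c (t - 1), ?_, by simp, by simpa using h3,
    fun t ht x hx => ?_⟩
  · intro t t' htt
    by_cases ht' : t = 0
    · by_cases ht'' : t' = 0
      · simp [ht', ht'']
      · simpa [ht', ht''] using (hm.trans h2).trans (h1 (Nat.zero_le _))
    · have : t' ≠ 0 := by omega
      simpa [ht', this] using h1 (by omega)
  · rcases Nat.eq_zero_or_pos t with rfl | hpos
    · obtain ⟨p, hp1, hp2, hp3⟩ := mem_symbolsIn.mp (hX hx)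
      exact ⟨p, by simpa using hp1, by simpa using lt_of_lt_of_le hp2 h2, hp3⟩
    · obtain ⟨p, hp1, hp2, hp3⟩ := h4 (t - 1) (by omega) x hx
      rw [Nat.sub_add_cancel hpos] at hp2
      exact ⟨p, by simpa [hpos.ne'] using hp1, by simpa using hp2, hp3⟩

/-- Contracting each group of blocks to its set of symbols creates no new formations: cuts between
groups are also cuts between blocks. -/
theorem HasFormation.of_groups {T : ℕ → Finset ℕ} {X : Finset ℕ} {s b : ℕ} {e : ℕ → ℕ}
    (he : Monotone e) (h : HasFormation (fun i => symbolsIn T (e i) (e (i + 1))) X s 0 b) :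
    HasFormation T X s (e 0) (e b) := by
  obtain ⟨c, h1, h2, h3, h4⟩ := h
  refine ⟨fun t => e (c t), he.comp h1, he h2, he h3, fun t ht x hx => ?_⟩
  obtain ⟨i, hi1, hi2, hi3⟩ := h4 t ht x hx
  obtain ⟨p, hp1, hp2, hp3⟩ := mem_symbolsIn.mp hi3
  exact ⟨p, (he hi1).trans hp1, lt_of_lt_of_le hp2 (he hi2), hp3⟩

theorem subset_of_hasFormation_restrict {T : ℕ → Finset ℕ} {X Y : Finset ℕ} {s lo hi : ℕ}
    (h : HasFormation (restrict T Y) X (s + 1) lo hi) : X ⊆ Y := by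
  obtain ⟨c, -, -, -, h4⟩ := h
  intro x hx
  obtain ⟨p, -, -, hp⟩ := h4 0 (Nat.succ_pos s) x hx
  exact (Finset.mem_inter.mp hp).2

/-- Symbols that recur after `mid` contribute one further interval, so a formation on them before
`mid` would extend to a longer one. Restricting to such symbols therefore lowers the forbidden
length by one. -/
theorem FormationFree.restrict_of_later {T : ℕ → Finset ℕ} {r s lo mid hi : ℕ} {Y : Finset ℕ}
    (h : FormationFree T r (s + 2) lo hi) (hm : mid ≤ hi) (hY : Y ⊆ symbolsIn T mid hi) :
    FormationFree (ZigZag.restrict T Y) r (s + 1) lo mid := fun X hX hf =>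
  h X hX ((hf.of_subset fun _ => Finset.inter_subset_left).append hm
    ((subset_of_hasFormation_restrict hf).trans hY))

theorem FormationFree.restrict_of_earlier {T : ℕ → Finset ℕ} {r s lo mid hi : ℕ} {Y : Finset ℕ}
    (h : FormationFree T r (s + 2) lo hi) (hm : lo ≤ mid) (hY : Y ⊆ symbolsIn T lo mid) :
    FormationFree (ZigZag.restrict T Y) r (s + 1) mid hi := fun X hX hf =>
  h X hX ((hf.of_subset fun _ => Finset.inter_subset_left).prepend hm
    ((subset_of_hasFormation_restrict hf).trans hY))

theorem card_symbolsIn_restrict_le (T : ℕ → Finset ℕ) (Y : Finset ℕ) (lo hi : ℕ) :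
    (symbolsIn (restrict T Y) lo hi).card ≤ Y.card := by
  refine Finset.card_le_card fun x hx => ?_
  obtain ⟨p, -, -, hp⟩ := mem_symbolsIn.mp hx
  exact (Finset.mem_inter.mp hp).2

theorem weight_le_mul (T : ℕ → Finset ℕ) (lo hi : ℕ) :
    weight T lo hi ≤ (hi - lo) * (symbolsIn T lo hi).card := by
  refine (Finset.sum_le_card_nsmul _ _ (symbolsIn T lo hi).card fun p hp => ?_).trans (by simp)
  exact Finset.card_le_card (Finset.subset_biUnion_of_mem T hp)

theorem weight_groups (T : ℕ → Finset ℕ) {e : ℕ → ℕ} (he : Monotone e) (b : ℕ) :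
    weight T (e 0) (e b) = ∑ i ∈ Finset.range b, weight T (e i) (e (i + 1)) := by
  induction b with
  | zero => simp [weight]
  | succ b ih =>
    rw [Finset.sum_range_succ, ← ih]
    exact (Finset.sum_Ico_consecutive _ (he (Nat.zero_le b)) (he (Nat.le_succ b))).symm

/-- The basic recurrence: symbols are local to one group or global, and the global symbols of a
group are divided into those with an occurrence in a later group, and the others. -/
theorem weight_recurrence (T : ℕ → Finset ℕ) {e : ℕ → ℕ} (he : Monotone e) (b r s : ℕ)
    (hfree : FormationFree T r (s + 2) (e 0) (e b)) (v v' u D D' E : ℕ)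
    (hloc : ∀ i < b, ∀ Y : Finset ℕ,
      weight (restrict T Y) (e i) (e (i + 1)) ≤ v * (Y.card + D * (e (i + 1) - e i)))
    (hlower : ∀ i < b, ∀ Y : Finset ℕ, FormationFree (restrict T Y) r (s + 1) (e i) (e (i + 1)) →
      weight (restrict T Y) (e i) (e (i + 1)) ≤ v' * (Y.card + D' * (e (i + 1) - e i)))
    (hcontr : ∀ Y : Finset ℕ,
      weight (restrict (fun i => symbolsIn T (e i) (e (i + 1))) Y) 0 b ≤ u * (Y.card + E))
    (hv : v' * u = v) (hu : 1 ≤ u) :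
    weight T (e 0) (e b) ≤
      v * ((symbolsIn T (e 0) (e b)).card + E + (D + 2 * D') * (e b - e 0)) := by
  classical
  -- `G i` is the contraction of the `i`-th group. Its symbols are classified as `L` (only in this
  -- group), `A` (also in a later group) and `B` (in an earlier but no later group).
  set G : ℕ → Finset ℕ := fun i => symbolsIn T (e i) (e (i + 1)) with hG
  set later : ℕ → Finset ℕ := fun i => symbolsIn T (e (i + 1)) (e b) with hlater
  set earlier : ℕ → Finset ℕ := fun i => symbolsIn T (e 0) (e i) with hearlier
  set A : ℕ → Finset ℕ := fun i => G i ∩ later i with hA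
  set B : ℕ → Finset ℕ := fun i => (G i ∩ earlier i) \ later i with hB
  set L : ℕ → Finset ℕ := fun i => G i \ (later i ∪ earlier i) with hL
  set N := symbolsIn T (e 0) (e b) with hN
  set Glob := N \ (Finset.range b).biUnion L with hGlob
  have hsplit : ∀ i < b, weight T (e i) (e (i + 1)) =
      weight (restrict T (L i)) (e i) (e (i + 1)) + (weight (restrict T (A i)) (e i) (e (i + 1)) +
        weight (restrict T (B i)) (e i) (e (i + 1))) := by
    intro i hi
    simp only [weight, ← Finset.sum_add_distrib]
    refine Finset.sum_congr rfl fun p hp => ?_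
    have hpG : T p ⊆ G i := Finset.subset_biUnion_of_mem T hp
    rw [restrict, restrict, restrict, ← Finset.card_union_of_disjoint,
      ← Finset.card_union_of_disjoint]
    · congr 1
      ext x
      have := @hpG x
      simp only [hL, hA, hB, Finset.mem_union, Finset.mem_inter, Finset.mem_sdiff]
      tauto
    · rw [Finset.disjoint_left]
      intro x
      simp only [hL, hA, hB, Finset.mem_union, Finset.mem_inter, Finset.mem_sdiff]
      tauto
    · rw [Finset.disjoint_left]
      intro x
      simp only [hA, hB, Finset.mem_inter, Finset.mem_sdiff]
      tauto
  have hGlater : ∀ i j, i < j → j < b → G j ⊆ later i := fun i j hij hj =>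
    symbolsIn_mono (he (by omega)) (he (by omega))
  have hGearlier : ∀ i j, j < i → G j ⊆ earlier i := fun i j hij =>
    symbolsIn_mono (he (by omega)) (he (by omega))
  have hLdisj : ∀ i < b, ∀ j < b, i ≠ j → ∀ x ∈ G i, x ∉ L j := by
    intro i hi j hj hij x hx hxj
    simp only [hL, Finset.mem_sdiff, Finset.mem_union, not_or] at hxj
    rcases lt_or_gt_of_ne hij with h | h
    · exact hxj.2.2 (hGearlier j i h hx)
    · exact hxj.2.1 (hGlater j i h hi hx)
  have hcardL : ∑ i ∈ Finset.range b, (L i).card + Glob.card = N.card := by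
    rw [← Finset.card_biUnion]
    · rw [hGlob, add_comm, Finset.card_sdiff_add_card_eq_card]
      intro x hx
      obtain ⟨i, hi, hx⟩ := Finset.mem_biUnion.mp hx
      exact symbolsIn_mono (he (Nat.zero_le i)) (he (by simpa using hi))
        (Finset.mem_sdiff.mp hx).1
    · intro i hi j hj hij
      rw [Function.onFun, Finset.disjoint_left]
      intro x hx
      exact hLdisj i (by simpa using hi) j (by simpa using hj) hij x (Finset.mem_sdiff.mp hx).1
  -- The global symbols of a group are counted once per group, which is the weight of the contracted
  -- sequence restricted to `Glob`.
  have hcardAB : ∑ i ∈ Finset.range b, ((A i).card + (B i).card) ≤ u * (Glob.card + E) := by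
    refine le_trans ?_ (hcontr Glob)
    rw [weight, ← Finset.range_eq_Ico]
    refine Finset.sum_le_sum fun i hi => ?_
    have hi' : i < b := by simpa using hi
    rw [← Finset.card_union_of_disjoint]
    · refine Finset.card_le_card fun x hx => ?_
      have hxG : x ∈ G i := by
        simp only [hA, hB, Finset.mem_union, Finset.mem_inter, Finset.mem_sdiff] at hx
        tauto
      have hxL : x ∉ L i := by
        simp only [hA, hB, Finset.mem_union, Finset.mem_inter, Finset.mem_sdiff] at hx
        simp only [hL, Finset.mem_union, Finset.mem_sdiff]
        tauto
      refine Finset.mem_inter.mpr ⟨hxG, Finset.mem_sdiff.mpr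
        ⟨symbolsIn_mono (he (Nat.zero_le i)) (he (by omega)) hxG, fun hx' => ?_⟩⟩
      obtain ⟨j, hj, hxj⟩ := Finset.mem_biUnion.mp hx'
      rcases eq_or_ne i j with rfl | hij
      · exact hxL hxj
      · exact hLdisj i hi' j (by simpa using hj) hij x hxG hxj
    · rw [Finset.disjoint_left]
      intro x
      simp only [hA, hB, Finset.mem_inter, Finset.mem_sdiff]
      tauto
  have hlen : ∑ i ∈ Finset.range b, (e (i + 1) - e i) = e b - e 0 := Finset.sum_range_tsub he b
  have hgroup : ∀ i ∈ Finset.range b, weight T (e i) (e (i + 1)) ≤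
      v * (L i).card + v' * ((A i).card + (B i).card) +
        (v * D + 2 * (v' * D')) * (e (i + 1) - e i) := by
    intro i hi
    have hi' : i < b := by simpa using hi
    -- `A` and `B` each fall under the bound for shorter formations, by appending a later or
    -- prepending an earlier interval; this is why `D'` enters twice.
    rw [hsplit i hi']
    have h1 := hloc i hi' (L i)
    have h2 := hlower i hi' (A i) (((hfree.mono (he (Nat.zero_le i)) le_rfl)).restrict_of_later
      (he (by omega)) Finset.inter_subset_right)
    have h3 := hlower i hi' (B i) (((hfree.mono le_rfl (he (by omega : i + 1 ≤ b)))).restrict_of_earlier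
      (he (Nat.zero_le i)) (Finset.sdiff_subset.trans Finset.inter_subset_right))
    calc _ ≤ _ := Nat.add_le_add h1 (Nat.add_le_add h2 h3)
      _ = _ := by ring
  rw [weight_groups T he b]
  refine (Finset.sum_le_sum hgroup).trans ?_
  rw [Finset.sum_add_distrib, Finset.sum_add_distrib, ← Finset.mul_sum, ← Finset.mul_sum,
    ← Finset.mul_sum, hlen, ← hcardL]
  have h4 : v' * ∑ i ∈ Finset.range b, ((A i).card + (B i).card) ≤ v * (Glob.card + E) := by
    calc _ ≤ v' * (u * (Glob.card + E)) := Nat.mul_le_mul_left _ hcardAB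
      _ = _ := by rw [← mul_assoc, hv]
  have h5 : v' ≤ v := by rw [← hv]; exact Nat.le_mul_of_pos_right _ hu
  have h6 : v' * (D' * (e b - e 0)) ≤ v * (D' * (e b - e 0)) := Nat.mul_le_mul_right _ h5
  calc _ ≤ v * ∑ i ∈ Finset.range b, (L i).card + v * (Glob.card + E) +
        (v * D * (e b - e 0) + 2 * (v * (D' * (e b - e 0)))) := by
          rw [add_mul]
          refine Nat.add_le_add (Nat.add_le_add_left h4 _) (Nat.add_le_add_left ?_ _)
          calc _ = 2 * (v' * (D' * (e b - e 0))) := by ring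
            _ ≤ _ := Nat.mul_le_mul_left _ h6
    _ = _ := by ring

/-! ### Upper bounds for formation-free sequences -/

/-- Ackermann's table with a constant row added at the bottom. -/
def ackermannTable' : ℕ → ℕ → ℕ
  | 0, _ => 2
  | k + 1, j => ackermannTable (k + 1) j

/-- The coefficient of the number of symbols in the bound on formation-free blocked sequences. -/
def levelCoeff (c : ℕ) : ℕ → ℕ → ℕ
  | 0, _ => 1
  | _ + 1, 0 => 2 ^ c
  | s + 1, k + 1 => levelCoeff c s (k + 1) * levelCoeff c (s + 1) k

/-- The coefficient of the number of blocks in the bound on formation-free blocked sequences. -/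
def blockCoeff (r : ℕ) : ℕ → ℕ
  | 0 => r
  | s + 1 => 2 + 2 * blockCoeff r s

theorem ackermannTable'_one (k : ℕ) : ackermannTable' k 1 = 2 := by
  cases k with
  | zero => rfl
  | succ k => exact ackermannTable_one_right k

theorem two_le_ackermannTable' (k j : ℕ) (hj : 1 ≤ j) : 2 ≤ ackermannTable' k j := by
  cases k with
  | zero => exact le_rfl
  | succ k => exact two_le_ackermannTable k j hj

theorem ackermannTable'_succ (k j : ℕ) (hj : 1 ≤ j) :
    ackermannTable' (k + 1) (j + 1) =
      ackermannTable' (k + 1) j * ackermannTable' k (ackermannTable' (k + 1) j) := by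
  cases k with
  | zero => simp [ackermannTable', ackermannTable, pow_succ]
  | succ k => exact ackermannTable_succ_succ k j hj

theorem one_le_levelCoeff (c s k : ℕ) : 1 ≤ levelCoeff c s k := by
  induction s generalizing k with
  | zero => simp [levelCoeff]
  | succ s ih =>
    induction k with
    | zero => simpa [levelCoeff] using Nat.one_le_two_pow
    | succ k ihk =>
      rw [levelCoeff]
      exact Nat.mul_pos (ih (k + 1)) ihk

/-- In exponents the product recursion is a sum, and `(k+2)^s + (k+1)^(s+1) ≤ (k+2)^(s+1)`: each
further unit of formation length raises the degree in `k` by one. -/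
theorem levelCoeff_le (c s k : ℕ) : levelCoeff c s k ≤ 2 ^ (c * (k + 1) ^ s) := by
  induction s generalizing k with
  | zero => simpa [levelCoeff] using Nat.one_le_two_pow
  | succ s ih =>
    induction k with
    | zero => simp [levelCoeff]
    | succ k ihk =>
      rw [levelCoeff]
      refine (Nat.mul_le_mul (ih (k + 1)) ihk).trans ?_
      rw [← pow_add, ← mul_add]
      refine Nat.pow_le_pow_right (by norm_num) (Nat.mul_le_mul_left _ ?_)
      have : (k + 1) ^ s ≤ (k + 2) ^ s := Nat.pow_le_pow_left (by omega) _
      calc (k + 2) ^ s + (k + 1) ^ s * (k + 1) ≤ (k + 2) ^ s + (k + 2) ^ s * (k + 1) :=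
            Nat.add_le_add_left (Nat.mul_le_mul_right _ this) _
        _ = (k + 2) ^ (s + 1) := by ring

theorem blockCoeff_mono (r : ℕ) : Monotone (blockCoeff r) :=
  monotone_nat_of_le_succ fun s => by rw [blockCoeff]; omega

/-- Provides a single exponent `c` that meets the hypothesis `hc` of the bounds below for all `s ≤
S`. -/
theorem blockCoeff_mul_pow_le (r S : ℕ) {s w : ℕ} (hs : s ≤ S) (hw : 2 ≤ w) :
    blockCoeff r s * w ^ s ≤ w ^ (blockCoeff r S + S + 2) := by
  have h1 : blockCoeff r s ≤ w ^ blockCoeff r S :=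
    (blockCoeff_mono r hs).trans (Nat.lt_pow_self hw).le
  calc _ ≤ w ^ blockCoeff r S * w ^ S := Nat.mul_le_mul h1 (Nat.pow_le_pow_right (by omega) hs)
    _ = w ^ (blockCoeff r S + S) := (pow_add _ _ _).symm
    _ ≤ _ := Nat.pow_le_pow_right (by omega) (by omega)

theorem card_symbolsIn_lt_of_formationFree {T : ℕ → Finset ℕ} {r lo hi : ℕ} (h : lo ≤ hi)
    (hfree : FormationFree T r 1 lo hi) : (symbolsIn T lo hi).card < r := by
  by_contra hlt
  obtain ⟨X, hX, hcard⟩ := Finset.exists_subset_card_eq (not_lt.mp hlt)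
  refine hfree X hcard ⟨fun t => if t = 0 then lo else hi, ?_, by simp, by simp, ?_⟩
  · intro t t' htt
    by_cases ht : t = 0
    · by_cases ht' : t' = 0 <;> simp [ht, ht', h]
    · have : t' ≠ 0 := by omega
      simp [ht, this]
  · intro t ht x hx
    obtain ⟨p, hp⟩ := mem_symbolsIn.mp (hX hx)
    obtain rfl : t = 0 := by omega
    exact ⟨p, by simpa using hp⟩

/-- Nested induction on `s`, `k` and `j`. An interval of length at most `ackermannTable' (k+1) (j+1)
^ c` is cut into groups of length `w ^ c`, where `w = ackermannTable' (k+1) j`. Single groups are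
handled by `j`, their global symbols by `s`, and the contracted sequence by row `k` at column `w`,
since the number of groups is at most `ackermannTable' k w ^ c`. -/
theorem weight_le_levelCoeff (r c S : ℕ)
    (hc : ∀ s ≤ S, ∀ w, 2 ≤ w → blockCoeff r s * w ^ s ≤ w ^ c) (s : ℕ) (hs : s ≤ S) (k j : ℕ)
    (hj : 1 ≤ j) (T : ℕ → Finset ℕ) (lo hi : ℕ) (hlo : lo ≤ hi)
    (hlen : hi - lo ≤ ackermannTable' k j ^ c) (hfree : FormationFree T r (s + 1) lo hi) :
    weight T lo hi ≤
      levelCoeff c s k * ((symbolsIn T lo hi).card + blockCoeff r s * j ^ s * (hi - lo)) := by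
  induction s generalizing k j T lo hi with
  | zero =>
    have h1 := card_symbolsIn_lt_of_formationFree hlo hfree
    have h2 := weight_le_mul T lo hi
    have h3 : (hi - lo) * (symbolsIn T lo hi).card ≤ r * (hi - lo) := by
      rw [mul_comm]; exact Nat.mul_le_mul_right _ h1.le
    simp only [levelCoeff, blockCoeff, pow_zero, mul_one, one_mul]
    omega
  | succ s ihs =>
    -- With at most `2 ^ c` blocks the trivial bound suffices. This covers row 0, which is
    -- constantly 2, and column 1, where every row equals 2.
    have hbase : ∀ k T lo hi, hi - lo ≤ 2 ^ c → weight T lo hi ≤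
        levelCoeff c (s + 1) k * (symbolsIn T lo hi).card := by
      intro k T lo hi h
      suffices h' : 2 ^ c ≤ levelCoeff c (s + 1) k from
        (weight_le_mul T lo hi).trans (Nat.mul_le_mul_right _ (h.trans h'))
      induction k with
      | zero => rw [levelCoeff]
      | succ k ih =>
        rw [levelCoeff]
        exact ih.trans (Nat.le_mul_of_pos_left _ (one_le_levelCoeff _ _ _))
    induction k generalizing j T lo hi with
    | zero =>
      exact (hbase 0 T lo hi hlen).trans (Nat.mul_le_mul_left _ (Nat.le_add_right _ _))
    | succ k ihk =>
      induction j, hj using Nat.le_induction generalizing T lo hi with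
      | base =>
        rw [ackermannTable'_one] at hlen
        exact (hbase (k + 1) T lo hi hlen).trans (Nat.mul_le_mul_left _ (Nat.le_add_right _ _))
      | succ j hj ihj =>
        set w := ackermannTable' (k + 1) j with hw
        have hw2 : 2 ≤ w := two_le_ackermannTable' (k + 1) j hj
        set L := w ^ c with hL
        have hLpos : 1 ≤ L := Nat.one_le_pow _ _ (by omega)
        set m := hi - lo with hm
        rcases Nat.lt_or_ge L m with hmL | hmL
        swap
        · refine (ihj T lo hi hlo hmL hfree).trans (Nat.mul_le_mul_left _
            (Nat.add_le_add_left (Nat.mul_le_mul_right _ (Nat.mul_le_mul_left _ ?_)) _))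
          exact Nat.pow_le_pow_left (by omega) _
        -- The number of groups is `m / L` rounded up; as `m > L`, rounding at most doubles `b * L`.
        set b := (m - 1) / L + 1 with hb
        have hbL : b * L ≤ 2 * m := by
          have := Nat.div_mul_le_self (m - 1) L
          rw [hb, add_mul]
          omega
        have hmb : m ≤ b * L := by
          have := Nat.lt_div_mul_add (a := m - 1) (b := L) hLpos
          rw [hb, add_mul]
          omega
        have hbQ : b ≤ ackermannTable' k w ^ c := by
          rw [ackermannTable'_succ k j hj, mul_pow, mul_comm] at hlen
          have h1 : m - 1 < m := Nat.sub_lt (by omega) one_pos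
          exact (Nat.div_lt_iff_lt_mul hLpos).mpr (lt_of_lt_of_le h1 hlen)
        set e : ℕ → ℕ := fun i => min (lo + i * L) hi with he
        have hemono : Monotone e := fun i i' hii => by
          have := Nat.mul_le_mul_right L hii
          simp only [he]
          omega
        have he0 : e 0 = lo := by simp [he, hlo]
        have heb : e b = hi := by simp only [he]; omega
        have hestep : ∀ i, e (i + 1) - e i ≤ L := fun i => by
          simp only [he, add_mul]
          omega
        have hle : ∀ i, e i ≤ e (i + 1) := fun i => hemono (Nat.le_succ i)
        have hrec := weight_recurrence T hemono b r s (by rw [he0, heb]; exact hfree)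
          (levelCoeff c (s + 1) (k + 1)) (levelCoeff c s (k + 1)) (levelCoeff c (s + 1) k)
          (blockCoeff r (s + 1) * j ^ (s + 1)) (blockCoeff r s * j ^ s) (2 * m)
          (by
            intro i hi Y
            refine (ihj _ _ _ (hle i) (hestep i) ?_).trans (Nat.mul_le_mul_left _
              (Nat.add_le_add_right (card_symbolsIn_restrict_le _ _ _ _) _))
            refine (hfree.mono ?_ ?_).restrict Y
            · rw [← he0]; exact hemono (Nat.zero_le i)
            · rw [← heb]; exact hemono (by omega))
          (by
            intro i hi Y hY
            exact (ihs (by omega) (k + 1) j hj _ _ _ (hle i) (hestep i) hY).trans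
              (Nat.mul_le_mul_left _
                (Nat.add_le_add_right (card_symbolsIn_restrict_le _ _ _ _) _)))
          (by
            intro Y
            refine (ihk w (by omega) _ 0 b (Nat.zero_le b) (by simpa using hbQ) ?_).trans
              (Nat.mul_le_mul_left _
                (Nat.add_le_add (card_symbolsIn_restrict_le _ _ _ _) ?_))
            · refine FormationFree.restrict (fun X hX hf => hfree X hX ?_) Y
              have := hf.of_groups hemono
              rwa [he0, heb] at this
            -- The contracted sequence has a block term with the large column `w`. The group length
            -- `w ^ c` absorbs it, leaving at most `b * L ≤ 2 * m`.
            · refine (Nat.mul_le_mul_right _ (hc (s + 1) hs w hw2)).trans ?_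
              rw [Nat.sub_zero, mul_comm]
              exact hbL)
          (by rw [levelCoeff]) (one_le_levelCoeff _ _ _)
        rw [he0, heb] at hrec
        refine hrec.trans (Nat.mul_le_mul_left _ ?_)
        rw [add_assoc, ← hm, ← add_mul]
        refine Nat.add_le_add_left (Nat.mul_le_mul_right _ ?_) _
        have h1 : j ^ s ≤ (j + 1) ^ s := Nat.pow_le_pow_left (by omega) _
        have h2 : 1 ≤ (j + 1) ^ s := Nat.one_le_pow _ _ (by omega)
        -- Room from `j` to `j + 1`: the new block terms, `2` from the contraction and `2 *
        -- blockCoeff r s` from the shorter formations, add up to `blockCoeff r (s + 1)` times `(j +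
        -- 1) ^ s`.
        have h3 : j ^ (s + 1) + (j + 1) ^ s ≤ (j + 1) ^ (s + 1) := by
          calc _ = j ^ s * j + (j + 1) ^ s := by rw [pow_succ]
            _ ≤ (j + 1) ^ s * j + (j + 1) ^ s := Nat.add_le_add_right (Nat.mul_le_mul_right _ h1) _
            _ = _ := by ring
        have h4 : blockCoeff r s * j ^ s ≤ blockCoeff r s * (j + 1) ^ s := Nat.mul_le_mul_left _ h1
        calc 2 + (blockCoeff r (s + 1) * j ^ (s + 1) + 2 * (blockCoeff r s * j ^ s))
            ≤ 2 * (j + 1) ^ s + (blockCoeff r (s + 1) * j ^ (s + 1) +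
                2 * (blockCoeff r s * (j + 1) ^ s)) := by omega
          _ = blockCoeff r (s + 1) * (j ^ (s + 1) + (j + 1) ^ s) := by rw [blockCoeff]; ring
          _ ≤ _ := Nat.mul_le_mul_left _ h3

/-! ### Upper bounds for sparse sequences -/

/-- Sparseness of the values of `S` on the interval `[lo, hi)`. -/
def SparseOn (r : ℕ) (S : ℕ → ℕ) (lo hi : ℕ) : Prop :=
  ∀ i j, lo ≤ i → i < j → j < hi → S i = S j → r ≤ j - i

/-- Greedy cutting: each piece is stopped as soon as it contains a formation of length `s + 1` on
some `r` symbols. One of these symbols never occurs again, as otherwise the formation would extend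
to length `s + 2`; so every cut uses up a symbol, and the number of pieces is at most the number of
symbols plus one. -/
theorem exists_cut_into_pieces (T : ℕ → Finset ℕ) (r s Φ : ℕ) (hr : 1 ≤ r) (lo hi : ℕ)
    (hlo : lo ≤ hi)
    (hΦ : ∀ lo' hi', lo ≤ lo' → lo' ≤ hi' → hi' ≤ hi → FormationFree T r (s + 1) lo' hi' →
      hi' - lo' ≤ Φ * (symbolsIn T lo' hi').card)
    (hfree : FormationFree T r (s + 2) lo hi) :
    ∃ (b : ℕ) (e : ℕ → ℕ), Monotone e ∧ e 0 = lo ∧ e b = hi ∧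
      b ≤ (symbolsIn T lo hi).card + 1 ∧
      ∀ i < b, e (i + 1) - e i ≤ Φ * (symbolsIn T (e i) (e (i + 1))).card + 1 := by
  classical
  induction hd : (symbolsIn T lo hi).card using Nat.strong_induction_on generalizing lo with
  | _ d ih =>
  by_cases hfr : FormationFree T r (s + 1) lo hi
  · refine ⟨1, fun i => if i = 0 then lo else hi, ?_, by simp, by simp, by omega, ?_⟩
    · intro t t' htt
      by_cases ht : t = 0
      · by_cases ht' : t' = 0 <;> simp [ht, ht', hlo]
      · have : t' ≠ 0 := by omega
        simp [ht, this]
    · intro i hi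
      obtain rfl : i = 0 := by omega
      simpa using (hΦ lo _ le_rfl hlo le_rfl hfr).trans (Nat.le_succ _)
  · have hex : ∃ y, ∃ X : Finset ℕ, X.card = r ∧ HasFormation T X (s + 1) lo y := by
      simp only [FormationFree, not_forall, not_not] at hfr
      obtain ⟨X, hX, hf⟩ := hfr
      exact ⟨hi, X, hX, hf⟩
    obtain ⟨y, ⟨X, hX, hf⟩, hmin⟩ : ∃ y, (∃ X : Finset ℕ, X.card = r ∧
        HasFormation T X (s + 1) lo y) ∧ ∀ y' < y, ¬ ∃ X : Finset ℕ, X.card = r ∧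
        HasFormation T X (s + 1) lo y' :=
      ⟨Nat.find hex, Nat.find_spec hex, fun y' hy' => Nat.find_min hex hy'⟩
    have hyhi : y ≤ hi := by
      by_contra hlt
      refine hfr fun X hX hf => hmin hi (by omega) ⟨X, hX, hf⟩
    have hXsub : X ⊆ symbolsIn T lo y := by
      obtain ⟨c, h1, h2, h3, h4⟩ := hf
      intro x hx
      obtain ⟨p, hp1, hp2, hp3⟩ := h4 0 (Nat.succ_pos s) x hx
      exact mem_symbolsIn.mpr ⟨p, h2.trans hp1,
        lt_of_lt_of_le hp2 ((h1 (by omega : 0 + 1 ≤ s + 1)).trans h3), hp3⟩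
    have hloy : lo < y := by
      obtain ⟨x, hx⟩ := Finset.card_pos.mp (by omega : 0 < X.card)
      obtain ⟨p, hp1, hp2, -⟩ := mem_symbolsIn.mp (hXsub hx)
      omega
    -- If the remainder lost no symbol, all of `X` would recur in it, giving a formation of length
    -- `s + 2`.
    have hlt : (symbolsIn T y hi).card < d := by
      rw [← hd]
      refine Finset.card_lt_card ⟨symbolsIn_mono hloy.le le_rfl, fun hsub => ?_⟩
      exact hfree X hX (hf.append hyhi
        ((hXsub.trans (symbolsIn_mono le_rfl hyhi)).trans hsub))
    obtain ⟨b, e, he1, he2, he3, he4, he5⟩ := ih _ hlt y hyhi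
      (fun lo' hi' h => hΦ lo' hi' (by omega)) (hfree.mono hloy.le le_rfl) rfl
    refine ⟨b + 1, fun i => if i = 0 then lo else e (i - 1), ?_, by simp, by simpa using he3,
      by omega, ?_⟩
    · intro t t' htt
      by_cases ht : t = 0
      · by_cases ht' : t' = 0
        · simp [ht, ht']
        · simpa [ht, ht'] using hloy.le.trans (he2.symm.le.trans (he1 (Nat.zero_le _)))
      · have : t' ≠ 0 := by omega
        simpa [ht, this] using he1 (by omega)
    · intro i hi'
      rcases Nat.eq_zero_or_pos i with rfl | hpos
      · have h1 := hΦ lo (y - 1) le_rfl (by omega) (by omega)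
          (fun X hX hf => hmin (y - 1) (by omega) ⟨X, hX, hf⟩)
        have h2 : (symbolsIn T lo (y - 1)).card ≤ (symbolsIn T lo y).card :=
          Finset.card_le_card (symbolsIn_mono le_rfl (by omega))
        have h3 := Nat.mul_le_mul_left Φ h2
        simp only [zero_add, one_ne_zero, if_false, if_true, Nat.sub_self, he2]
        omega
      · have := he5 (i - 1) (by omega)
        rw [Nat.sub_add_cancel hpos] at this
        simpa [hpos.ne'] using this

/-- The coefficient in the bound on formation-free sparse sequences. -/
def sparseCoeff (r c : ℕ) : ℕ → ℕ → ℕ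
  | 0, _ => r
  | s + 1, k => sparseCoeff r c s k *
      (levelCoeff c (s + 1) k * (1 + 2 * (blockCoeff r (s + 1) * 3 ^ (s + 1)))) + 2

/-- The sequence is cut into pieces that are free of formations shorter by one, up to a last
position. The induction bounds a piece by its number of distinct symbols, and the sum of these
numbers is the weight of the contracted sequence, which has at most one block more than there are
symbols and is bounded by `weight_le_levelCoeff` in column 3. -/
theorem length_le_sparseCoeff (r c S : ℕ) (hr : 1 ≤ r) (hc2 : 2 ≤ c)
    (hc : ∀ s ≤ S, ∀ w, 2 ≤ w → blockCoeff r s * w ^ s ≤ w ^ c) (s : ℕ) (hs : s ≤ S) (k : ℕ)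
    (f : ℕ → ℕ) (lo hi : ℕ) (hlo : lo ≤ hi) (hsp : SparseOn r f lo hi)
    (hcard : (symbolsIn (fun p => {f p}) lo hi).card ≤ ackermannTable (k + 1) 3)
    (hfree : FormationFree (fun p => {f p}) r (s + 1) lo hi) :
    hi - lo ≤ sparseCoeff r c s (k + 1) * (symbolsIn (fun p => {f p}) lo hi).card := by
  rcases hlo.eq_or_lt with rfl | hlt
  · simp
  have hpos : 1 ≤ (symbolsIn (fun p => {f p}) lo hi).card :=
    Finset.card_pos.mpr ⟨f lo, mem_symbolsIn.mpr ⟨lo, le_rfl, hlt, by simp⟩⟩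
  induction s generalizing lo hi with
  | zero =>
    have h1 := card_symbolsIn_lt_of_formationFree hlo hfree
    -- By sparseness any `r` consecutive positions carry distinct symbols, but there are fewer than
    -- `r` symbols.
    have h2 : hi - lo ≤ r := by
      by_contra hgt
      have : (Finset.Ico lo (lo + r)).card ≤ (symbolsIn (fun p => {f p}) lo hi).card := by
        refine Finset.card_le_card_of_injOn f ?_ ?_
        · intro p hp
          have := Finset.mem_Ico.mp hp
          exact mem_symbolsIn.mpr ⟨p, this.1, by omega, by simp⟩
        · intro p hp q hq hpq
          have hp' := Finset.mem_Ico.mp hp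
          have hq' := Finset.mem_Ico.mp hq
          rcases lt_trichotomy p q with h | h | h
          · have := hsp p q hp'.1 h (by omega) hpq
            omega
          · exact h
          · have := hsp q p hq'.1 h (by omega) hpq.symm
            omega
      rw [Nat.card_Ico] at this
      omega
    exact h2.trans (Nat.le_mul_of_pos_right _ hpos)
  | succ s ih =>
    set T : ℕ → Finset ℕ := fun p => {f p} with hT
    set n := (symbolsIn T lo hi).card with hn
    obtain ⟨b, e, he1, he2, he3, he4, he5⟩ := exists_cut_into_pieces T r s
      (sparseCoeff r c s (k + 1)) hr lo hi hlo
      (by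
        intro lo' hi' h1 h2 h3 h4
        rcases h2.eq_or_lt with rfl | h2'
        · simp
        refine ih (by omega) lo' hi' h2 (fun i j hi hij hj => hsp i j (by omega) hij (by omega))
          ((Finset.card_le_card (symbolsIn_mono h1 h3)).trans hcard) h4 h2'
          (Finset.card_pos.mpr ⟨f lo', mem_symbolsIn.mpr ⟨lo', le_rfl, h2', Finset.mem_singleton_self _⟩⟩)) hfree
    set G : ℕ → Finset ℕ := fun i => symbolsIn T (e i) (e (i + 1)) with hG
    -- There may be one piece more than symbols, so the number of pieces may exceed the table entry
    -- by one; `2 ≤ c` takes care of that.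
    have hbig : b ≤ ackermannTable' (k + 1) 3 ^ c := by
      have h2 := two_le_ackermannTable k 3 (by norm_num)
      calc b ≤ ackermannTable (k + 1) 3 + 1 := by omega
        _ ≤ ackermannTable (k + 1) 3 ^ 2 := by nlinarith
        _ ≤ _ := Nat.pow_le_pow_right (by omega) hc2
    have hw := weight_le_levelCoeff r c S hc (s + 1) hs (k + 1) 3 (by norm_num) G 0 b
      (Nat.zero_le b) (by simpa using hbig) (by
        intro X hX hf
        have := hf.of_groups he1
        rw [he2, he3] at this
        exact hfree X hX this)
    have hsym : (symbolsIn G 0 b).card ≤ n := by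
      refine Finset.card_le_card fun x hx => ?_
      obtain ⟨i, -, hi, hx⟩ := mem_symbolsIn.mp hx
      refine symbolsIn_mono ?_ ?_ hx
      · rw [← he2]; exact he1 (Nat.zero_le i)
      · rw [← he3]; exact he1 (by omega)
    have hlen : hi - lo = ∑ i ∈ Finset.range b, (e (i + 1) - e i) := by
      rw [Finset.sum_range_tsub he1 b, he2, he3]
    have hsum : hi - lo ≤ sparseCoeff r c s (k + 1) * weight G 0 b + b := by
      rw [hlen]
      refine (Finset.sum_le_sum fun i hi => he5 i (by simpa using hi)).trans ?_
      rw [Finset.sum_add_distrib, ← Finset.mul_sum, weight, ← Finset.range_eq_Ico]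
      simp only [Finset.sum_const, Finset.card_range, smul_eq_mul, mul_one]
      exact le_rfl
    have hw' : weight G 0 b ≤ levelCoeff c (s + 1) (k + 1) *
        (n + blockCoeff r (s + 1) * 3 ^ (s + 1) * (2 * n)) := by
      refine hw.trans (Nat.mul_le_mul_left _ (Nat.add_le_add hsym (Nat.mul_le_mul_left _ ?_)))
      omega
    calc hi - lo ≤ sparseCoeff r c s (k + 1) * (levelCoeff c (s + 1) (k + 1) *
        (n + blockCoeff r (s + 1) * 3 ^ (s + 1) * (2 * n))) + 2 * n := by
          have := Nat.mul_le_mul_left (sparseCoeff r c s (k + 1)) hw'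
          omega
      _ = _ := by rw [sparseCoeff]; ring

theorem exists_sparseCoeff_le (r c s : ℕ) : ∃ C : ℕ, ∀ k, sparseCoeff r c s k ≤
    2 ^ (C * (k + 1) ^ s) := by
  induction s with
  | zero => exact ⟨r, fun k => by simpa [sparseCoeff] using Nat.lt_two_pow_self.le⟩
  | succ s ih =>
    obtain ⟨C, hC⟩ := ih
    set Q := 1 + 2 * (blockCoeff r (s + 1) * 3 ^ (s + 1)) with hQ
    refine ⟨C + c + Q + 1, fun k => ?_⟩
    set y := (k + 1) ^ (s + 1) with hy
    have hy1 : 1 ≤ y := Nat.one_le_pow _ _ (by omega)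
    have h1 : sparseCoeff r c s k ≤ 2 ^ (C * y) := by
      refine (hC k).trans (Nat.pow_le_pow_right (by norm_num) (Nat.mul_le_mul_left _ ?_))
      exact Nat.pow_le_pow_right (by omega) (by omega)
    have h2 : levelCoeff c (s + 1) k ≤ 2 ^ (c * y) := levelCoeff_le c (s + 1) k
    have h3 : Q ≤ 2 ^ (Q * y) := by
      refine Nat.lt_two_pow_self.le.trans (Nat.pow_le_pow_right (by norm_num) ?_)
      exact Nat.le_mul_of_pos_right _ hy1
    have h4 : 2 ≤ 2 ^ (C * y + (c * y + Q * y)) := by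
      calc 2 = 2 ^ 1 := rfl
        _ ≤ _ := Nat.pow_le_pow_right (by norm_num)
            (le_add_left (le_add_left (Nat.mul_pos (by omega) hy1)))
    calc sparseCoeff r c (s + 1) k ≤ 2 ^ (C * y) * (2 ^ (c * y) * 2 ^ (Q * y)) + 2 := by
          rw [sparseCoeff]
          exact Nat.add_le_add_right (Nat.mul_le_mul h1 (Nat.mul_le_mul h2 h3)) _
      _ = 2 ^ (C * y + (c * y + Q * y)) + 2 := by rw [pow_add, pow_add]
      _ ≤ 2 ^ (C * y + (c * y + Q * y)) * 2 := by omega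
      _ = 2 ^ (C * y + (c * y + Q * y) + 1) := (pow_succ _ _).symm
      _ ≤ _ := Nat.pow_le_pow_right (by norm_num) (by nlinarith)

/-- Whatever the renaming of `σ` into `X`, its `t`-th symbol can be picked from the `t`-th interval.
-/
theorem contained_of_hasFormation {σ S : List ℕ} {X : Finset ℕ} (hX : X.card = numSym σ)
    (h : HasFormation (fun p => {S.getD p 0}) X σ.length 0 S.length) : Contained σ S := by
  classical
  obtain ⟨c, h1, -, h3, h4⟩ := h
  have e : {x // x ∈ σ.toFinset} ≃ {x // x ∈ X} :=
    Fintype.equivOfCardEq (by rw [Fintype.card_coe, Fintype.card_coe, hX]; rfl)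
  let f : ℕ → ℕ := fun a => if h : a ∈ σ.toFinset then (e ⟨a, h⟩).1 else 0
  have hf : ∀ a ∈ σ, f a ∈ X := fun a ha => by
    have ha' : a ∈ σ.toFinset := List.mem_toFinset.mpr ha
    simp only [f, ha', dif_pos]
    exact (e ⟨a, ha'⟩).2
  have hpos : ∀ t : Fin σ.length, ∃ p, c t ≤ p ∧ p < c (t + 1) ∧ f σ[t] = S.getD p 0 := by
    intro t
    obtain ⟨p, hp1, hp2, hp3⟩ := h4 t t.2 (f σ[t]) (hf _ (by simp))
    exact ⟨p, hp1, hp2, by simpa using hp3⟩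
  choose p hp1 hp2 hp3 using hpos
  have hplt : ∀ t, p t < S.length := fun t =>
    lt_of_lt_of_le (hp2 t) ((h1 (Nat.succ_le_of_lt t.2)).trans h3)
  refine ⟨f, ?_, ?_⟩
  · intro a ha b hb hab
    have ha' : a ∈ σ.toFinset := List.mem_toFinset.mpr ha
    have hb' : b ∈ σ.toFinset := List.mem_toFinset.mpr hb
    simp only [f, ha', hb', dif_pos] at hab
    exact congrArg Subtype.val (e.injective (Subtype.ext hab))
  · rw [List.sublist_iff_exists_fin_orderEmbedding_get_eq]
    refine ⟨OrderEmbedding.ofStrictMono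
      (fun t => ⟨p (Fin.cast (by simp) t), hplt _⟩) ?_, ?_⟩
    · intro t t' htt
      have htt' : t.1 + 1 ≤ t'.1 := htt
      change p (Fin.cast _ t) < p (Fin.cast _ t')
      exact lt_of_lt_of_le (hp2 (Fin.cast (by simp) t))
        ((h1 htt').trans (hp1 (Fin.cast (by simp) t')))
    · intro t
      have := hp3 (Fin.cast (by simp) t)
      rw [List.getD_eq_getElem _ _ (hplt _)] at this
      simp only [List.get_eq_getElem, List.getElem_map]
      exact this

theorem exists_Ex_le (σ : List ℕ) :
    ∃ C s : ℕ, ∀ n, 1 ≤ n → Ex σ n ≤ n * 2 ^ (C * (alpha n + 1) ^ s) := by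
  classical
  rcases Nat.eq_zero_or_pos (numSym σ) with h0 | hr
  · have hσ : σ = [] := by
      simpa [numSym] using h0
    refine ⟨0, 0, fun n _ => ?_⟩
    have : admissibleLengths σ n = ∅ := by
      refine Set.eq_empty_of_forall_notMem ?_
      rintro L ⟨S, hS, -⟩
      exact hS ⟨id, by simp [hσ], by simp [hσ]⟩
    simp [Ex, this]
  · set r := numSym σ with hr'
    set s := σ.length with hs'
    set c := blockCoeff r s + s + 2 with hc
    obtain ⟨C, hC⟩ := exists_sparseCoeff_le r c s
    refine ⟨C, s, fun n hn => ?_⟩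
    rcases Set.eq_empty_or_nonempty (admissibleLengths σ n) with he | hne
    · simp [Ex, he]
    refine csSup_le hne ?_
    rintro L ⟨S, hfree, hSn, hsp, rfl⟩
    have hsym : symbolsIn (fun p => {S.getD p 0}) 0 S.length = S.toFinset := by
      ext x
      rw [mem_symbolsIn, List.mem_toFinset, List.mem_iff_getElem]
      constructor
      · rintro ⟨p, -, hp, hx⟩
        rw [List.getD_eq_getElem _ _ hp, Finset.mem_singleton] at hx
        exact ⟨p, hp, hx.symm⟩
      · rintro ⟨p, hp, hx⟩
        refine ⟨p, Nat.zero_le p, hp, ?_⟩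
        rw [List.getD_eq_getElem _ _ hp, hx, Finset.mem_singleton]
    have hcard : (symbolsIn (fun p => {S.getD p 0}) 0 S.length).card = n := by
      rw [hsym]; exact hSn
    obtain ⟨ha1, ha2⟩ := alpha_spec n hn
    obtain ⟨k, hk⟩ := Nat.exists_eq_add_of_le' ha1
    have := length_le_sparseCoeff r c s hr (by omega)
      (fun s' hs' w hw => blockCoeff_mul_pow_le r s hs' hw) s le_rfl k (fun p => S.getD p 0) 0
      S.length (Nat.zero_le _)
      (by
        intro i j _ hij hj hSij
        beta_reduce at hSij
        rw [List.getD_eq_getElem _ _ hj, List.getD_eq_getElem _ _ (hij.trans hj)] at hSij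
        exact hsp i j (hij.trans hj) hj hij hSij)
      (by rw [hcard, ← hk]; exact ha2)
      (by
        -- The bound at parameter `s` concerns formations of length `s + 1 = |σ| + 1`; the first
        -- `|σ|` intervals already contain `σ`.
        rintro X hX ⟨d, h1, h2, h3, h4⟩
        exact hfree (contained_of_hasFormation hX
          ⟨d, h1, h2, (h1 (Nat.le_succ _)).trans h3, fun t ht => h4 t (by omega)⟩))
    rw [hcard, Nat.sub_zero, ← hk, mul_comm] at this
    exact this.trans (Nat.mul_le_mul_left _ (hC _))

/-! ### Containment of zig-zags -/

/-- `σ ≺ S` for a sequence `S` over any alphabet. -/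
def Embeds {α : Type} (σ : List ℕ) (S : List α) : Prop :=
  ∃ f : ℕ → α, Set.InjOn f {a | a ∈ σ} ∧ (σ.map f).Sublist S

theorem Embeds.of_map {α β : Type} [Nonempty α] {σ : List ℕ} {S : List α} {h : α → β}
    (hinj : Set.InjOn h {a | a ∈ S}) (hS : Embeds σ (S.map h)) : Embeds σ S := by
  obtain ⟨f, hf, hsub⟩ := hS
  obtain ⟨S', hS', heq⟩ := List.sublist_map_iff.mp hsub
  refine ⟨fun a => Function.invFunOn h {a | a ∈ S} (f a), ?_, ?_⟩
  · have hmem : ∀ a ∈ σ, ∃ x ∈ {a | a ∈ S}, h x = f a := by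
      intro a ha
      have : f a ∈ S'.map h := by rw [← heq]; exact List.mem_map_of_mem ha
      obtain ⟨x, hx, hxa⟩ := List.mem_map.mp this
      exact ⟨x, hS'.subset hx, hxa⟩
    intro a ha b hb hab
    refine hf ha hb ?_
    rw [← Function.invFunOn_eq (hmem a ha), ← Function.invFunOn_eq (hmem b hb)]
    exact congrArg h hab
  · have h1 : σ.map (fun a => Function.invFunOn h {a | a ∈ S} (f a)) =
        (σ.map f).map (Function.invFunOn h {a | a ∈ S}) := by rw [List.map_map]; rfl
    rw [h1, heq, List.map_map]
    have h2 : S'.map (Function.invFunOn h {a | a ∈ S} ∘ h) = S' := by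
      conv_rhs => rw [← List.map_id S']
      refine List.map_congr_left fun x hx => ?_
      have hx' : x ∈ S := hS'.subset hx
      have hex : ∃ y ∈ {a | a ∈ S}, h y = h x := ⟨x, hx', rfl⟩
      exact hinj (Function.invFunOn_mem hex) hx' (Function.invFunOn_eq hex)
    rw [h2]
    exact hS'

/-- The zig-zag `0 1 ⋯ l ⋯ 1 0 1 ⋯ l ⋯ 1 0 1 ⋯ l` as a function of the position. -/
def zigzagValue (l p : ℕ) : ℕ :=
  if p ≤ l then p else if p ≤ 2 * l then 2 * l - p else if p ≤ 3 * l then p - 2 * l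
  else if p ≤ 4 * l then 4 * l - p else p - 4 * l

theorem length_Z (l : ℕ) : (Z l).length = 5 * l + 1 := by
  simp [Z, ascending, descending]
  omega

theorem getElem_Z (l p : ℕ) (hp : p < (Z l).length) : (Z l)[p] = zigzagValue l p + 1 := by
  have hp' : p < 5 * l + 1 := by rwa [length_Z] at hp
  simp only [Z, ascending, descending, List.getElem_append, List.length_append, List.length_range',
    List.length_reverse, List.getElem_reverse, List.getElem_range', zigzagValue]
  split_ifs <;> omega

theorem mem_Z {l a : ℕ} : a ∈ Z l ↔ 1 ≤ a ∧ a ≤ l + 1 := by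
  simp only [Z, ascending, descending, List.mem_append, List.mem_reverse, List.mem_range'_1]
  omega

theorem numSym_Z (l : ℕ) : numSym (Z l) = l + 1 := by
  have : (Z l).toFinset = Finset.Icc 1 (l + 1) := by
    ext a
    simp [mem_Z]
  simp [numSym, this]

/-- The symbols `g 0, …, g l` occur along a zig-zag: `P i v` is the position of `g v` in the `i`-th
of the five monotone passes. -/
structure ZigZagAt {α : Type} (occ : ℕ → α → Prop) (l : ℕ) (g : ℕ → α) (P : ℕ → ℕ → ℕ) :
    Prop where
  inj : ∀ u ≤ l, ∀ v ≤ l, g u = g v → u = v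
  occ : ∀ i < 5, ∀ v ≤ l, occ (P i v) (g v)
  up₀ : ∀ u v, u < v → v ≤ l → P 0 u < P 0 v
  turn₁ : P 0 l ≤ P 1 l
  down₁ : ∀ u v, u < v → v ≤ l → P 1 v < P 1 u
  turn₂ : P 1 0 ≤ P 2 0
  up₂ : ∀ u v, u < v → v ≤ l → P 2 u < P 2 v
  turn₃ : P 2 l ≤ P 3 l
  down₃ : ∀ u v, u < v → v ≤ l → P 3 v < P 3 u
  turn₄ : P 3 0 ≤ P 4 0
  up₄ : ∀ u v, u < v → v ≤ l → P 4 u < P 4 v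

namespace ZigZagAt

variable {α : Type} {occ : ℕ → α → Prop} {l : ℕ} {g : ℕ → α} {P : ℕ → ℕ → ℕ}

theorem up₀' (h : ZigZagAt occ l g P) {u v : ℕ} (huv : u ≤ v) (hv : v ≤ l) : P 0 u ≤ P 0 v := by
  rcases huv.eq_or_lt with rfl | h'
  exacts [le_rfl, (h.up₀ u v h' hv).le]

theorem down₁' (h : ZigZagAt occ l g P) {u v : ℕ} (huv : u ≤ v) (hv : v ≤ l) : P 1 v ≤ P 1 u := by
  rcases huv.eq_or_lt with rfl | h'
  exacts [le_rfl, (h.down₁ u v h' hv).le]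

theorem up₂' (h : ZigZagAt occ l g P) {u v : ℕ} (huv : u ≤ v) (hv : v ≤ l) : P 2 u ≤ P 2 v := by
  rcases huv.eq_or_lt with rfl | h'
  exacts [le_rfl, (h.up₂ u v h' hv).le]

theorem down₃' (h : ZigZagAt occ l g P) {u v : ℕ} (huv : u ≤ v) (hv : v ≤ l) : P 3 v ≤ P 3 u := by
  rcases huv.eq_or_lt with rfl | h'
  exacts [le_rfl, (h.down₃ u v h' hv).le]

theorem up₄' (h : ZigZagAt occ l g P) {u v : ℕ} (huv : u ≤ v) (hv : v ≤ l) : P 4 u ≤ P 4 v := by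
  rcases huv.eq_or_lt with rfl | h'
  exacts [le_rfl, (h.up₄ u v h' hv).le]

theorem zero_le_one (h : ZigZagAt occ l g P) {u v : ℕ} (hu : u ≤ l) (hv : v ≤ l) :
    P 0 u ≤ P 1 v :=
  (h.up₀' hu le_rfl).trans (h.turn₁.trans (h.down₁' hv le_rfl))

theorem one_le_two (h : ZigZagAt occ l g P) {u v : ℕ} (hu : u ≤ l) (hv : v ≤ l) :
    P 1 u ≤ P 2 v :=
  (h.down₁' (Nat.zero_le u) hu).trans (h.turn₂.trans (h.up₂' (Nat.zero_le v) hv))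

theorem two_le_three (h : ZigZagAt occ l g P) {u v : ℕ} (hu : u ≤ l) (hv : v ≤ l) :
    P 2 u ≤ P 3 v :=
  (h.up₂' hu le_rfl).trans (h.turn₃.trans (h.down₃' hv le_rfl))

theorem three_le_four (h : ZigZagAt occ l g P) {u v : ℕ} (hu : u ≤ l) (hv : v ≤ l) :
    P 3 u ≤ P 4 v :=
  (h.down₃' (Nat.zero_le u) hu).trans (h.turn₄.trans (h.up₄' (Nat.zero_le v) hv))

end ZigZagAt

theorem exists_zigZagAt_of_sublist {α : Type} {S : List α} {l : ℕ} {f : ℕ → α}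
    (hf : Set.InjOn f {a | a ∈ Z l}) (hsub : ((Z l).map f).Sublist S) :
    ∃ P, ZigZagAt (fun p a => S[p]? = some a) l (fun v => f (v + 1)) P := by
  obtain ⟨φ, hφ⟩ := List.sublist_iff_exists_orderEmbedding_getElem?_eq.mp hsub
  have hφ' : ∀ p, p ≤ 5 * l → S[φ p]? = some (f (zigzagValue l p + 1)) := by
    intro p hp
    have hp' : p < (Z l).length := by rw [length_Z]; omega
    rw [← hφ p, List.getElem?_map, List.getElem?_eq_getElem hp', getElem_Z]
    rfl
  refine ⟨fun i v => φ (if i = 0 then v else if i = 1 then 2 * l - v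
    else if i = 2 then 2 * l + v else if i = 3 then 4 * l - v else 4 * l + v), ?_⟩
  constructor
  · intro u hu v hv huv
    have := hf (mem_Z.mpr ⟨by omega, by omega⟩) (mem_Z.mpr ⟨by omega, by omega⟩) huv
    omega
  · intro i hi v hv
    rw [hφ']
    · congr 3
      simp only [zigzagValue]
      interval_cases i <;> simp <;> (try split_ifs) <;> omega
    · interval_cases i <;> simp <;> omega
  all_goals
    first
    | (intro u v huv hv
       refine φ.strictMono ?_
       simp
       try omega)
    | (refine φ.monotone ?_
       simp
       try omega)

/-- Symbols taken from strictly increasing blocks form a subsequence regardless of the order inside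
the blocks. -/
theorem sublist_flatten_of_strictMono {α : Type} (L : List α) (T : List (List α)) (φ : ℕ → ℕ)
    (hφ : ∀ p q, p < q → q < L.length → φ p < φ q)
    (h : ∀ p (hp : p < L.length), ∃ B, T[φ p]? = some B ∧ L[p] ∈ B) : L.Sublist T.flatten := by
  induction L generalizing T φ with
  | nil => exact List.nil_sublist _
  | cons x L ih =>
    obtain ⟨B, hB, hx⟩ := h 0 (by simp)
    obtain ⟨hlt, hB'⟩ := List.getElem?_eq_some_iff.mp hB
    have h1 : [x].Sublist (T.take (φ 0 + 1)).flatten := by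
      rw [List.singleton_sublist, List.mem_flatten]
      refine ⟨B, ?_, by simpa using hx⟩
      rw [List.mem_iff_getElem?]
      exact ⟨φ 0, by rw [List.getElem?_take, if_pos (Nat.lt_succ_self _), hB]⟩
    have h2 : L.Sublist (T.drop (φ 0 + 1)).flatten := by
      refine ih _ (fun p => φ (p + 1) - (φ 0 + 1)) ?_ ?_
      · intro p q hpq hq
        have h1 := hφ (p + 1) (q + 1) (by omega) (by simpa using hq)
        have h2 := hφ 0 (p + 1) (by omega) (by simp; omega)
        omega
      · intro p hp
        obtain ⟨B', hB', hx'⟩ := h (p + 1) (by simpa using hp)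
        have h2 := hφ 0 (p + 1) (by omega) (by simpa using hp)
        refine ⟨B', ?_, by simpa using hx'⟩
        rw [List.getElem?_drop, ← hB']
        congr 1
        omega
    have h3 : T.flatten = (T.take (φ 0 + 1)).flatten ++ (T.drop (φ 0 + 1)).flatten := by
      rw [← List.flatten_append, List.take_append_drop]
    rw [h3]
    exact h1.append h2

/-- Within a pass the block indices are strict, so distinct symbols use distinct blocks. At a turn
the same symbol may be recorded twice in one block; only one of the two records is used, hence the
weak inequalities there. -/
theorem ZigZagAt.embeds_flatten {α : Type} {T : List (List α)} {l : ℕ} {g : ℕ → α}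
    {P : ℕ → ℕ → ℕ} (h : ZigZagAt (fun γ a => ∃ B, T[γ]? = some B ∧ a ∈ B) l g P) :
    Embeds (Z l) T.flatten := by
  refine ⟨fun a => g (a - 1), ?_, ?_⟩
  · intro a ha b hb hab
    have ha' := mem_Z.mp ha
    have hb' := mem_Z.mp hb
    have := h.inj (a - 1) (by omega) (b - 1) (by omega) hab
    omega
  · set φ : ℕ → ℕ := fun p => if p ≤ l then P 0 p else if p ≤ 2 * l then P 1 (2 * l - p)
      else if p ≤ 3 * l then P 2 (p - 2 * l) else if p ≤ 4 * l then P 3 (4 * l - p)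
      else P 4 (p - 4 * l) with hφ
    refine sublist_flatten_of_strictMono _ _ φ ?_ ?_
    · have key : ∀ p, p + 1 < 5 * l + 1 → φ p < φ (p + 1) := by
        intro p hp
        simp only [hφ]
        split_ifs with h1 h2 h3 h4 h5 h6 h7 h8 <;> first
          | omega
          | exact h.up₀ _ _ (by omega) (by omega)
          | exact h.down₁ _ _ (by omega) (by omega)
          | exact h.up₂ _ _ (by omega) (by omega)
          | exact h.down₃ _ _ (by omega) (by omega)
          | exact h.up₄ _ _ (by omega) (by omega)
          | (obtain rfl : p = l := by omega
             exact lt_of_le_of_lt h.turn₁ (h.down₁ _ _ (by omega) (by omega)))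
          | (obtain rfl : p = 2 * l := by omega
             rw [Nat.sub_self]
             exact lt_of_le_of_lt h.turn₂ (h.up₂ _ _ (by omega) (by omega)))
          | (obtain rfl : p = 3 * l := by omega
             rw [show 3 * l - 2 * l = l by omega]
             exact lt_of_le_of_lt h.turn₃ (h.down₃ _ _ (by omega) (by omega)))
          | (obtain rfl : p = 4 * l := by omega
             rw [Nat.sub_self]
             exact lt_of_le_of_lt h.turn₄ (h.up₄ _ _ (by omega) (by omega)))
      intro p q hpq hq
      rw [List.length_map, length_Z] at hq
      induction q, hpq using Nat.le_induction with
      | base => exact key p hq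
      | succ q hpq ih => exact (ih (by omega)).trans (key q hq)
    · intro p hp
      have hp' : p < (Z l).length := by simpa using hp
      have hp'' : p < 5 * l + 1 := by rwa [length_Z] at hp'
      rw [List.getElem_map, getElem_Z l p hp', Nat.add_sub_cancel]
      simp only [hφ, zigzagValue]
      split_ifs
      · exact h.occ 0 (by norm_num) _ (by omega)
      · exact h.occ 1 (by norm_num) _ (by omega)
      · exact h.occ 2 (by norm_num) _ (by omega)
      · exact h.occ 3 (by norm_num) _ (by omega)
      · exact h.occ 4 (by norm_num) _ (by omega)

theorem ZigZagAt.embeds {α : Type} {S : List α} {l : ℕ} {g : ℕ → α} {P : ℕ → ℕ → ℕ}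
    (h : ZigZagAt (fun p a => S[p]? = some a) l g P) : Embeds (Z l) S := by
  have hS : S = (S.map fun a => [a]).flatten := by
    rw [← List.flatMap_def, List.flatMap_singleton']
  rw [hS]
  refine ZigZagAt.embeds_flatten (g := g) (P := P) ⟨h.inj, fun i hi v hv => ?_, h.up₀, h.turn₁,
    h.down₁, h.turn₂, h.up₂, h.turn₃, h.down₃, h.turn₄, h.up₄⟩
  have := h.occ i hi v hv
  exact ⟨[g v], by simp [List.getElem?_map, this], by simp⟩

/-! ### Blocks of equal length -/

theorem getElem?_flatMap_of_length {α β : Type} (L : List β) (h : β → List α) (M : ℕ)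
    (hM : ∀ b ∈ L, (h b).length = M) (p : ℕ) :
    (L.flatMap h)[p]? = L[p / M]?.bind fun b => (h b)[p % M]? := by
  rcases Nat.eq_zero_or_pos M with rfl | hpos
  · have h1 : L.flatMap h = [] := by
      rw [List.flatMap_eq_nil_iff]
      exact fun b hb => List.eq_nil_of_length_eq_zero (hM b hb)
    rw [h1, Nat.div_zero, Nat.mod_zero]
    cases L with
    | nil => simp
    | cons b L =>
      have : h b = [] := List.eq_nil_of_length_eq_zero (hM b (by simp))
      simp [this]
  induction L generalizing p with
  | nil => simp
  | cons b L ih =>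
    rw [List.flatMap_cons]
    have hb : (h b).length = M := hM b (by simp)
    rcases Nat.lt_or_ge p M with hp | hp
    · rw [List.getElem?_append_left (by omega), Nat.div_eq_of_lt hp, Nat.mod_eq_of_lt hp]
      simp
    · rw [List.getElem?_append_right (by omega), hb,
        ih (fun b' hb' => hM b' (List.mem_cons_of_mem _ hb'))]
      obtain ⟨p, rfl⟩ := Nat.exists_eq_add_of_le' hp
      rw [Nat.add_sub_cancel, Nat.add_div_right _ hpos, Nat.add_mod_right]
      simp

theorem getElem?_flatten_of_length {α : Type} (T : List (List α)) (M : ℕ)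
    (hM : ∀ B ∈ T, B.length = M) (p : ℕ) :
    T.flatten[p]? = T[p / M]?.bind fun B => B[p % M]? := by
  have := getElem?_flatMap_of_length T id M hM p
  rwa [List.flatMap_id] at this

theorem length_flatMap_of_length {α β : Type} (L : List β) (h : β → List α) (M : ℕ)
    (hM : ∀ b ∈ L, (h b).length = M) : (L.flatMap h).length = L.length * M := by
  induction L with
  | nil => simp
  | cons b L ih =>
    rw [List.flatMap_cons, List.length_append, hM b (by simp),
      ih fun b' hb' => hM b' (List.mem_cons_of_mem _ hb'), List.length_cons]
    ring

/-- The symbol `a` occurs in the `γ`-th block of `T`. -/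
def Occ {α : Type} (T : Blocked α) (γ : ℕ) (a : α) : Prop := ∃ B, T[γ]? = some B ∧ a ∈ B

theorem mem_flatten_iff_occ {α : Type} {T : Blocked α} {a : α} :
    a ∈ T.flatten ↔ ∃ γ, Occ T γ a := by
  rw [List.mem_flatten]
  constructor
  · rintro ⟨B, hB, h⟩
    obtain ⟨γ, hγ⟩ := List.mem_iff_getElem?.mp hB
    exact ⟨γ, B, hγ, h⟩
  · rintro ⟨γ, B, hγ, h⟩
    exact ⟨B, List.mem_of_getElem? hγ, h⟩

/-- All blocks consist of `j` distinct symbols, there are `N` symbols, and each of them occurs `μ`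
times on average. -/
structure Shaped {α : Type} [DecidableEq α] (T : Blocked α) (j N μ : ℕ) : Prop where
  length_block : ∀ B ∈ T, B.length = j
  nodup_block : ∀ B ∈ T, B.Nodup
  card : T.flatten.toFinset.card = N
  count : T.length * j = N * μ

/-- Every block of `T` containing `a` that lies between two blocks containing `b` is the `β`-th. -/
def Outer {α : Type} (T : Blocked α) (β : ℕ) (a b : α) : Prop :=
  ∀ γ δ₁ δ₂, δ₁ ≤ γ → γ ≤ δ₂ → Occ T γ a → Occ T δ₁ b → Occ T δ₂ b → γ = β

/-- If two symbols `a`, `b` share the block `β`, at positions related by `R`, then `a` is outer. -/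
def Nested {α : Type} (R : ℕ → ℕ → Prop) (T : Blocked α) : Prop :=
  ∀ β B, T[β]? = some B → ∀ x y a b, R x y → B[x]? = some a → B[y]? = some b → Outer T β a b

/-! ### Injective renamings and canonical form -/

theorem occ_map {α β : Type} {T : Blocked α} {h : α → β} {γ : ℕ} {b : β} :
    Occ (T.map (List.map h)) γ b ↔ ∃ a, Occ T γ a ∧ h a = b := by
  simp only [Occ, List.getElem?_map, Option.map_eq_some_iff]
  constructor
  · rintro ⟨_, ⟨B, hB, rfl⟩, hb⟩
    obtain ⟨a, ha, rfl⟩ := List.mem_map.mp hb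
    exact ⟨a, ⟨B, hB, ha⟩, rfl⟩
  · rintro ⟨a, ⟨B, hB, ha⟩, rfl⟩
    exact ⟨_, ⟨B, hB, rfl⟩, List.mem_map_of_mem ha⟩

theorem flatten_map_map {α β : Type} (T : Blocked α) (h : α → β) :
    (T.map (List.map h)).flatten = T.flatten.map h := List.map_flatten.symm

theorem Shaped.map {α β : Type} [DecidableEq α] [DecidableEq β] {T : Blocked α} {j N μ : ℕ}
    (hT : Shaped T j N μ) {h : α → β} (hinj : Set.InjOn h {a | a ∈ T.flatten}) :
    Shaped (T.map (List.map h)) j N μ where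
  length_block := by
    intro B hB
    obtain ⟨B, hB', rfl⟩ := List.mem_map.mp hB
    simpa using hT.length_block B hB'
  nodup_block := by
    intro B hB
    obtain ⟨B, hB', rfl⟩ := List.mem_map.mp hB
    exact List.Nodup.map_on (fun x hx y hy hxy => hinj (List.mem_flatten.mpr ⟨B, hB', hx⟩)
      (List.mem_flatten.mpr ⟨B, hB', hy⟩) hxy) (hT.nodup_block B hB')
  card := by
    rw [flatten_map_map, ← hT.card]
    have : (T.flatten.map h).toFinset = T.flatten.toFinset.image h := by
      ext x
      simp only [List.mem_toFinset, List.mem_map, Finset.mem_image]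
    rw [this, Finset.card_image_of_injOn]
    intro a ha b hb hab
    exact hinj (by simpa using ha) (by simpa using hb) hab
  count := by simpa using hT.count

theorem Nested.map {α β : Type} {R : ℕ → ℕ → Prop} {T : Blocked α} (hT : Nested R T) {h : α → β}
    (hinj : Set.InjOn h {a | a ∈ T.flatten}) : Nested R (T.map (List.map h)) := by
  intro β B hB x y a b hxy ha hb γ δ₁ δ₂ h1 h2 oa ob₁ ob₂
  rw [List.getElem?_map, Option.map_eq_some_iff] at hB
  obtain ⟨B, hB, rfl⟩ := hB
  rw [List.getElem?_map, Option.map_eq_some_iff] at ha hb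
  obtain ⟨a, ha, rfl⟩ := ha
  obtain ⟨b, hb, rfl⟩ := hb
  obtain ⟨a', oa', haa⟩ := occ_map.mp oa
  obtain ⟨b₁, ob₁', hbb₁⟩ := occ_map.mp ob₁
  obtain ⟨b₂, ob₂', hbb₂⟩ := occ_map.mp ob₂
  have hmem : ∀ {γ c}, Occ T γ c → c ∈ T.flatten := fun hc => mem_flatten_iff_occ.mpr ⟨_, hc⟩
  have hoa : Occ T β a := ⟨B, hB, List.mem_of_getElem? ha⟩
  have hob : Occ T β b := ⟨B, hB, List.mem_of_getElem? hb⟩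
  rw [hinj (hmem oa') (hmem hoa) haa] at oa'
  rw [hinj (hmem ob₁') (hmem hob) hbb₁] at ob₁'
  rw [hinj (hmem ob₂') (hmem hob) hbb₂] at ob₂'
  exact hT β B hB x y a b hxy ha hb γ δ₁ δ₂ h1 h2 oa' ob₁' ob₂'

/-- The new name of a symbol in the canonical form. -/
def newName {α : Type} [DecidableEq α] (S : List α) (a : α) : ℕ :=
  (S.take (S.idxOf a)).toFinset.card + 1

theorem canonical_eq {α : Type} [DecidableEq α] (T : Blocked α) :
    canonical T = T.map (List.map (newName T.flatten)) := rfl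

theorem notMem_take_idxOf {α : Type} [DecidableEq α] (S : List α) (a : α) :
    a ∉ S.take (S.idxOf a) := by
  intro h
  obtain ⟨i, hi, hia⟩ := List.mem_iff_getElem.mp h
  rw [List.length_take] at hi
  rw [List.getElem_take] at hia
  have := List.not_of_lt_findIdx (p := (· == a)) (xs := S) (i := i)
    (show i < S.idxOf a by omega)
  simp [hia] at this

theorem newName_lt {α : Type} [DecidableEq α] {S : List α} {a b : α}
    (h : S.idxOf a < S.idxOf b) : newName S a < newName S b := by
  refine Nat.succ_lt_succ (Finset.card_lt_card ⟨?_, fun hsub => ?_⟩)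
  · intro x hx
    rw [List.mem_toFinset] at hx ⊢
    exact (List.take_subset_take_left S h.le) hx
  · have ha : S.idxOf a < S.length := h.trans_le List.idxOf_le_length
    have h1 : a ∈ S.take (S.idxOf b) := by
      rw [List.mem_iff_getElem?]
      exact ⟨S.idxOf a, by rw [List.getElem?_take, if_pos h, List.getElem?_idxOf
        (List.idxOf_lt_length_iff.mp ha)]⟩
    exact notMem_take_idxOf S a (List.mem_toFinset.mp (hsub (List.mem_toFinset.mpr h1)))

theorem newName_injOn {α : Type} [DecidableEq α] (S : List α) :
    Set.InjOn (newName S) {a | a ∈ S} := by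
  intro a ha b hb hab
  rcases lt_trichotomy (S.idxOf a) (S.idxOf b) with h | h | h
  · have := newName_lt h; omega
  · exact (List.idxOf_inj ha).mp h
  · have := newName_lt h; omega

theorem idxOf_map_of_injOn {α β : Type} [DecidableEq α] [DecidableEq β] {S : List α} {h : α → β}
    (hinj : Set.InjOn h {a | a ∈ S}) {a : α} (ha : a ∈ S) :
    (S.map h).idxOf (h a) = S.idxOf a := by
  induction S with
  | nil => simp at ha
  | cons x S ih =>
    rw [List.map_cons, List.idxOf_cons, List.idxOf_cons]
    by_cases hx : x = a
    · simp [hx]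
    · have hx' : h x ≠ h a := fun hh => hx (hinj (by simp) ha hh)
      have ha' : a ∈ S := by
        rcases List.mem_cons.mp ha with rfl | h'
        · exact absurd rfl hx
        · exact h'
      rw [ih (fun b hb c hc => hinj (List.mem_cons_of_mem _ hb) (List.mem_cons_of_mem _ hc)) ha',
        beq_false_of_ne hx, beq_false_of_ne hx']

/-- The symbols are `1, …, N` and their first occurrences are in increasing order. -/
structure InOrder (T : Blocked ℕ) (N : ℕ) : Prop where
  mem_iff : ∀ a, a ∈ T.flatten ↔ 1 ≤ a ∧ a ≤ N
  idxOf_lt : ∀ a b, 1 ≤ a → a < b → b ≤ N → T.flatten.idxOf a < T.flatten.idxOf b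

/-- `newName` is injective on the symbols and strictly monotone in the position of the first
occurrence, and its values are bounded by the number of symbols; so they are exactly `1, …, N`. -/
theorem inOrder_canonical {α : Type} [DecidableEq α] {T : Blocked α} {N : ℕ}
    (hN : T.flatten.toFinset.card = N) : InOrder (canonical T) N := by
  set S := T.flatten with hS
  have hflat : (canonical T).flatten = S.map (newName S) := by
    rw [canonical_eq, flatten_map_map]
  have hset : S.toFinset.image (newName S) = Finset.Icc 1 N := by
    refine Finset.eq_of_subset_of_card_le ?_ ?_
    · intro x hx
      obtain ⟨a, ha, rfl⟩ := Finset.mem_image.mp hx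
      refine Finset.mem_Icc.mpr ⟨Nat.succ_pos _, ?_⟩
      rw [← hN]
      refine Finset.card_lt_card ⟨fun x hx => ?_, fun hsub => ?_⟩
      · rw [List.mem_toFinset] at hx ⊢
        exact List.mem_of_mem_take hx
      · exact notMem_take_idxOf S a (List.mem_toFinset.mp (hsub ha))
    · rw [Finset.card_image_of_injOn, hN, Nat.card_Icc, Nat.add_sub_cancel]
      intro a ha b hb hab
      exact newName_injOn S (by simpa using ha) (by simpa using hb) hab
  have hmem : ∀ a, a ∈ S.map (newName S) ↔ 1 ≤ a ∧ a ≤ N := by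
    intro a
    rw [← Finset.mem_Icc, ← hset]
    simp
  refine ⟨by rw [hflat]; exact hmem, ?_⟩
  rw [hflat]
  intro a b ha hab hb
  obtain ⟨a, ha', rfl⟩ := List.mem_map.mp ((hmem a).mpr ⟨ha, by omega⟩)
  obtain ⟨b, hb', rfl⟩ := List.mem_map.mp ((hmem b).mpr ⟨by omega, hb⟩)
  rw [idxOf_map_of_injOn (newName_injOn S) ha', idxOf_map_of_injOn (newName_injOn S) hb']
  by_contra hlt
  rcases (not_lt.mp hlt).eq_or_lt with h | h
  · rw [(List.idxOf_inj hb').mp h] at hab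
    omega
  · have := newName_lt h
    omega

/-! ### Composition -/

theorem substitute_eq (T : Blocked ℕ) (B : List ℕ) :
    substitute T B = T.map (List.map fun k => B.getD (k - 1) 0) := rfl

theorem getD_injOn {B : List ℕ} (hB : B.Nodup) :
    Set.InjOn (fun k => B.getD (k - 1) 0) {k | 1 ≤ k ∧ k ≤ B.length} := by
  intro k hk k' hk' h
  have h1 : k - 1 < B.length := by have := hk.1; have := hk.2; omega
  have h2 : k' - 1 < B.length := by have := hk'.1; have := hk'.2; omega
  beta_reduce at h
  rw [List.getD_eq_getElem _ _ h1, List.getD_eq_getElem _ _ h2] at h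
  have := (List.Nodup.getElem_inj_iff hB).mp h
  have := hk.1
  have := hk'.1
  omega

theorem flatten_compose (top mid : Blocked ℕ) : (compose top mid).flatten =
    top.flatMap fun B => mid.flatten.map fun k => B.getD (k - 1) 0 := by
  induction top with
  | nil => rfl
  | cons B top ih =>
    rw [compose, List.flatMap_cons, List.flatten_append, ← compose, ih, List.flatMap_cons,
      substitute_eq, flatten_map_map]

theorem length_compose (top mid : Blocked ℕ) :
    (compose top mid).length = top.length * mid.length :=
  length_flatMap_of_length _ _ _ fun B _ => by simp [substitute]

/-- Multiplicities multiply, because every occurrence in `top` is replaced with all the occurrences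
of a symbol of `mid`; no symbols are created or lost. -/
theorem Shaped.compose {top mid : Blocked ℕ} {N j Nt μ ν : ℕ} (htop : Shaped top N Nt μ)
    (hmid : Shaped mid j N ν) (hord : InOrder mid N) :
    Shaped (compose top mid) j Nt (μ * ν) where
  length_block := by
    intro C hC
    obtain ⟨B, hB, hC⟩ := List.mem_flatMap.mp hC
    obtain ⟨D, hD, rfl⟩ := List.mem_map.mp hC
    simpa using hmid.length_block D hD
  nodup_block := by
    intro C hC
    obtain ⟨B, hB, hC⟩ := List.mem_flatMap.mp hC
    obtain ⟨D, hD, rfl⟩ := List.mem_map.mp hC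
    refine List.Nodup.map_on (fun x hx y hy hxy => getD_injOn (htop.nodup_block B hB) ?_ ?_ hxy)
      (hmid.nodup_block D hD)
    · rw [Set.mem_ofPred_eq, htop.length_block B hB]
      exact (hord.mem_iff x).mp (List.mem_flatten.mpr ⟨D, hD, hx⟩)
    · rw [Set.mem_ofPred_eq, htop.length_block B hB]
      exact (hord.mem_iff y).mp (List.mem_flatten.mpr ⟨D, hD, hy⟩)
  card := by
    rw [← htop.card, flatten_compose]
    congr 1
    ext x
    simp only [List.mem_toFinset, List.mem_flatMap, List.mem_map, List.mem_flatten]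
    constructor
    · rintro ⟨B, hB, k, hk, rfl⟩
      have hk' := (hord.mem_iff k).mp (List.mem_flatten.mpr hk)
      have : k - 1 < B.length := by rw [htop.length_block B hB]; omega
      rw [List.getD_eq_getElem _ _ this]
      exact ⟨B, hB, List.getElem_mem _⟩
    · rintro ⟨B, hB, hx⟩
      obtain ⟨p, hp, rfl⟩ := List.mem_iff_getElem.mp hx
      refine ⟨B, hB, p + 1, List.mem_flatten.mp ((hord.mem_iff (p + 1)).mpr ⟨by omega, ?_⟩), ?_⟩
      · rw [htop.length_block B hB] at hp; omega
      · rw [Nat.add_sub_cancel, List.getD_eq_getElem _ _ hp]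
  count := by
    rw [length_compose, mul_assoc, hmid.count, ← mul_assoc, htop.count, mul_assoc]

/-! ### Shuffling -/

/-- The common form of the two shuffles: `ins a L` inserts the symbol `a` into the block `L`. -/
def shuffle (ins : ℕ ⊕ ℕ × ℕ → List (ℕ ⊕ ℕ × ℕ) → List (ℕ ⊕ ℕ × ℕ)) (sub bot : Blocked ℕ) :
    Blocked (ℕ ⊕ ℕ × ℕ) :=
  sub.zipIdx.flatMap fun Bq =>
    List.zipWith (fun a L => ins (Sum.inl a) (L.map fun b => Sum.inr (Bq.2, b))) Bq.1 bot

/-- `ins a L` is `L` with one `a` inserted. -/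
def IsInsertion {α : Type} (ins : α → List α → List α) : Prop :=
  ∀ a L, ∃ L₁ L₂, L = L₁ ++ L₂ ∧ ins a L = L₁ ++ a :: L₂

theorem preshuffle_eq (sub bot : Blocked ℕ) :
    preshuffle sub bot = shuffle List.cons sub bot := rfl

theorem postshuffle_eq (sub bot : Blocked ℕ) :
    postshuffle sub bot = shuffle (fun a L => L ++ [a]) sub bot := rfl

theorem isInsertion_cons {α : Type} : IsInsertion (List.cons : α → List α → List α) :=
  fun _ L => ⟨[], L, rfl, rfl⟩

theorem isInsertion_concat {α : Type} : IsInsertion (fun (a : α) (L : List α) => L ++ [a]) :=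
  fun _ L => ⟨L, [], by simp, rfl⟩

theorem IsInsertion.perm {α : Type} {ins : α → List α → List α} (h : IsInsertion ins) (a : α)
    (L : List α) : (ins a L).Perm (a :: L) := by
  obtain ⟨L₁, L₂, rfl, h2⟩ := h a L
  rw [h2]
  exact List.perm_middle

theorem index_eq_of_nodup {α : Type} {L : List α} (h : L.Nodup) {i j : ℕ} {a : α}
    (hi : L[i]? = some a) (hj : L[j]? = some a) : i = j := by
  obtain ⟨hi, rfl⟩ := List.getElem?_eq_some_iff.mp hi
  obtain ⟨hj, hij⟩ := List.getElem?_eq_some_iff.mp hj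
  exact ((List.Nodup.getElem_inj_iff h).mp hij).symm

section

variable {ins : ℕ ⊕ ℕ × ℕ → List (ℕ ⊕ ℕ × ℕ) → List (ℕ ⊕ ℕ × ℕ)} {sub bot : Blocked ℕ}

theorem length_shuffle (hlen : ∀ B ∈ sub, B.length = bot.length) :
    (shuffle ins sub bot).length = sub.length * bot.length := by
  rw [shuffle, length_flatMap_of_length _ _ bot.length, List.length_zipIdx]
  intro Bq hBq
  rw [List.length_zipWith, hlen _ (List.fst_mem_of_mem_zipIdx hBq), Nat.min_self]

theorem getElem?_shuffle (hlen : ∀ B ∈ sub, B.length = bot.length) {γ : ℕ}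
    {C : List (ℕ ⊕ ℕ × ℕ)} : (shuffle ins sub bot)[γ]? = some C ↔
      ∃ B a L, sub[γ / bot.length]? = some B ∧ B[γ % bot.length]? = some a ∧
        bot[γ % bot.length]? = some L ∧
        ins (Sum.inl a) (L.map fun c => Sum.inr (γ / bot.length, c)) = C := by
  rw [shuffle, getElem?_flatMap_of_length _ _ bot.length]
  · rw [List.getElem?_zipIdx]
    constructor
    · intro h
      obtain ⟨Bq, hBq, hC⟩ := Option.bind_eq_some_iff.mp h
      obtain ⟨B, hB, rfl⟩ := Option.map_eq_some_iff.mp hBq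
      obtain ⟨a, L, ha, hL, rfl⟩ := List.getElem?_zipWith_eq_some.mp hC
      exact ⟨B, a, L, hB, ha, hL, by simp⟩
    · rintro ⟨B, a, L, hB, ha, hL, rfl⟩
      rw [hB, Option.map_some, Option.bind_some, List.getElem?_zipWith_eq_some]
      exact ⟨a, L, ha, hL, by simp⟩
  · intro Bq hBq
    rw [List.length_zipWith, hlen _ (List.fst_mem_of_mem_zipIdx hBq), Nat.min_self]

theorem occ_shuffle_inl (hins : IsInsertion ins) (hlen : ∀ B ∈ sub, B.length = bot.length)
    {γ a : ℕ} : Occ (shuffle ins sub bot) γ (Sum.inl a) ↔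
      ∃ B, sub[γ / bot.length]? = some B ∧ B[γ % bot.length]? = some a := by
  constructor
  · rintro ⟨C, hC, ha⟩
    obtain ⟨B, a', L, hB, ha', hL, rfl⟩ := (getElem?_shuffle hlen).mp hC
    rw [(hins.perm _ _).mem_iff] at ha
    obtain rfl : a = a' := by simpa using ha
    exact ⟨B, hB, ha'⟩
  · rintro ⟨B, hB, ha⟩
    have hlt := (List.getElem?_eq_some_iff.mp ha).1
    rw [hlen B (List.mem_of_getElem? hB)] at hlt
    refine ⟨_, (getElem?_shuffle hlen).mpr ⟨B, a, _, hB, ha, List.getElem?_eq_getElem hlt, rfl⟩, ?_⟩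
    rw [(hins.perm _ _).mem_iff]
    simp

theorem occ_shuffle_inr (hins : IsInsertion ins) (hlen : ∀ B ∈ sub, B.length = bot.length)
    {γ q c : ℕ} : Occ (shuffle ins sub bot) γ (Sum.inr (q, c)) ↔
      γ / bot.length = q ∧ q < sub.length ∧ Occ bot (γ % bot.length) c := by
  constructor
  · rintro ⟨C, hC, hc⟩
    obtain ⟨B, a', L, hB, ha', hL, rfl⟩ := (getElem?_shuffle hlen).mp hC
    rw [(hins.perm _ _).mem_iff] at hc
    have hlt := (List.getElem?_eq_some_iff.mp hB).1
    have hc' : c ∈ L ∧ γ / bot.length = q := by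
      simpa [and_comm, eq_comm] using hc
    exact ⟨hc'.2, hc'.2 ▸ hlt, L, hL, hc'.1⟩
  · rintro ⟨rfl, hq, L, hL, hc⟩
    have hlt := (List.getElem?_eq_some_iff.mp hL).1
    have hB := List.getElem?_eq_getElem hq
    have hlt' := hlt.trans_eq (hlen _ (List.mem_of_getElem? hB)).symm
    refine ⟨_, (getElem?_shuffle hlen).mpr ⟨_, _, L, hB, List.getElem?_eq_getElem hlt', hL, rfl⟩, ?_⟩
    rw [(hins.perm _ _).mem_iff]
    simp [hc]

/-- Both constituents have average multiplicity `μ` and their alphabets are disjoint, so the mixture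
has it as well. -/
theorem Shaped.shuffle (hins : IsInsertion ins) {j Ns Nb μ : ℕ}
    (hsub : Shaped sub bot.length Ns μ) (hbot : Shaped bot j Nb μ) :
    Shaped (shuffle ins sub bot) (j + 1) (Ns + sub.length * Nb) μ where
  length_block := by
    intro C hC
    obtain ⟨γ, hγ⟩ := List.mem_iff_getElem?.mp hC
    obtain ⟨B, a, L, hB, ha, hL, rfl⟩ := (getElem?_shuffle hsub.length_block).mp hγ
    rw [(hins.perm _ _).length_eq]
    simp [hbot.length_block L (List.mem_of_getElem? hL)]
  nodup_block := by
    intro C hC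
    obtain ⟨γ, hγ⟩ := List.mem_iff_getElem?.mp hC
    obtain ⟨B, a, L, hB, ha, hL, rfl⟩ := (getElem?_shuffle hsub.length_block).mp hγ
    rw [(hins.perm _ _).nodup_iff, List.nodup_cons]
    refine ⟨by simp, (hbot.nodup_block L (List.mem_of_getElem? hL)).map fun x y h => ?_⟩
    simpa using h
  card := by
    have hset : (ZigZag.shuffle ins sub bot).flatten.toFinset =
        sub.flatten.toFinset.disjSum (Finset.range sub.length ×ˢ bot.flatten.toFinset) := by
      ext x
      rw [List.mem_toFinset, mem_flatten_iff_occ]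
      rcases x with a | ⟨q, c⟩
      · simp only [occ_shuffle_inl hins hsub.length_block, Finset.inl_mem_disjSum,
          List.mem_toFinset, mem_flatten_iff_occ]
        constructor
        · rintro ⟨γ, B, hB, ha⟩
          exact ⟨_, B, hB, List.mem_of_getElem? ha⟩
        · rintro ⟨q, B, hB, ha⟩
          obtain ⟨p, hp⟩ := List.mem_iff_getElem?.mp ha
          have hlt := (List.getElem?_eq_some_iff.mp hp).1
          rw [hsub.length_block B (List.mem_of_getElem? hB)] at hlt
          refine ⟨q * bot.length + p, B, ?_, ?_⟩
          · rw [mul_comm, Nat.mul_add_div (by omega), Nat.div_eq_of_lt hlt, Nat.add_zero, hB]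
          · rw [mul_comm, Nat.mul_add_mod, Nat.mod_eq_of_lt hlt, hp]
      · simp only [occ_shuffle_inr hins hsub.length_block, Finset.inr_mem_disjSum,
          Finset.mem_product, Finset.mem_range, List.mem_toFinset, mem_flatten_iff_occ]
        constructor
        · rintro ⟨γ, hq, hlt, hc⟩
          exact ⟨hlt, _, hc⟩
        · rintro ⟨hlt, p, hc⟩
          have hp : p < bot.length := by
            obtain ⟨L, hL, -⟩ := hc
            exact (List.getElem?_eq_some_iff.mp hL).1
          refine ⟨q * bot.length + p, ?_, hlt, ?_⟩
          · rw [mul_comm, Nat.mul_add_div (by omega), Nat.div_eq_of_lt hp, Nat.add_zero]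
          · rwa [mul_comm, Nat.mul_add_mod, Nat.mod_eq_of_lt hp]
    rw [hset, Finset.card_disjSum, Finset.card_product, Finset.card_range, hsub.card, hbot.card]
  count := by
    rw [length_shuffle hsub.length_block, mul_add, mul_one, mul_assoc sub.length, hbot.count,
      hsub.count]
    ring

/-- A bottom symbol is confined to the span of its copy, and a top symbol occurs only once in that
span since blocks of `sub` have no repetitions. -/
theorem outer_shuffle_inl_inr (hins : IsInsertion ins)
    (hlen : ∀ B ∈ sub, B.length = bot.length) (hnodup : ∀ B ∈ sub, B.Nodup) {β a c : ℕ}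
    (ha : Occ (shuffle ins sub bot) β (Sum.inl a)) :
    Outer (shuffle ins sub bot) β (Sum.inl a) (Sum.inr (β / bot.length, c)) := by
  intro γ δ₁ δ₂ h1 h2 hγ hδ₁ hδ₂
  have e1 := ((occ_shuffle_inr hins hlen).mp hδ₁).1
  have e2 := ((occ_shuffle_inr hins hlen).mp hδ₂).1
  have h3 := Nat.div_le_div_right (c := bot.length) h1
  have h4 := Nat.div_le_div_right (c := bot.length) h2
  have e3 : γ / bot.length = β / bot.length := by omega
  obtain ⟨B, hB, hBa⟩ := (occ_shuffle_inl hins hlen).mp hγ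
  obtain ⟨B', hB', hBa'⟩ := (occ_shuffle_inl hins hlen).mp ha
  rw [e3, hB', Option.some_inj] at hB
  subst hB
  have := index_eq_of_nodup (hnodup B' (List.mem_of_getElem? hB')) hBa hBa'
  rw [← Nat.div_add_mod γ bot.length, ← Nat.div_add_mod β bot.length, e3, this]

theorem outer_shuffle_inr_inr (hins : IsInsertion ins)
    (hlen : ∀ B ∈ sub, B.length = bot.length) {β c d : ℕ}
    (h : Outer bot (β % bot.length) c d) :
    Outer (shuffle ins sub bot) β (Sum.inr (β / bot.length, c))
      (Sum.inr (β / bot.length, d)) := by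
  intro γ δ₁ δ₂ h1 h2 hγ hδ₁ hδ₂
  obtain ⟨e1, -, o1⟩ := (occ_shuffle_inr hins hlen).mp hδ₁
  obtain ⟨e2, -, o2⟩ := (occ_shuffle_inr hins hlen).mp hδ₂
  obtain ⟨e3, -, o3⟩ := (occ_shuffle_inr hins hlen).mp hγ
  have m1 := Nat.div_add_mod γ bot.length
  have m2 := Nat.div_add_mod δ₁ bot.length
  have m3 := Nat.div_add_mod δ₂ bot.length
  rw [e3] at m1
  rw [e1] at m2
  rw [e2] at m3
  have := h (γ % bot.length) (δ₁ % bot.length) (δ₂ % bot.length) (by omega) (by omega) o3 o1 o2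
  rw [← m1, this, Nat.div_add_mod]

/-- The inserted symbol is outer with respect to the bottom symbols in its block and stands first;
pairs of bottom symbols inherit nesting from `bot`. For the postshuffle the inserted symbol stands
last, which reverses the relation. -/
theorem nested_preshuffle (hlen : ∀ B ∈ sub, B.length = bot.length)
    (hnodup : ∀ B ∈ sub, B.Nodup) (hbot : Nested (· < ·) bot) :
    Nested (· < ·) (preshuffle sub bot) := by
  intro β C hC x y a b hxy ha hb
  rw [preshuffle_eq] at hC ⊢
  have oa : Occ (shuffle List.cons sub bot) β a := ⟨C, hC, List.mem_of_getElem? ha⟩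
  obtain ⟨B, s, L, hB, hs, hL, rfl⟩ := (getElem?_shuffle hlen).mp hC
  obtain ⟨y, rfl⟩ := Nat.exists_eq_add_of_lt hxy
  rw [List.getElem?_cons_succ, List.getElem?_map, Option.map_eq_some_iff] at hb
  obtain ⟨d, hd, rfl⟩ := hb
  cases x with
  | zero =>
    obtain rfl : Sum.inl s = a := by simpa using ha
    exact outer_shuffle_inl_inr isInsertion_cons hlen hnodup oa
  | succ x =>
    rw [List.getElem?_cons_succ, List.getElem?_map, Option.map_eq_some_iff] at ha
    obtain ⟨c, hc, rfl⟩ := ha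
    exact outer_shuffle_inr_inr isInsertion_cons hlen
      (hbot _ L hL x (x + 1 + y) c d (by omega) hc hd)

theorem nested_postshuffle (hlen : ∀ B ∈ sub, B.length = bot.length)
    (hnodup : ∀ B ∈ sub, B.Nodup) (hbot : Nested (· > ·) bot) :
    Nested (· > ·) (postshuffle sub bot) := by
  intro β C hC x y a b hxy ha hb
  rw [postshuffle_eq] at hC ⊢
  have oa : Occ (shuffle (fun a L => L ++ [a]) sub bot) β a := ⟨C, hC, List.mem_of_getElem? ha⟩
  obtain ⟨B, s, L, hB, hs, hL, rfl⟩ := (getElem?_shuffle hlen).mp hC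
  have hx := (List.getElem?_eq_some_iff.mp ha).1
  rw [List.length_append, List.length_map, List.length_singleton] at hx
  have hxy' : y < x := hxy
  rw [List.getElem?_append_left (by rw [List.length_map]; omega), List.getElem?_map,
    Option.map_eq_some_iff] at hb
  obtain ⟨d, hd, rfl⟩ := hb
  rcases Nat.lt_or_ge x L.length with hxL | hxL
  · rw [List.getElem?_append_left (by rw [List.length_map]; omega), List.getElem?_map,
      Option.map_eq_some_iff] at ha
    obtain ⟨c, hc, rfl⟩ := ha
    exact outer_shuffle_inr_inr isInsertion_concat hlen (hbot _ L hL x y c d hxy hc hd)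
  · rw [List.getElem?_append_right (by rw [List.length_map]; omega), List.length_map,
      show x - L.length = 0 by omega] at ha
    obtain rfl : Sum.inl s = a := by simpa using ha
    exact outer_shuffle_inl_inr isInsertion_concat hlen hnodup oa

theorem filterMap_inl_shuffle (hins : IsInsertion ins) :
    ((shuffle ins sub bot).flatten.filterMap Sum.getLeft?).Sublist sub.flatten := by
  rw [shuffle]
  generalize 0 = n
  induction sub generalizing n with
  | nil => simp
  | cons B sub ih =>
    rw [List.zipIdx_cons, List.flatMap_cons, List.flatten_append, List.filterMap_append,
      List.flatten_cons]
    refine List.Sublist.append ?_ (ih _)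
    clear ih
    simp only
    induction B generalizing bot with
    | nil => simp
    | cons a B ih =>
      cases bot with
      | nil => simp
      | cons L bot =>
        rw [List.zipWith_cons_cons, List.flatten_cons, List.filterMap_append]
        have h1 : (ins (Sum.inl a) (L.map fun b => Sum.inr (n, b))).filterMap Sum.getLeft? =
            [a] := by
          have h2 := (hins.perm (Sum.inl a) (L.map fun b => Sum.inr (n, b))).filterMap Sum.getLeft?
          rw [List.filterMap_cons] at h2
          have h3 : (L.map fun b => (Sum.inr (n, b) : ℕ ⊕ ℕ × ℕ)).filterMap Sum.getLeft? = [] := by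
            rw [List.filterMap_eq_nil_iff]
            intro x hx
            obtain ⟨b, -, rfl⟩ := List.mem_map.mp hx
            rfl
          rw [h3] at h2
          exact List.perm_singleton.mp h2
        rw [h1]
        exact (ih (bot := bot)).cons_cons a

/-- The symbols of the `q`-th copy of the bottom sequence. -/
def copySymbol (q : ℕ) : ℕ ⊕ ℕ × ℕ → Option ℕ
  | Sum.inl _ => none
  | Sum.inr (q', c) => if q' = q then some c else none

theorem filterMap_inr_shuffle (hins : IsInsertion ins) (q : ℕ) :
    ((shuffle ins sub bot).flatten.filterMap (copySymbol q)).Sublist bot.flatten := by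
  have hblock : ∀ n a (L : List ℕ),
      (ins (Sum.inl a) (L.map fun b => Sum.inr (n, b))).filterMap (copySymbol q) =
        if n = q then L else [] := by
    intro n a L
    obtain ⟨L₁, L₂, h1, h2⟩ := hins (Sum.inl a) (L.map fun b => Sum.inr (n, b))
    rw [h2, List.filterMap_append, List.filterMap_cons]
    change L₁.filterMap (copySymbol q) ++ L₂.filterMap (copySymbol q) = _
    rw [← List.filterMap_append, ← h1, List.filterMap_map]
    by_cases hn : n = q
    · rw [if_pos hn]
      conv_rhs => rw [← List.filterMap_some (l := L)]
      refine List.filterMap_congr fun c _ => ?_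
      simp [copySymbol, hn]
    · rw [if_neg hn, List.filterMap_eq_nil_iff]
      intro c _
      simp [copySymbol, hn]
  have hchunk : ∀ n (B : List ℕ), ((List.zipWith (fun a L => ins (Sum.inl a)
      (L.map fun b => Sum.inr (n, b))) B bot).flatten.filterMap (copySymbol q)).Sublist
        (if n = q then bot.flatten else []) := by
    intro n B
    induction B generalizing bot with
    | nil => simp
    | cons a B ih =>
      cases bot with
      | nil => simp
      | cons L bot =>
        rw [List.zipWith_cons_cons, List.flatten_cons, List.filterMap_append, hblock]
        have := ih (bot := bot)
        by_cases hn : n = q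
        · simp only [if_pos hn, List.flatten_cons] at this ⊢
          exact (List.Sublist.refl L).append this
        · simpa only [if_neg hn, List.nil_append] using this
  have key : ∀ n, (((sub.zipIdx n).flatMap fun Bq => List.zipWith (fun a L => ins (Sum.inl a)
      (L.map fun b => Sum.inr (Bq.2, b))) Bq.1 bot).flatten.filterMap (copySymbol q)).Sublist
        (if n ≤ q then bot.flatten else []) := by
    induction sub with
    | nil => simp
    | cons B sub ih =>
      intro n
      rw [List.zipIdx_cons, List.flatMap_cons, List.flatten_append, List.filterMap_append]
      have h1 := hchunk n B
      have h2 := ih (n + 1)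
      rcases lt_trichotomy n q with h | h | h
      · rw [if_neg (by omega)] at h1
        rw [if_pos (by omega)] at h2
        rw [if_pos (by omega)]
        exact h1.append h2
      · rw [if_pos (by omega)] at h1
        rw [if_neg (by omega)] at h2
        rw [if_pos (by omega)]
        have := h1.append h2
        rwa [List.append_nil] at this
      · rw [if_neg (by omega)] at h1
        rw [if_neg (by omega)] at h2
        rw [if_neg (by omega)]
        exact h1.append h2
  exact key 0

theorem Embeds.of_filterMap {α β : Type} {σ : List ℕ} {S : List α} {S' : List β} {f : ℕ → α}
    (hf : Set.InjOn f {a | a ∈ σ}) (hsub : (σ.map f).Sublist S) (φ : α → Option β) (g : ℕ → β)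
    (hφ : ∀ a ∈ σ, φ (f a) = some (g a))
    (hinj : ∀ x y b, φ x = some b → φ y = some b → x = y)
    (hS : (S.filterMap φ).Sublist S') : Embeds σ S' := by
  refine ⟨g, ?_, ?_⟩
  · intro a ha b hb hab
    refine hf ha hb (hinj _ _ (g a) (hφ a ha) ?_)
    rw [hφ b hb, hab]
  · have h1 : (σ.map f).filterMap φ = σ.map g := by
      rw [List.filterMap_map, ← List.filterMap_eq_map]
      exact List.filterMap_congr hφ
    rw [← h1]
    exact (hsub.filterMap φ).trans hS

/-- If one symbol of the zig-zag belongs to a bottom copy, then every other symbol occurs twice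
between two of its occurrences, hence twice in the span of that copy. A top symbol cannot do this,
so the whole zig-zag lies in that copy. -/
theorem embeds_of_embeds_shuffle (hins : IsInsertion ins) {J l : ℕ}
    (hlen : ∀ B ∈ sub, B.length = bot.length) (hnodup : ∀ B ∈ sub, B.Nodup)
    (hlen' : ∀ C ∈ shuffle ins sub bot, C.length = J)
    (hnodup' : ∀ C ∈ shuffle ins sub bot, C.Nodup)
    (h : Embeds (Z l) (shuffle ins sub bot).flatten) :
    Embeds (Z l) sub.flatten ∨ Embeds (Z l) bot.flatten := by
  set T := shuffle ins sub bot with hT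
  obtain ⟨f, hf, hsub⟩ := h
  obtain ⟨P, hP⟩ := exists_zigZagAt_of_sublist hf hsub
  have hocc : ∀ p x, T.flatten[p]? = some x →
      ∃ C, T[p / J]? = some C ∧ C[p % J]? = some x := by
    intro p x hx
    rw [getElem?_flatten_of_length T J hlen'] at hx
    exact Option.bind_eq_some_iff.mp hx
  have hchunk : ∀ p q c, T.flatten[p]? = some (Sum.inr (q, c)) → p / J / bot.length = q := by
    intro p q c hx
    obtain ⟨C, hC, hx⟩ := hocc p _ hx
    exact ((occ_shuffle_inr hins hlen).mp ⟨C, hC, List.mem_of_getElem? hx⟩).1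
  -- Positions are read in three scales: place in the block, block in the copy, copy. A repeated top
  -- symbol within one copy would have to agree in all three.
  have key : ∀ (p₁ p₂ a₁ a₂ q c c' : ℕ) (x : ℕ ⊕ ℕ × ℕ), a₁ ≤ p₁ → p₁ < p₂ → p₂ ≤ a₂ →
      T.flatten[a₁]? = some (Sum.inr (q, c)) → T.flatten[a₂]? = some (Sum.inr (q, c')) →
      T.flatten[p₁]? = some x → T.flatten[p₂]? = some x → ∃ d, x = Sum.inr (q, d) := by
    intro p₁ p₂ a₁ a₂ q c c' x h1 h2 h3 ha₁ ha₂ hp₁ hp₂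
    have c1 := hchunk _ _ _ ha₁
    have c2 := hchunk _ _ _ ha₂
    have mono : ∀ {u v : ℕ}, u ≤ v → u / J / bot.length ≤ v / J / bot.length := fun huv =>
      Nat.div_le_div_right (Nat.div_le_div_right huv)
    have d1 : p₁ / J / bot.length = q :=
      le_antisymm ((mono (h2.le.trans h3)).trans c2.le) (c1.symm.le.trans (mono h1))
    have d2 : p₂ / J / bot.length = q :=
      le_antisymm ((mono h3).trans c2.le) (c1.symm.le.trans (mono (h1.trans h2.le)))
    rcases x with a | ⟨q', d⟩
    · exfalso
      obtain ⟨C, hC, hx⟩ := hocc p₁ _ hp₁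
      obtain ⟨C', hC', hx'⟩ := hocc p₂ _ hp₂
      obtain ⟨B, hB, hBa⟩ := (occ_shuffle_inl hins hlen).mp ⟨C, hC, List.mem_of_getElem? hx⟩
      obtain ⟨B', hB', hBa'⟩ := (occ_shuffle_inl hins hlen).mp ⟨C', hC', List.mem_of_getElem? hx'⟩
      rw [d1] at hB
      rw [d2, hB, Option.some_inj] at hB'
      subst hB'
      have e1 := index_eq_of_nodup (hnodup B (List.mem_of_getElem? hB)) hBa hBa'
      have e2 : p₁ / J = p₂ / J := by
        rw [← Nat.div_add_mod (p₁ / J) bot.length, ← Nat.div_add_mod (p₂ / J) bot.length, d1, d2, e1]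
      rw [← e2, hC, Option.some_inj] at hC'
      subst hC'
      have e3 := index_eq_of_nodup (hnodup' C (List.mem_of_getElem? hC)) hx hx'
      have e4 : p₁ = p₂ := by rw [← Nat.div_add_mod p₁ J, ← Nat.div_add_mod p₂ J, e2, e3]
      omega
    · exact ⟨d, by rw [← hchunk _ _ _ hp₁, d1]⟩
  -- For `u < v` the occurrences of `v` in passes 0 and 2 lie between those of `u` in passes 0 and
  -- 3; for `v < u` one uses passes 1 and 3 of `v` between passes 0 and 4 of `u`.
  have hspread : ∀ u ≤ l, ∀ q c, f (u + 1) = Sum.inr (q, c) → ∀ v ≤ l,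
      ∃ d, f (v + 1) = Sum.inr (q, d) := by
    intro u hu q c hfu v hv
    have hoc : ∀ i < 5, T.flatten[P i u]? = some (Sum.inr (q, c)) := fun i hi => by
      rw [← hfu]; exact hP.occ i hi u hu
    rcases lt_trichotomy u v with huv | rfl | huv
    · refine key (P 0 v) (P 2 v) (P 0 u) (P 3 u) q c c _ (Nat.le_of_lt (hP.up₀ u v huv hv))
        ?_ (le_trans (hP.two_le_three hv hv) (hP.down₃ u v huv hv).le) (hoc 0 (by norm_num))
        (hoc 3 (by norm_num)) (hP.occ 0 (by norm_num) v hv) (hP.occ 2 (by norm_num) v hv)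
      exact lt_of_le_of_lt (hP.zero_le_one hv hu) (lt_of_le_of_lt (hP.one_le_two hu hu)
        (hP.up₂ u v huv hv))
    · exact ⟨c, hfu⟩
    · refine key (P 1 v) (P 3 v) (P 0 u) (P 4 u) q c c _ (hP.zero_le_one hu hv) ?_
        (hP.three_le_four hv hu) (hoc 0 (by norm_num))
        (hoc 4 (by norm_num)) (hP.occ 1 (by norm_num) v hv) (hP.occ 3 (by norm_num) v hv)
      exact lt_of_le_of_lt (hP.one_le_two hv hv) (lt_of_lt_of_le (hP.up₂ v u huv hu)
        ((hP.two_le_three hu hu).trans (hP.down₃ v u huv hu).le))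
  by_cases hall : ∀ v ≤ l, ∃ a, f (v + 1) = Sum.inl a
  · left
    refine Embeds.of_filterMap hf hsub Sum.getLeft? (fun a => ((f a).getLeft?).getD 0) ?_ ?_
      (filterMap_inl_shuffle hins)
    · intro a ha
      obtain ⟨h1, h2⟩ := mem_Z.mp ha
      obtain ⟨s, hs⟩ := hall (a - 1) (by omega)
      rw [Nat.sub_add_cancel h1] at hs
      simp [hs]
    · intro x y b hx hy
      rw [Sum.getLeft?_eq_some_iff] at hx hy
      rw [hx, hy]
  · right
    push Not at hall
    obtain ⟨u, hu, hne⟩ := hall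
    obtain ⟨q, c, hfu⟩ : ∃ q c, f (u + 1) = Sum.inr (q, c) := by
      rcases hx : f (u + 1) with a | ⟨q, c⟩
      · exact absurd hx (hne a)
      · exact ⟨q, c, rfl⟩
    refine Embeds.of_filterMap hf hsub (copySymbol q) (fun a => (copySymbol q (f a)).getD 0) ?_ ?_
      (filterMap_inr_shuffle hins q)
    · intro a ha
      obtain ⟨h1, h2⟩ := mem_Z.mp ha
      obtain ⟨d, hd⟩ := hspread u hu q c hfu (a - 1) (by omega)
      rw [Nat.sub_add_cancel h1] at hd
      simp [hd, copySymbol]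
    · have hcs : ∀ x b, copySymbol q x = some b → x = Sum.inr (q, b) := by
        rintro (a | ⟨q', c⟩) b hb
        · simp [copySymbol] at hb
        · simp only [copySymbol, Option.ite_none_right_eq_some, Option.some_inj] at hb
          rw [hb.1, hb.2]
      intro x y b hx hy
      rw [hcs x b hx, hcs y b hy]

end

/-! ### Zig-zags in compositions -/

/-- The part of a zig-zag in the copy of `w` that replaces a block `β`: the symbol `v` of the
zig-zag is the `π v`-th symbol of the block, and every copy of `w` has length `M`. -/
structure InBlock (R : ℕ → ℕ → Prop) (w : List ℕ) (N l : ℕ) (π : ℕ → ℕ) (P : ℕ → ℕ → ℕ)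
    (M β : ℕ) : Prop where
  walk : ZigZagAt (fun _ _ => True) l π P
  lt : ∀ v ≤ l, π v < N
  getElem : ∀ i < 5, ∀ v ≤ l, P i v / M = β → w[P i v % M]? = some (π v + 1)
  outer_low : ∀ u v, u < v → v ≤ l → R (π u) (π v) → P 1 u / M = β ∧ P 4 u / M = β
  outer_high : ∀ u v, u < v → v ≤ l → R (π v) (π u) → P 0 v / M = β ∧ P 3 v / M = β

theorem div_eq_of_between {M β a b c : ℕ} (ha : a / M = β) (hc : c / M = β) (hab : a ≤ b)
    (hbc : b ≤ c) : b / M = β :=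
  le_antisymm ((Nat.div_le_div_right hbc).trans hc.le) (ha.symm.le.trans (Nat.div_le_div_right hab))

theorem mod_lt_mod_of_div_eq {M a b : ℕ} (h : a / M = b / M) (hab : a < b) : a % M < b % M := by
  have h1 := Nat.div_add_mod a M
  have h2 := Nat.div_add_mod b M
  rw [h] at h1
  omega

/-- If two symbols of the zig-zag share a block `β` of `top`, one of them is outer. Two of its
passes are enclosed by occurrences of the other, so they lie in the copy of `mid` replacing `β`,
together with everything between them. This includes a full pass, whence all symbols of the zig-zag
belong to the block `β`. -/
theorem embeds_or_inBlock_of_compose {R : ℕ → ℕ → Prop} (hR : ∀ x y, x ≠ y → R x y ∨ R y x)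
    {top mid : Blocked ℕ} {N Nt μ l : ℕ} (htop : Shaped top N Nt μ) (hnest : Nested R top)
    (hord : InOrder mid N) (h : Embeds (Z l) (compose top mid).flatten) :
    Embeds (Z l) top.flatten ∨ ∃ π P M β, InBlock R mid.flatten N l π P M β := by
  set w := mid.flatten with hw
  set M := w.length with hM
  obtain ⟨f, hf, hsub⟩ := h
  obtain ⟨P, hP⟩ := exists_zigZagAt_of_sublist hf hsub
  set g : ℕ → ℕ := fun v => f (v + 1) with hg
  have hocc : ∀ i < 5, ∀ v ≤ l, ∃ B k, top[P i v / M]? = some B ∧ w[P i v % M]? = some (k + 1) ∧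
      B[k]? = some (g v) := by
    intro i hi v hv
    have h1 := hP.occ i hi v hv
    rw [flatten_compose, getElem?_flatMap_of_length _ _ M (fun B _ => by rw [List.length_map])] at h1
    obtain ⟨B, hB, h2⟩ := Option.bind_eq_some_iff.mp h1
    rw [List.getElem?_map, Option.map_eq_some_iff] at h2
    obtain ⟨k, hk, h3⟩ := h2
    obtain ⟨hk1, hk2⟩ := (hord.mem_iff k).mp (List.mem_of_getElem? hk)
    have hlt : k - 1 < B.length := by
      rw [htop.length_block B (List.mem_of_getElem? hB)]
      omega
    rw [List.getD_eq_getElem _ _ hlt] at h3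
    exact ⟨B, k - 1, hB, by rw [Nat.sub_add_cancel hk1]; exact hk,
      by rw [List.getElem?_eq_getElem hlt, h3]⟩
  have hocc' : ∀ i < 5, ∀ v ≤ l, Occ top (P i v / M) (g v) := by
    intro i hi v hv
    obtain ⟨B, k, hB, -, hk⟩ := hocc i hi v hv
    exact ⟨B, hB, List.mem_of_getElem? hk⟩
  by_cases hshare : ∃ u v β, u < v ∧ v ≤ l ∧ Occ top β (g u) ∧ Occ top β (g v)
  · right
    obtain ⟨u₀, v₀, β, huv, hv₀, ⟨B, hB, hu₀⟩, ⟨B', hB', hv₀'⟩⟩ := hshare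
    rw [hB, Option.some_inj] at hB'
    subst hB'
    have hnd := htop.nodup_block B (List.mem_of_getElem? hB)
    -- An outer `u < v` is enclosed by `v` in pass 1 (passes 0 and 2 of `v`) and in pass 4 (passes 3
    -- and 4 of `v`). An outer `v` is enclosed by `u` in pass 0 (passes 0 and 1 of `u`) and in pass
    -- 3 (passes 2 and 3 of `u`).
    have low : ∀ u v x y, u < v → v ≤ l → B[x]? = some (g u) → B[y]? = some (g v) → R x y →
        P 1 u / M = β ∧ P 4 u / M = β := by
      intro u v x y huv hv hx hy hxy
      have hu : u ≤ l := by omega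
      have hout := hnest β B hB x y (g u) (g v) hxy hx hy
      exact ⟨hout _ (P 0 v / M) (P 2 v / M)
          (Nat.div_le_div_right ((hP.zero_le_one hv hv).trans (hP.down₁ u v huv hv).le))
          (Nat.div_le_div_right (hP.one_le_two hu hv)) (hocc' 1 (by norm_num) u hu)
          (hocc' 0 (by norm_num) v hv) (hocc' 2 (by norm_num) v hv),
        hout _ (P 3 v / M) (P 4 v / M) (Nat.div_le_div_right (hP.three_le_four hv hu))
          (Nat.div_le_div_right (hP.up₄ u v huv hv).le) (hocc' 4 (by norm_num) u hu)
          (hocc' 3 (by norm_num) v hv) (hocc' 4 (by norm_num) v hv)⟩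
    have high : ∀ u v x y, u < v → v ≤ l → B[x]? = some (g u) → B[y]? = some (g v) → R y x →
        P 0 v / M = β ∧ P 3 v / M = β := by
      intro u v x y huv hv hx hy hxy
      have hu : u ≤ l := by omega
      have hout := hnest β B hB y x (g v) (g u) hxy hy hx
      exact ⟨hout _ (P 0 u / M) (P 1 u / M) (Nat.div_le_div_right (hP.up₀ u v huv hv).le)
          (Nat.div_le_div_right (hP.zero_le_one hv hu)) (hocc' 0 (by norm_num) v hv)
          (hocc' 0 (by norm_num) u hu) (hocc' 1 (by norm_num) u hu),
        hout _ (P 2 u / M) (P 3 u / M) (Nat.div_le_div_right (hP.two_le_three hu hv))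
          (Nat.div_le_div_right (hP.down₃ u v huv hv).le) (hocc' 3 (by norm_num) v hv)
          (hocc' 2 (by norm_num) u hu) (hocc' 3 (by norm_num) u hu)⟩
    obtain ⟨x₀, hx₀⟩ := List.mem_iff_getElem?.mp hu₀
    obtain ⟨y₀, hy₀⟩ := List.mem_iff_getElem?.mp hv₀'
    have hu₀l : u₀ ≤ l := by omega
    have hne : x₀ ≠ y₀ := by
      rintro rfl
      rw [hx₀, Option.some_inj] at hy₀
      have := hP.inj u₀ hu₀l v₀ hv₀ hy₀
      omega
    -- Between passes 1 and 4 of one symbol lies all of pass 2; between passes 0 and 3 lies all of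
    -- pass 1.
    have hall : ∀ v ≤ l, ∃ x : ℕ, B[x]? = some (g v) := by
      intro v hv
      have : ∃ i < 5, P i v / M = β := by
        rcases hR x₀ y₀ hne with hxy | hxy
        · obtain ⟨h1, h2⟩ := low u₀ v₀ x₀ y₀ huv hv₀ hx₀ hy₀ hxy
          exact ⟨2, by norm_num, div_eq_of_between h1 h2 (hP.one_le_two hu₀l hv)
            ((hP.two_le_three hv hv).trans (hP.three_le_four hv hu₀l))⟩
        · obtain ⟨h1, h2⟩ := high u₀ v₀ x₀ y₀ huv hv₀ hx₀ hy₀ hxy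
          exact ⟨1, by norm_num, div_eq_of_between h1 h2 (hP.zero_le_one hv₀ hv)
            ((hP.one_le_two hv hv).trans (hP.two_le_three hv hv₀))⟩
      obtain ⟨i, hi, hβ⟩ := this
      obtain ⟨B', k, hB', -, hk⟩ := hocc i hi v hv
      rw [hβ, hB, Option.some_inj] at hB'
      subst hB'
      exact ⟨k, hk⟩
    choose! π hπ using hall
    refine ⟨π, P, M, β, ⟨?_, fun _ _ _ _ => trivial, hP.up₀, hP.turn₁, hP.down₁, hP.turn₂, hP.up₂,
      hP.turn₃, hP.down₃, hP.turn₄, hP.up₄⟩, ?_, ?_, ?_, ?_⟩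
    · intro u hu v hv h
      refine hP.inj u hu v hv ?_
      have h1 := hπ u hu
      rw [h, hπ v hv, Option.some_inj] at h1
      exact h1.symm
    · intro v hv
      rw [← htop.length_block B (List.mem_of_getElem? hB)]
      exact (List.getElem?_eq_some_iff.mp (hπ v hv)).1
    · intro i hi v hv hβ
      obtain ⟨B', k, hB', hk, hk'⟩ := hocc i hi v hv
      rw [hβ, hB, Option.some_inj] at hB'
      subst hB'
      rw [hk, index_eq_of_nodup hnd hk' (hπ v hv)]
    · exact fun u v huv hv => low u v _ _ huv hv (hπ u (by omega)) (hπ v hv)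
    · exact fun u v huv hv => high u v _ _ huv hv (hπ u (by omega)) (hπ v hv)
  · left
    -- Without shared blocks, distinct symbols have distinct block indices, so the strict order of
    -- positions passes to block indices.
    have hsep : ∀ i < 5, ∀ u v, u ≠ v → u ≤ l → v ≤ l → P i u / M ≠ P i v / M := by
      intro i hi u v huv hu hv heq
      have h1 := hocc' i hi u hu
      have h2 := hocc' i hi v hv
      rw [← heq] at h2
      rcases lt_or_gt_of_ne huv with h | h
      · exact hshare ⟨u, v, _, h, hv, h1, h2⟩
      · exact hshare ⟨v, u, _, h, hu, h2, h1⟩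
    have hstep : ∀ i < 5, ∀ u v, u ≠ v → u ≤ l → v ≤ l → P i u < P i v → P i u / M < P i v / M :=
      fun i hi u v huv hu hv hlt =>
        lt_of_le_of_ne (Nat.div_le_div_right hlt.le) (hsep i hi u v huv hu hv)
    refine ZigZagAt.embeds_flatten (g := g) (P := fun i v => P i v / M) ⟨hP.inj, hocc', ?_, ?_, ?_,
      ?_, ?_, ?_, ?_, ?_, ?_⟩
    · exact fun u v huv hv => hstep 0 (by norm_num) u v (by omega) (by omega) hv (hP.up₀ u v huv hv)
    · exact Nat.div_le_div_right hP.turn₁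
    · exact fun u v huv hv => hstep 1 (by norm_num) v u (by omega) hv (by omega)
        (hP.down₁ u v huv hv)
    · exact Nat.div_le_div_right hP.turn₂
    · exact fun u v huv hv => hstep 2 (by norm_num) u v (by omega) (by omega) hv (hP.up₂ u v huv hv)
    · exact Nat.div_le_div_right hP.turn₃
    · exact fun u v huv hv => hstep 3 (by norm_num) v u (by omega) hv (by omega)
        (hP.down₃ u v huv hv)
    · exact Nat.div_le_div_right hP.turn₄
    · exact fun u v huv hv => hstep 4 (by norm_num) u v (by omega) (by omega) hv (hP.up₄ u v huv hv)

theorem getElem?_idxOf_of_mem {S : List ℕ} {a : ℕ} (h : a ∈ S) : S[S.idxOf a]? = some a :=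
  List.getElem?_idxOf h

theorem idxOf_le_of_getElem? {S : List ℕ} {a p : ℕ} (h : S[p]? = some a) : S.idxOf a ≤ p := by
  by_contra hlt
  obtain ⟨hp, hpa⟩ := List.getElem?_eq_some_iff.mp h
  have := List.not_of_lt_findIdx (p := (· == a)) (xs := S) (i := p) (not_le.mp hlt)
  simp [hpa] at this

/-- If the earlier symbols of a block are outer, one third of a zig-zag lies in the copy of the
middle sequence. -/
theorem InBlock.embeds {mid : Blocked ℕ} {N m : ℕ} {π : ℕ → ℕ} {P : ℕ → ℕ → ℕ} {M β : ℕ}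
    (hord : InOrder mid N) (hm : 1 ≤ m)
    (h : InBlock (· < ·) mid.flatten N (3 * m) π P M β) : Embeds (Z m) mid.flatten := by
  set w := mid.flatten with hw
  have hW := h.walk
  have hlt : ∀ {a b}, a / M = β → b / M = β → a < b → a % M < b % M := fun ha hb hab =>
    mod_lt_mod_of_div_eq (ha.trans hb.symm) hab
  have hle : ∀ {a b}, a / M = β → b / M = β → a ≤ b → a % M ≤ b % M := fun ha hb hab => by
    rcases hab.eq_or_lt with rfl | hab
    exacts [le_rfl, (hlt ha hb hab).le]
  have hfirst : ∀ v ≤ 3 * m, w[w.idxOf (π v + 1)]? = some (π v + 1) := fun v hv =>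
    getElem?_idxOf_of_mem ((hord.mem_iff _).mpr ⟨by omega, h.lt v hv⟩)
  -- Here an outer symbol `p ≥ m` confines passes 1 to 4 of the first third to the copy. As block
  -- indices increase along this third, the first occurrences in canonical order can replace pass 0.
  by_cases hA : (∀ u v, u < v → v ≤ m → π u < π v) ∧
      ∃ u v, m ≤ u ∧ u < v ∧ v ≤ 3 * m ∧ π u < π v
  · obtain ⟨hinc, p, v, hp, hpv, hv, hlow⟩ := hA
    obtain ⟨h1, h4⟩ := h.outer_low p v hpv hv hlow
    have hp3 : p ≤ 3 * m := by omega
    have in1 : ∀ u ≤ m, P 1 u / M = β := fun u hu => div_eq_of_between h1 h4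
      (hW.down₁' (by omega) hp3) ((hW.one_le_two (by omega) hp3).trans
        ((hW.two_le_three hp3 hp3).trans (hW.three_le_four hp3 hp3)))
    have in2 : ∀ u ≤ m, P 2 u / M = β := fun u hu => div_eq_of_between h1 h4
      (hW.one_le_two hp3 (by omega)) ((hW.two_le_three (by omega) hp3).trans
        (hW.three_le_four hp3 hp3))
    have in3 : ∀ u ≤ m, P 3 u / M = β := fun u hu => div_eq_of_between h1 h4
      ((hW.one_le_two hp3 hp3).trans (hW.two_le_three hp3 (by omega)))
      (hW.three_le_four (by omega) hp3)
    have in4 : ∀ u ≤ m, P 4 u / M = β := fun u hu => div_eq_of_between h1 h4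
      ((hW.one_le_two hp3 hp3).trans ((hW.two_le_three hp3 hp3).trans
        (hW.three_le_four hp3 (by omega)))) (hW.up₄' (by omega) hp3)
    refine ZigZagAt.embeds (g := fun v => π v + 1) (P := fun i v => if i = 0 then w.idxOf (π v + 1)
      else P i v % M) ⟨?_, ?_, ?_, ?_, ?_, ?_, ?_, ?_, ?_, ?_, ?_⟩
    · intro u hu v hv huv
      exact hW.inj u (by omega) v (by omega) (by simpa using huv)
    · intro i hi v hv
      rcases Nat.eq_zero_or_pos i with rfl | hi0
      · exact hfirst v (by omega)
      · simp only [hi0.ne', if_false]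
        refine h.getElem i hi v (by omega) ?_
        interval_cases i
        exacts [in1 v hv, in2 v hv, in3 v hv, in4 v hv]
    · intro u v huv hv
      have := hinc u v huv hv
      exact hord.idxOf_lt _ _ (by omega) (by omega) (h.lt v (by omega))
    · exact idxOf_le_of_getElem? (h.getElem 1 (by norm_num) m (by omega) (in1 m le_rfl))
    · exact fun u v huv hv => hlt (in1 v hv) (in1 u (by omega)) (hW.down₁ u v huv (by omega))
    · exact hle (in1 0 (by omega)) (in2 0 (by omega)) hW.turn₂
    · exact fun u v huv hv => hlt (in2 u (by omega)) (in2 v hv) (hW.up₂ u v huv (by omega))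
    · exact hle (in2 m le_rfl) (in3 m le_rfl) (hW.two_le_three (by omega) (by omega))
    · exact fun u v huv hv => hlt (in3 v hv) (in3 u (by omega)) (hW.down₃ u v huv (by omega))
    · exact hle (in3 0 (by omega)) (in4 0 (by omega)) hW.turn₄
    · exact fun u v huv hv => hlt (in4 u (by omega)) (in4 v hv) (hW.up₄ u v huv (by omega))
  -- The mirror image: an outer symbol `q ≤ 2 * m` confines passes 0 to 3 of the last third. Read
  -- backwards these become passes 1 to 4, and first occurrences, now increasing in reversed order,
  -- supply pass 0.
  by_cases hC : (∀ u v, 2 * m ≤ u → u < v → v ≤ 3 * m → π v < π u) ∧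
      ∃ u v, u < v ∧ v ≤ 2 * m ∧ π v < π u
  · obtain ⟨hdec, u, q, huq, hq, hhigh⟩ := hC
    obtain ⟨h0, h3⟩ := h.outer_high u q huq (by omega) hhigh
    have hq3 : q ≤ 3 * m := by omega
    have in0 : ∀ v, 2 * m ≤ v → v ≤ 3 * m → P 0 v / M = β := fun v hv hv' =>
      div_eq_of_between h0 h3 (hW.up₀' (by omega) hv') ((hW.zero_le_one hv' hq3).trans
        ((hW.one_le_two hq3 hq3).trans (hW.two_le_three hq3 hq3)))
    have in1 : ∀ v, 2 * m ≤ v → v ≤ 3 * m → P 1 v / M = β := fun v hv hv' =>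
      div_eq_of_between h0 h3 (hW.zero_le_one hq3 hv') ((hW.one_le_two hv' hq3).trans
        (hW.two_le_three hq3 hq3))
    have in2 : ∀ v, 2 * m ≤ v → v ≤ 3 * m → P 2 v / M = β := fun v hv hv' =>
      div_eq_of_between h0 h3 ((hW.zero_le_one hq3 hq3).trans (hW.one_le_two hq3 hv'))
        (hW.two_le_three hv' hq3)
    have in3 : ∀ v, 2 * m ≤ v → v ≤ 3 * m → P 3 v / M = β := fun v hv hv' =>
      div_eq_of_between h0 h3 ((hW.zero_le_one hq3 hq3).trans ((hW.one_le_two hq3 hq3).trans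
        (hW.two_le_three hq3 hv'))) (hW.down₃' (by omega) hv')
    refine ZigZagAt.embeds (g := fun v => π (3 * m - v) + 1) (P := fun i v =>
      if i = 0 then w.idxOf (π (3 * m - v) + 1) else P (i - 1) (3 * m - v) % M)
      ⟨?_, ?_, ?_, ?_, ?_, ?_, ?_, ?_, ?_, ?_, ?_⟩
    · intro u hu v hv huv
      have := hW.inj (3 * m - u) (by omega) (3 * m - v) (by omega) (by simpa using huv)
      omega
    · intro i hi v hv
      rcases Nat.eq_zero_or_pos i with rfl | hi0
      · exact hfirst _ (by omega)
      · simp only [hi0.ne', if_false]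
        refine h.getElem (i - 1) (by omega) _ (by omega) ?_
        interval_cases i
        exacts [in0 _ (by omega) (by omega), in1 _ (by omega) (by omega),
          in2 _ (by omega) (by omega), in3 _ (by omega) (by omega)]
    · intro u v huv hv
      have := hdec (3 * m - v) (3 * m - u) (by omega) (by omega) (by omega)
      exact hord.idxOf_lt _ _ (by omega) (by omega) (h.lt _ (by omega))
    · exact idxOf_le_of_getElem? (h.getElem 0 (by norm_num) _ (by omega)
        (in0 _ (by omega) (by omega)))
    · exact fun u v huv hv => hlt (in0 _ (by omega) (by omega)) (in0 _ (by omega) (by omega))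
        (hW.up₀ _ _ (by omega) (by omega))
    · exact hle (in0 _ (by omega) (by omega)) (in1 _ (by omega) (by omega)) hW.turn₁
    · exact fun u v huv hv => hlt (in1 _ (by omega) (by omega)) (in1 _ (by omega) (by omega))
        (hW.down₁ _ _ (by omega) (by omega))
    · exact hle (in1 _ (by omega) (by omega)) (in2 _ (by omega) (by omega))
        (hW.one_le_two (by omega) (by omega))
    · exact fun u v huv hv => hlt (in2 _ (by omega) (by omega)) (in2 _ (by omega) (by omega))
        (hW.up₂ _ _ (by omega) (by omega))
    · exact hle (in2 _ (by omega) (by omega)) (in3 _ (by omega) (by omega)) hW.turn₃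
    · exact fun u v huv hv => hlt (in3 _ (by omega) (by omega)) (in3 _ (by omega) (by omega))
        (hW.down₃ _ _ (by omega) (by omega))
  have hne : ∀ u v, u < v → v ≤ 3 * m → ¬ π u < π v → π v < π u := fun u v huv hv hn =>
    lt_of_le_of_ne (not_lt.mp hn) fun heq => by
      have := hW.inj v hv u (by omega) heq
      omega
  -- A descent of `π` in the first third would put pass 0 of its upper symbol into the copy. Without
  -- one, `π` increases there; the first case having failed, `π` decreases from `m` on, which is the
  -- second case.
  obtain ⟨q, hq, h0⟩ : ∃ q ≤ m, P 0 q / M = β := by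
    by_contra hcon
    have hinc : ∀ u v, u < v → v ≤ m → π u < π v := by
      intro u v huv hv
      by_contra hn
      exact hcon ⟨v, hv, (h.outer_high u v huv (by omega) (hne u v huv (by omega) hn)).1⟩
    have hdec : ∀ u v, m ≤ u → u < v → v ≤ 3 * m → π v < π u := by
      intro u v hu huv hv
      exact hne u v huv hv fun hlt => hA ⟨hinc, u, v, hu, huv, hv, hlt⟩
    exact hC ⟨fun u v hu => hdec u v (by omega), m, m + 1, by omega, by omega,
      hdec m (m + 1) le_rfl (by omega) (by omega)⟩
  -- Symmetrically, an ascent in the last third gives the desired `p`. Without one, the failure of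
  -- the second case makes `π` increase up to `2 * m`, which is the first case.
  obtain ⟨p, hp, hp3, h4⟩ : ∃ p, 2 * m ≤ p ∧ p ≤ 3 * m ∧ P 4 p / M = β := by
    by_contra hcon
    have hdec : ∀ u v, 2 * m ≤ u → u < v → v ≤ 3 * m → π v < π u := by
      intro u v hu huv hv
      exact hne u v huv hv fun hlt =>
        hcon ⟨u, hu, by omega, (h.outer_low u v huv hv hlt).2⟩
    have hinc : ∀ u v, u < v → v ≤ 2 * m → π u < π v := by
      intro u v huv hv
      by_contra hn
      exact hC ⟨hdec, u, v, huv, hv, hne u v huv (by omega) hn⟩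
    exact hA ⟨fun u v huv hv => hinc u v huv (by omega), m, m + 1, le_rfl, by omega, by omega,
      hinc m (m + 1) (by omega) (by omega)⟩
  -- All five passes of the middle third lie between pass 0 of `q` and pass 4 of `p`, so they form a
  -- complete zig-zag in one copy.
  have hin : ∀ i < 5, ∀ v, m ≤ v → v ≤ 2 * m → P i v / M = β := by
    intro i hi v hv hv'
    have hv3 : v ≤ 3 * m := by omega
    have b0 : P 0 q ≤ P 0 v := hW.up₀' (by omega) hv3
    have b1 : P 0 v ≤ P 1 v := hW.zero_le_one hv3 hv3
    have b2 : P 1 v ≤ P 2 v := hW.one_le_two hv3 hv3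
    have b3 : P 2 v ≤ P 3 v := hW.two_le_three hv3 hv3
    have b4 : P 3 v ≤ P 4 v := hW.three_le_four hv3 hv3
    have b5 : P 4 v ≤ P 4 p := hW.up₄' (by omega) hp3
    interval_cases i <;> exact div_eq_of_between h0 h4 (by omega) (by omega)
  refine ZigZagAt.embeds (g := fun v => π (v + m) + 1) (P := fun i v => P i (v + m) % M)
    ⟨?_, ?_, ?_, ?_, ?_, ?_, ?_, ?_, ?_, ?_, ?_⟩
  · intro u hu v hv huv
    have := hW.inj (u + m) (by omega) (v + m) (by omega) (by simpa using huv)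
    omega
  · exact fun i hi v hv => h.getElem i hi _ (by omega) (hin i hi _ (by omega) (by omega))
  · exact fun u v huv hv => hlt (hin 0 (by norm_num) _ (by omega) (by omega))
      (hin 0 (by norm_num) _ (by omega) (by omega)) (hW.up₀ _ _ (by omega) (by omega))
  · exact hle (hin 0 (by norm_num) _ (by omega) (by omega))
      (hin 1 (by norm_num) _ (by omega) (by omega)) (hW.zero_le_one (by omega) (by omega))
  · exact fun u v huv hv => hlt (hin 1 (by norm_num) _ (by omega) (by omega))
      (hin 1 (by norm_num) _ (by omega) (by omega)) (hW.down₁ _ _ (by omega) (by omega))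
  · exact hle (hin 1 (by norm_num) _ (by omega) (by omega))
      (hin 2 (by norm_num) _ (by omega) (by omega)) (hW.one_le_two (by omega) (by omega))
  · exact fun u v huv hv => hlt (hin 2 (by norm_num) _ (by omega) (by omega))
      (hin 2 (by norm_num) _ (by omega) (by omega)) (hW.up₂ _ _ (by omega) (by omega))
  · exact hle (hin 2 (by norm_num) _ (by omega) (by omega))
      (hin 3 (by norm_num) _ (by omega) (by omega)) (hW.two_le_three (by omega) (by omega))
  · exact fun u v huv hv => hlt (hin 3 (by norm_num) _ (by omega) (by omega))
      (hin 3 (by norm_num) _ (by omega) (by omega)) (hW.down₃ _ _ (by omega) (by omega))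
  · exact hle (hin 3 (by norm_num) _ (by omega) (by omega))
      (hin 4 (by norm_num) _ (by omega) (by omega)) (hW.three_le_four (by omega) (by omega))
  · exact fun u v huv hv => hlt (hin 4 (by norm_num) _ (by omega) (by omega))
      (hin 4 (by norm_num) _ (by omega) (by omega)) (hW.up₄ _ _ (by omega) (by omega))

theorem getElem?_ascending_append_descending {j p k : ℕ}
    (h : (ascending j ++ descending j)[p]? = some k) :
    (p < j ∧ k = p + 1) ∨ (j ≤ p ∧ p < 2 * j ∧ k = 2 * j - p) := by
  obtain ⟨hp, rfl⟩ := List.getElem?_eq_some_iff.mp h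
  simp only [ascending, descending, List.length_append, List.length_range',
    List.length_reverse] at hp
  simp only [ascending, descending, List.getElem_append, List.length_range', List.getElem_reverse,
    List.getElem_range']
  split_ifs <;> omega

/-- If the later symbols of a block are outer, no alternation lies in a copy of `1 ⋯ j j ⋯ 1`. -/
theorem not_inBlock_ascending_descending {j N : ℕ} {π : ℕ → ℕ} {P : ℕ → ℕ → ℕ} {M β : ℕ} :
    ¬ InBlock (· > ·) (ascending j ++ descending j) N 1 π P M β := by
  intro h
  have hW := h.walk
  have hmod : ∀ {a b}, a / M = β → b / M = β → a < b → a % M < b % M := fun ha hb hab =>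
    mod_lt_mod_of_div_eq (ha.trans hb.symm) hab
  have b1 := hW.turn₁
  have b2 := hW.down₁ 0 1 (by norm_num) le_rfl
  have b3 := hW.turn₂
  have b4 := hW.up₂ 0 1 (by norm_num) le_rfl
  have b5 := hW.turn₃
  have b6 := hW.down₃ 0 1 (by norm_num) le_rfl
  have b7 := hW.turn₄
  -- Either way the enclosed stretch contains `y x y` with `y` the larger index. On two symbols `x <
  -- y`, the sequence `1 ⋯ j j ⋯ 1` reads `x y y x`, which has no such pattern.
  rcases lt_trichotomy (π 0) (π 1) with hlt | heq | hlt
  · obtain ⟨h1, h2⟩ := h.outer_high 0 1 (by norm_num) le_rfl hlt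
    have i1 := div_eq_of_between h1 h2 (b := P 1 0) (by omega) (by omega)
    have i2 := div_eq_of_between h1 h2 (b := P 1 1) (by omega) (by omega)
    have i3 := div_eq_of_between h1 h2 (b := P 2 1) (by omega) (by omega)
    have e1 := getElem?_ascending_append_descending (h.getElem 1 (by norm_num) 0 (by norm_num) i1)
    have e2 := getElem?_ascending_append_descending (h.getElem 1 (by norm_num) 1 (by norm_num) i2)
    have e3 := getElem?_ascending_append_descending (h.getElem 2 (by norm_num) 1 (by norm_num) i3)
    have l1 := hmod i2 i1 b2
    have l2 := hmod i1 i3 (by omega)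
    omega
  · have := hW.inj 0 (by norm_num) 1 le_rfl heq
    omega
  · obtain ⟨h1, h2⟩ := h.outer_low 0 1 (by norm_num) le_rfl hlt
    have i1 := div_eq_of_between h1 h2 (b := P 2 0) (by omega) (by omega)
    have i2 := div_eq_of_between h1 h2 (b := P 2 1) (by omega) (by omega)
    have i3 := div_eq_of_between h1 h2 (b := P 3 0) (by omega) (by omega)
    have e1 := getElem?_ascending_append_descending (h.getElem 2 (by norm_num) 0 (by norm_num) i1)
    have e2 := getElem?_ascending_append_descending (h.getElem 2 (by norm_num) 1 (by norm_num) i2)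
    have e3 := getElem?_ascending_append_descending (h.getElem 3 (by norm_num) 0 (by norm_num) i3)
    have l1 := hmod i1 i2 b4
    have l2 := hmod i2 i3 (by omega)
    omega

/-! ### The sequences `U` for the patterns of zig-zags -/

/-- The middle sequence in the construction of `U (zPattern k)`. -/
def midU : ℕ → ℕ → ℕ → Blocked ℕ
  | 0, i, b => U [.up, .down] i b
  | k + 1, i, b => U (zPattern k) i b

theorem length_zPattern (k : ℕ) : (zPattern k).length = 2 * k + 4 := by
  simp [zPattern]
  omega

theorem multiplicity_zPattern (k i : ℕ) :
    multiplicity (zPattern k) i = 2 ^ (i + k).choose (k + 1) := by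
  have : ((zPattern k).length - 2) / 2 = k + 1 := by rw [length_zPattern]; omega
  rw [multiplicity, this]
  congr 2

theorem U_up_down (i j : ℕ) : U [.up, .down] i j = [ascending j, descending j] := by
  rw [U]
  simp

theorem U_zero (k j : ℕ) : U (zPattern k) 0 j = [ascending j] := by
  rw [U, if_neg (by rw [length_zPattern]; omega), if_pos rfl]

theorem U_one (k i : ℕ) : U (zPattern k) (i + 1) 1 =
    List.replicate (2 ^ (i + 1 + k).choose (k + 1)) [1] := by
  rw [U, if_neg (by rw [length_zPattern]; omega), if_neg (by omega), if_pos le_rfl,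
    multiplicity_zPattern]

theorem truncation_zPattern_succ (k : ℕ) : truncation (zPattern (k + 1)) = zPattern k := by
  rw [truncation, zPattern, List.replicate_succ, List.cons_append, List.cons_append, List.tail_cons,
    List.replicate_succ' (n := k + 1), ← List.append_assoc, List.dropLast_concat, zPattern]

/-- Truncating `zPattern (k + 1)` gives `zPattern k`, with preshuffling. Only `k = 0` uses the
postshuffle, where `↘ ↗` is flipped to `↗ ↘`. -/
theorem U_succ_succ (k i j : ℕ) (hj : 1 ≤ j) : U (zPattern k) (i + 1) (j + 1) =
    canonical ((if k = 0 then postshuffle else preshuffle)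
      (compose (U (zPattern k) i
        (numSym (midU k (i + 1) (U (zPattern k) (i + 1) j).length).flatten))
        (midU k (i + 1) (U (zPattern k) (i + 1) j).length)) (U (zPattern k) (i + 1) j)) := by
  rw [U, if_neg (by rw [length_zPattern]; omega), if_neg (by omega), if_neg (by omega)]
  cases k with
  | zero =>
    simp [zPattern, truncation, midU, Diag.flip]
  | succ k =>
    have h1 : (zPattern (k + 1))[1]? = some .up := by
      simp [zPattern, List.replicate_succ]
    have h2 : (zPattern (k + 1))[(zPattern (k + 1)).length - 2]? = some .down := by
      rw [length_zPattern, zPattern, List.getElem?_append_right (by simp),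
        List.getElem?_replicate, if_pos]
      simp
      omega
    rw [if_pos ⟨h1, h2⟩, truncation_zPattern_succ]
    simp [midU]

/-- The invariants of the Class II sequences that are used in the constructions. -/
structure Regular (T : Blocked ℕ) (j N μ : ℕ) : Prop where
  shaped : Shaped T j N μ
  inOrder : InOrder T N

theorem toFinset_ascending (j : ℕ) : (ascending j).toFinset = Finset.Icc 1 j := by
  ext a
  simp only [ascending, List.mem_toFinset, List.mem_range'_1, Finset.mem_Icc]
  omega

theorem idxOf_ascending_append {j a : ℕ} (S : List ℕ) (ha : 1 ≤ a) (haj : a ≤ j) :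
    (ascending j ++ S).idxOf a = a - 1 := by
  have h1 : (ascending j ++ S)[a - 1]? = some a := by
    rw [List.getElem?_append_left (by simp [ascending]; omega)]
    simp only [ascending]
    rw [List.getElem?_range' (by omega)]
    congr 1
    omega
  have h2 := idxOf_le_of_getElem? h1
  have hmem : a ∈ ascending j := by
    rw [← List.mem_toFinset, toFinset_ascending, Finset.mem_Icc]
    exact ⟨ha, haj⟩
  have h3 := getElem?_idxOf_of_mem (List.mem_append_left S hmem)
  have h4 : (ascending j ++ S).idxOf a < j := by omega
  rw [List.getElem?_append_left (by simpa [ascending] using h4)] at h3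
  simp only [ascending] at h3 h4 ⊢
  rw [List.getElem?_range' h4] at h3
  simp only [Option.some_inj] at h3
  omega

theorem regular_ascending (j : ℕ) : Regular [ascending j] j j 1 where
  shaped := {
    length_block := by simp [ascending]
    nodup_block := by simp [ascending, List.nodup_range']
    card := by simp [toFinset_ascending]
    count := by simp }
  inOrder := {
    mem_iff := fun a => by
      simp only [List.flatten_singleton]
      rw [← List.mem_toFinset, toFinset_ascending, Finset.mem_Icc]
    idxOf_lt := fun a b ha hab hb => by
      rw [List.flatten_singleton, ← List.append_nil (ascending j),
        idxOf_ascending_append _ ha (by omega), idxOf_ascending_append _ (by omega) hb]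
      omega }

theorem regular_ascending_descending (j : ℕ) : Regular [ascending j, descending j] j j 2 where
  shaped := {
    length_block := by simp [ascending, descending]
    nodup_block := by simp [ascending, descending, List.nodup_range']
    card := by simp [descending, toFinset_ascending]
    count := by simp [mul_comm] }
  inOrder := {
    mem_iff := fun a => by
      rw [← List.mem_toFinset]
      simp [descending, toFinset_ascending]
    idxOf_lt := fun a b ha hab hb => by
      rw [List.flatten_cons, idxOf_ascending_append _ ha (by omega),
        idxOf_ascending_append _ (by omega) hb]
      omega }

theorem regular_replicate {μ : ℕ} (hμ : 1 ≤ μ) : Regular (List.replicate μ [1]) 1 1 μ := by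
  have hmem : ∀ a, a ∈ (List.replicate μ [1]).flatten ↔ a = 1 := fun a => by
    simp only [List.mem_flatten, List.mem_replicate]
    constructor
    · rintro ⟨l, ⟨-, rfl⟩, h⟩
      simpa using h
    · rintro rfl
      exact ⟨[1], ⟨by omega, rfl⟩, by simp⟩
  refine ⟨⟨?_, ?_, ?_, ?_⟩, ?_, ?_⟩
  · intro B hB
    simp [List.eq_of_mem_replicate hB]
  · intro B hB
    simp [List.eq_of_mem_replicate hB]
  · rw [Finset.card_eq_one]
    refine ⟨1, ?_⟩
    ext a
    rw [List.mem_toFinset, hmem, Finset.mem_singleton]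
  · simp
  · intro a
    rw [hmem]
    omega
  · intro a b ha hab hb
    omega

/-- The invariants of `U (zPattern k)`, including the nesting property. -/
structure ZRegular (k : ℕ) (T : Blocked ℕ) (j N μ : ℕ) : Prop extends Regular T j N μ where
  nested : Nested (if k = 0 then (· > ·) else (· < ·)) T

theorem Regular.numSym_eq {T : Blocked ℕ} {j N μ : ℕ} (h : Regular T j N μ) :
    numSym T.flatten = N := h.shaped.card

theorem shaped_shuffle_of_eq {k j Ns Nb μ : ℕ} {sub bot : Blocked ℕ}
    (hsub : Shaped sub bot.length Ns μ) (hbot : Shaped bot j Nb μ) :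
    Shaped ((if k = 0 then postshuffle else preshuffle) sub bot) (j + 1)
      (Ns + sub.length * Nb) μ := by
  split_ifs
  · exact hsub.shuffle isInsertion_concat hbot
  · exact hsub.shuffle isInsertion_cons hbot

/-- Pascal's rule: top and middle multiplicities combine to the new one. -/
theorem multiplicity_succ (i k : ℕ) :
    2 ^ (i + k).choose (k + 1) * 2 ^ (i + k).choose k = 2 ^ (i + 1 + k).choose (k + 1) := by
  rw [← pow_add, show i + 1 + k = (i + k) + 1 by ring, Nat.choose_succ_succ, add_comm]

theorem regular_midU_of {k i : ℕ}
    (ih : ∀ k' < k, ∀ b, 1 ≤ b → ∃ N, 1 ≤ N ∧ ZRegular k' (U (zPattern k') (i + 1) b) b N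
      (2 ^ (i + 1 + k').choose (k' + 1))) (b : ℕ) (hb : 1 ≤ b) :
    ∃ N, 1 ≤ N ∧ Regular (midU k (i + 1) b) b N (2 ^ (i + k).choose k) := by
  cases k with
  | zero =>
    rw [midU, U_up_down]
    exact ⟨b, hb, by simpa using regular_ascending_descending b⟩
  | succ k =>
    obtain ⟨N, hN1, hN⟩ := ih k (Nat.lt_succ_self k) b hb
    refine ⟨N, hN1, ?_⟩
    rw [show i + (k + 1) = i + 1 + k by ring]
    exact hN.toRegular

theorem nested_of_length_le_one {R : ℕ → ℕ → Prop} {T : Blocked ℕ} (hT : T.length ≤ 1) :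
    Nested R T := by
  rintro β B hB x y a b - - - γ - - - - ⟨C, hC, -⟩ - -
  have := (List.getElem?_eq_some_iff.mp hB).1
  have := (List.getElem?_eq_some_iff.mp hC).1
  omega

theorem nested_of_length_block_le_one {R : ℕ → ℕ → Prop} (hR : ∀ x, ¬ R x x) {T : Blocked ℕ}
    (hT : ∀ B ∈ T, B.length ≤ 1) : Nested R T := by
  rintro β B hB x y a b hxy ha hb
  have := hT B (List.mem_of_getElem? hB)
  have := (List.getElem?_eq_some_iff.mp ha).1
  have := (List.getElem?_eq_some_iff.mp hb).1
  obtain rfl : x = y := by omega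
  exact absurd hxy (hR x)

/-- Outer induction on `k` supplies the middle sequence, induction on `i` the top and induction on
`j` the bottom. Nesting is needed only of the shuffled result and comes from the bottom. -/
theorem exists_zRegular (k i j : ℕ) (hj : 1 ≤ j) :
    ∃ N, 1 ≤ N ∧ ZRegular k (U (zPattern k) i j) j N (2 ^ (i + k).choose (k + 1)) := by
  induction k using Nat.strong_induction_on generalizing i j with
  | _ k ihk =>
  induction i generalizing j with
  | zero =>
    refine ⟨j, hj, ?_⟩
    rw [U_zero, Nat.zero_add, Nat.choose_succ_self, pow_zero]
    exact ⟨regular_ascending j, nested_of_length_le_one (by simp)⟩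
  | succ i ihi =>
    induction j, hj using Nat.le_induction with
    | base =>
      refine ⟨1, le_rfl, ?_⟩
      rw [U_one]
      refine ⟨regular_replicate Nat.one_le_two_pow, nested_of_length_block_le_one ?_ ?_⟩
      · intro x
        split_ifs <;> exact lt_irrefl x
      · intro B hB
        simp [List.eq_of_mem_replicate hB]
    | succ j hj ihj =>
      obtain ⟨Nb, hNb, hbot⟩ := ihj
      set bot := U (zPattern k) (i + 1) j with hbot'
      have hb : 1 ≤ bot.length := by
        have := hbot.shaped.count
        have h2 : 1 ≤ Nb * 2 ^ (i + 1 + k).choose (k + 1) := Nat.mul_pos hNb (by positivity)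
        by_contra h0
        rw [show bot.length = 0 by omega] at this
        omega
      obtain ⟨Nm, hNm, hmid⟩ := regular_midU_of (i := i) (fun k' hk' b hb =>
        ihk k' hk' (i + 1) b hb) bot.length hb
      set mid := midU k (i + 1) bot.length with hmid'
      obtain ⟨Nt, hNt, htop⟩ := ihi Nm hNm
      set top := U (zPattern k) i Nm with htop'
      have hsub := htop.shaped.compose hmid.shaped hmid.inOrder
      rw [multiplicity_succ] at hsub
      have hsh := shaped_shuffle_of_eq (k := k) hsub hbot.shaped
      refine ⟨Nt + (compose top mid).length * Nb, Nat.le_add_right_of_le hNt, ?_⟩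
      rw [U_succ_succ k i j hj, ← hbot', ← hmid', hmid.numSym_eq, ← htop']
      refine ⟨⟨hsh.map (newName_injOn _), inOrder_canonical hsh.card⟩,
        Nested.map ?_ (newName_injOn _)⟩
      have hn := hbot.nested
      split_ifs with hk
      · rw [if_pos hk] at hn
        exact nested_postshuffle hsub.length_block hsub.nodup_block hn
      · rw [if_neg hk] at hn
        exact nested_preshuffle hsub.length_block hsub.nodup_block hn

theorem zRegular_U (k i j : ℕ) (hj : 1 ≤ j) : ZRegular k (U (zPattern k) i j) j
    (numSym (U (zPattern k) i j).flatten) (2 ^ (i + k).choose (k + 1)) := by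
  obtain ⟨N, -, h⟩ := exists_zRegular k i j hj
  rwa [h.numSym_eq]

theorem one_le_numSym_U (k i j : ℕ) (hj : 1 ≤ j) :
    1 ≤ numSym (U (zPattern k) i j).flatten := by
  obtain ⟨N, hN, h⟩ := exists_zRegular k i j hj
  rwa [h.numSym_eq]

theorem one_le_length_U (k i j : ℕ) (hj : 1 ≤ j) : 1 ≤ (U (zPattern k) i j).length := by
  have h1 := (zRegular_U k i j hj).shaped.count
  have h2 : 1 ≤ numSym (U (zPattern k) i j).flatten * 2 ^ (i + k).choose (k + 1) :=
    Nat.mul_pos (one_le_numSym_U k i j hj) (by positivity)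
  by_contra h0
  rw [show (U (zPattern k) i j).length = 0 by omega] at h1
  omega

theorem regular_midU (k i b : ℕ) (hb : 1 ≤ b) : Regular (midU k (i + 1) b) b
    (numSym (midU k (i + 1) b).flatten) (2 ^ (i + k).choose k) := by
  obtain ⟨N, -, h⟩ := regular_midU_of (k := k) (i := i)
    (fun k' _ b hb => exists_zRegular k' (i + 1) b hb) b hb
  rwa [h.numSym_eq]

theorem one_le_numSym_midU (k i b : ℕ) (hb : 1 ≤ b) :
    1 ≤ numSym (midU k (i + 1) b).flatten := by
  obtain ⟨N, hN, h⟩ := regular_midU_of (k := k) (i := i)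
    (fun k' _ b hb => exists_zRegular k' (i + 1) b hb) b hb
  rwa [h.numSym_eq]

theorem shaped_compose_U (k i j : ℕ) (hj : 1 ≤ j) {bot mid top : Blocked ℕ}
    (hbot : bot = U (zPattern k) (i + 1) j) (hmid : mid = midU k (i + 1) bot.length)
    (htop : top = U (zPattern k) i (numSym mid.flatten)) :
    Shaped (compose top mid) bot.length (numSym top.flatten)
      (2 ^ (i + 1 + k).choose (k + 1)) := by
  have hb : 1 ≤ bot.length := hbot ▸ one_le_length_U k (i + 1) j hj
  have hm := regular_midU k i bot.length hb
  have hm1 := one_le_numSym_midU k i bot.length hb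
  rw [← hmid] at hm hm1
  have ht := zRegular_U k i (numSym mid.flatten) hm1
  rw [← htop] at ht
  have := ht.shaped.compose hm.shaped hm.inOrder
  rwa [multiplicity_succ] at this

theorem isInsertion_ite {α : Type} {p : Prop} [Decidable p] :
    IsInsertion (if p then fun (a : α) (L : List α) => L ++ [a] else List.cons) := by
  split_ifs
  exacts [isInsertion_concat, isInsertion_cons]

theorem ite_shuffle_eq (k : ℕ) (sub bot : Blocked ℕ) :
    (if k = 0 then postshuffle else preshuffle) sub bot =
      shuffle (if k = 0 then fun a L => L ++ [a] else List.cons) sub bot := by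
  split_ifs <;> rfl

theorem length_U_succ_succ (k i j : ℕ) (hj : 1 ≤ j) {bot mid top : Blocked ℕ}
    (hbot : bot = U (zPattern k) (i + 1) j) (hmid : mid = midU k (i + 1) bot.length)
    (htop : top = U (zPattern k) i (numSym mid.flatten)) :
    (U (zPattern k) (i + 1) (j + 1)).length = top.length * mid.length * bot.length ∧
      numSym (U (zPattern k) (i + 1) (j + 1)).flatten =
        numSym top.flatten + top.length * mid.length * numSym bot.flatten := by
  have hsub := shaped_compose_U k i j hj hbot hmid htop
  have hb := (zRegular_U k (i + 1) j hj).shaped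
  rw [← hbot] at hb
  rw [U_succ_succ k i j hj, ← hbot, ← hmid, ← htop, canonical_eq, ite_shuffle_eq]
  have hs := (hsub.shuffle (ins := if k = 0 then fun a L => L ++ [a] else List.cons)
    isInsertion_ite hb).map (newName_injOn _)
  refine ⟨?_, ?_⟩
  · rw [List.length_map, length_shuffle hsub.length_block, length_compose]
  · rw [← length_compose]
    exact hs.card

/-! ### Avoidance of zig-zags -/

theorem not_embeds_of_nodup {l : ℕ} (hl : 1 ≤ l) {S : List ℕ} (hS : S.Nodup) :
    ¬ Embeds (Z l) S := by
  rintro ⟨f, hf, hsub⟩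
  have h3 := List.toFinset_card_of_nodup (List.Nodup.of_map f (hsub.nodup hS))
  have h4 : (Z l).toFinset.card = l + 1 := numSym_Z l
  rw [length_Z] at h3
  omega

theorem not_embeds_of_forall_eq {l : ℕ} (hl : 1 ≤ l) {S : List ℕ} {c : ℕ}
    (hS : ∀ a ∈ S, a = c) : ¬ Embeds (Z l) S := by
  rintro ⟨f, hf, hsub⟩
  have h1 : (1 : ℕ) ∈ Z l := mem_Z.mpr ⟨le_rfl, by omega⟩
  have h2 : (2 : ℕ) ∈ Z l := mem_Z.mpr ⟨by norm_num, by omega⟩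
  have h3 := hf h1 h2 ((hS _ (hsub.subset (List.mem_map_of_mem h1))).trans
    (hS _ (hsub.subset (List.mem_map_of_mem h2))).symm)
  omega

/-- A forbidden zig-zag would descend to the bottom, to the top, or, with length divided by 3, to
the middle sequence; each is excluded by one of the three inductions. -/
theorem not_contained_U (k i j : ℕ) (hj : 1 ≤ j) :
    ¬ Contained (Z (3 ^ k)) (U (zPattern k) i j).flatten := by
  have hl : ∀ k, 1 ≤ 3 ^ k := fun k => Nat.one_le_pow _ _ (by norm_num)
  change ¬ Embeds (Z (3 ^ k)) (U (zPattern k) i j).flatten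
  induction k using Nat.strong_induction_on generalizing i j with
  | _ k ihk =>
  induction i generalizing j with
  | zero =>
    rw [U_zero, List.flatten_singleton]
    exact not_embeds_of_nodup (hl k) (by simp [ascending, List.nodup_range'])
  | succ i ihi =>
    induction j, hj using Nat.le_induction with
    | base =>
      refine not_embeds_of_forall_eq (c := 1) (hl k) fun a ha => ?_
      rw [U_one] at ha
      obtain ⟨L, hL, ha⟩ := List.mem_flatten.mp ha
      rw [List.eq_of_mem_replicate hL] at ha
      simpa using ha
    | succ j hj ihj =>
      intro h
      set bot := U (zPattern k) (i + 1) j with hbot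
      have hb : 1 ≤ bot.length := one_le_length_U k (i + 1) j hj
      set mid := midU k (i + 1) bot.length with hmid
      set top := U (zPattern k) i (numSym mid.flatten) with htop
      have hm1 : 1 ≤ numSym mid.flatten := one_le_numSym_midU k i bot.length hb
      have hm := regular_midU k i bot.length hb
      have ht := zRegular_U k i (numSym mid.flatten) hm1
      have hsub := shaped_compose_U k i j hj hbot hmid htop
      rw [U_succ_succ k i j hj, ← hbot, ← hmid, ← htop, canonical_eq, flatten_map_map,
        ite_shuffle_eq] at h
      have hs := hsub.shuffle (ins := if k = 0 then fun a L => L ++ [a] else List.cons)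
        isInsertion_ite (zRegular_U k (i + 1) j hj).shaped
      rcases embeds_of_embeds_shuffle isInsertion_ite hsub.length_block hsub.nodup_block
        hs.length_block hs.nodup_block (Embeds.of_map (newName_injOn _) h) with h | h
      · cases k with
        | zero =>
          rcases embeds_or_inBlock_of_compose (R := (· > ·)) (fun x y hxy => (lt_or_gt_of_ne hxy).symm)
            ht.shaped (by simpa using ht.nested) hm.inOrder h with h | ⟨π, P, M, β, h⟩
          · exact ihi _ hm1 h
          · have hflat : (midU 0 (i + 1) bot.length).flatten =
                ascending bot.length ++ descending bot.length := by
              rw [midU, U_up_down]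
              simp
            rw [hmid, hflat] at h
            exact not_inBlock_ascending_descending h
        | succ k =>
          rcases embeds_or_inBlock_of_compose (R := (· < ·)) (fun x y hxy => lt_or_gt_of_ne hxy)
            ht.shaped (by simpa using ht.nested) hm.inOrder h with h | ⟨π, P, M, β, h⟩
          · exact ihi _ hm1 h
          · rw [pow_succ, mul_comm] at h
            exact ihk k (Nat.lt_succ_self k) (i + 1) bot.length hb
              (InBlock.embeds hm.inOrder (hl k) h)
      · exact ihj h

/-! ### The size of the Class II sequences -/

theorem six_mul_add_two_le (n p : ℕ) (hp : 2 ≤ p) :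
    6 * ackermannTable (n + 2) p + 2 ≤ ackermannTable (n + 2) (p + 1) := by
  refine le_trans ?_ (two_pow_mul_le_ackermannTable n p (by omega))
  set w := ackermannTable (n + 2) p with hw
  have h1 : 2 ^ 2 ≤ w := (Nat.pow_le_pow_right (by norm_num) hp).trans
    (two_pow_le_ackermannTable (n + 1) p (by omega))
  have h2 : 2 ^ 4 ≤ 2 ^ w := Nat.pow_le_pow_right (by norm_num) (by omega)
  have h3 : w * 2 ^ 4 ≤ w * 2 ^ w := Nat.mul_le_mul_left _ h2
  omega

/-- Feeding a quantity already bounded in row `n + 3` into the size bound of the row below costs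
only two columns. -/
theorem ackermannTable_six_mul_add_two_le (n p b : ℕ) (hp : 2 ≤ p)
    (hb : b ≤ ackermannTable (n + 3) p) :
    ackermannTable (n + 2) (6 * b + 2) ≤ ackermannTable (n + 3) (p + 2) := by
  refine le_trans ?_ (ackermannTable_comp_le (n + 1) (p + 1) (by omega))
  refine ackermannTable_mono_right (n + 1) (by omega) ?_
  exact (Nat.add_le_add_right (Nat.mul_le_mul_left 6 hb) 2).trans (six_mul_add_two_le (n + 1) p hp)

theorem choose_le_two_pow' (n k : ℕ) : 2 ^ n.choose k ≤ ackermannTable (n + 2) 3 := by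
  refine le_trans ?_ (two_pow_mul_le_ackermannTable n 2 (by norm_num))
  have h1 : ackermannTable (n + 2) 2 = 2 ^ (n + 3) := ackermannTable_two_right (n + 1)
  rw [h1]
  have h2 : n.choose k ≤ 2 ^ (n + 3) := by
    refine le_trans ?_ (Nat.pow_le_pow_right (by norm_num) (Nat.le_add_right n 3))
    rcases Nat.lt_or_ge n k with h | h
    · simp [Nat.choose_eq_zero_of_lt h]
    · rw [← Nat.sum_range_choose n]
      exact Finset.single_le_sum (f := fun i => n.choose i) (fun _ _ => Nat.zero_le _)
        (Finset.mem_range.mpr (by omega))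
  exact (Nat.pow_le_pow_right (by norm_num) h2).trans
    (Nat.le_mul_of_pos_left _ (by positivity))

/-- Six columns are available per unit of `j`: two for the middle sequence built from the number of
bottom blocks, two for the top built from the number of middle symbols, and two squarings for the
product of three factors. -/
theorem size_U_le (k i j : ℕ) (hj : 1 ≤ j) :
    numSym (U (zPattern k) i j).flatten ≤ ackermannTable (i + k + 2) (6 * j + 2) ∧
      (U (zPattern k) i j).length ≤ ackermannTable (i + k + 2) (6 * j + 2) := by
  induction k using Nat.strong_induction_on generalizing i j with
  | _ k ihk =>
  induction i generalizing j with
  | zero =>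
    have h := lt_ackermannTable (0 + k + 1) (6 * j + 2) (by omega)
    rw [U_zero, (regular_ascending j).numSym_eq, List.length_singleton]
    constructor
    · exact le_trans (by omega) h.le
    · exact le_trans (by omega) h.le
  | succ i ihi =>
    induction j, hj using Nat.le_induction with
    | base =>
      have h := lt_ackermannTable (i + 1 + k + 1) (6 * 1 + 2) (by omega)
      rw [U_one, (regular_replicate Nat.one_le_two_pow).numSym_eq, List.length_replicate]
      refine ⟨le_trans (by omega) h.le, ?_⟩
      exact (choose_le_two_pow' _ _).trans (ackermannTable_mono_right _ (by norm_num) (by norm_num))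
    | succ j hj ihj =>
      set bot := U (zPattern k) (i + 1) j with hbot
      have hb1 : 1 ≤ bot.length := one_le_length_U k (i + 1) j hj
      set mid := midU k (i + 1) bot.length with hmid
      set top := U (zPattern k) i (numSym mid.flatten) with htop
      have hm1 : 1 ≤ numSym mid.flatten := one_le_numSym_midU k i bot.length hb1
      obtain ⟨e1, e2⟩ := length_U_succ_succ k i j hj hbot hmid htop
      rw [e1, e2]
      set p := 6 * j + 2 with hp
      rw [show i + 1 + k + 2 = (i + k) + 3 by ring] at ihj ⊢
      rw [show 6 * (j + 1) + 2 = p + 4 + 1 + 1 by omega]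
      set n := i + k with hn
      obtain ⟨hNb, hb⟩ := ihj
      have hmidle : numSym mid.flatten ≤ ackermannTable (n + 3) (p + 2) ∧
          mid.length ≤ ackermannTable (n + 3) (p + 2) := by
        have hle := ackermannTable_six_mul_add_two_le n p bot.length (by omega) hb
        cases k with
        | zero =>
          have h := lt_ackermannTable (n + 1) (6 * bot.length + 2) (by omega)
          rw [hmid, midU, U_up_down]
          rw [(regular_ascending_descending bot.length).numSym_eq]
          simp only [List.length_cons, List.length_nil]
          constructor
          · exact le_trans (by omega) (h.le.trans hle)
          · exact le_trans (by omega) (h.le.trans hle)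
        | succ k =>
          obtain ⟨h1, h2⟩ := ihk k (Nat.lt_succ_self k) (i + 1) bot.length hb1
          rw [show i + 1 + k + 2 = n + 2 by omega] at h1 h2
          exact ⟨h1.trans hle, h2.trans hle⟩
      obtain ⟨t1, t2⟩ := ihi (numSym mid.flatten) hm1
      have hle := ackermannTable_six_mul_add_two_le n (p + 2) _ (by omega) hmidle.1
      have t1 := t1.trans hle
      have t2 := t2.trans hle
      have m1 : ackermannTable (n + 3) p ≤ ackermannTable (n + 3) (p + 4) :=
        ackermannTable_mono_right (n + 2) (by omega) (by omega)
      have m2 : ackermannTable (n + 3) (p + 2) ≤ ackermannTable (n + 3) (p + 4) :=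
        ackermannTable_mono_right (n + 2) (by omega) (by omega)
      have q1 := sq_le_ackermannTable (n + 1) (p + 4) (by omega)
      have q2 := sq_le_ackermannTable (n + 1) (p + 4 + 1) (by omega)
      have y2 : 2 ≤ ackermannTable (n + 3) (p + 4) := two_le_ackermannTable (n + 2) _ (by omega)
      rw [show p + 2 + 2 = p + 4 by ring] at t1 t2
      set y := ackermannTable (n + 3) (p + 4) with hy
      -- Each step to the next column at least squares the entry.
      have hbig : y ^ 4 ≤ ackermannTable (n + 3) (p + 4 + 1 + 1) := by
        calc y ^ 4 = (y ^ 2) ^ 2 := by ring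
          _ ≤ _ := (Nat.pow_le_pow_left q1 2).trans q2
      have hprod : top.length * mid.length ≤ y * y := Nat.mul_le_mul t2 (hmidle.2.trans m2)
      have hy3 : y + y * y * y ≤ y ^ 4 := by
        have h1 : y ≤ y * y * y := by nlinarith
        calc y + y * y * y ≤ 2 * (y * y * y) := by omega
          _ ≤ y * (y * y * y) := Nat.mul_le_mul_right _ y2
          _ = y ^ 4 := by ring
      constructor
      · calc _ ≤ y + y * y * y := Nat.add_le_add t1 (Nat.mul_le_mul hprod (hNb.trans m1))
          _ ≤ _ := hy3.trans hbig
      · calc _ ≤ y * y * y := Nat.mul_le_mul hprod (hb.trans m1)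
          _ ≤ _ := (Nat.le_add_left _ _).trans (hy3.trans hbig)

/-! ### Lower bounds for the extremal functions of zig-zags -/

theorem Sparse.append {r : ℕ} {S S' : List ℕ} (hS : Sparse r S) (hS' : Sparse r S')
    (h : ∀ (i j : ℕ) (hi : i < S.length) (hj : j < S'.length), S[i] = S'[j] →
      r ≤ S.length + j - i) : Sparse r (S ++ S') := by
  intro i j hi hj hij heq
  rw [List.length_append] at hi hj
  rcases Nat.lt_or_ge j S.length with hjS | hjS
  · rw [List.getElem_append_left (by omega), List.getElem_append_left hjS] at heq
    exact hS i j (by omega) hjS hij heq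
  · rw [List.getElem_append_right hjS] at heq
    rcases Nat.lt_or_ge i S.length with hiS | hiS
    · rw [List.getElem_append_left hiS] at heq
      have := h i (j - S.length) hiS (by omega) heq
      omega
    · rw [List.getElem_append_right hiS] at heq
      have := hS' (i - S.length) (j - S.length) (by omega) (by omega) (by omega) heq
      omega

theorem Sparse.append_of_disjoint {r : ℕ} {S S' : List ℕ} (hS : Sparse r S) (hS' : Sparse r S')
    (h : ∀ a ∈ S, a ∉ S') : Sparse r (S ++ S') :=
  hS.append hS' fun _ _ hi hj heq =>
    absurd (heq ▸ List.getElem_mem hj) (h _ (List.getElem_mem hi))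

theorem sparse_of_nodup (r : ℕ) {S : List ℕ} (hS : S.Nodup) : Sparse r S := by
  intro i j hi hj hij heq
  have := (List.Nodup.getElem_inj_iff hS).mp heq
  omega

theorem Sparse.map {r : ℕ} {S : List ℕ} (hS : Sparse r S) {f : ℕ → ℕ}
    (hf : Function.Injective f) : Sparse r (S.map f) := by
  intro i j hi hj hij heq
  rw [List.getElem_map, List.getElem_map] at heq
  exact hS i j (by simpa using hi) (by simpa using hj) hij (hf heq)

/-- A sequence of blocks of length `j` becomes `r`-sparse when at most `r - 1` symbols are deleted
from each block. -/
theorem exists_sparse_sublist (r j : ℕ) (T : Blocked ℕ)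
    (hT : ∀ B ∈ T, B.length = j ∧ B.Nodup) :
    ∃ S : List ℕ, S.Sublist T.flatten ∧ Sparse r S ∧ T.length * (j - (r - 1)) ≤ S.length := by
  induction T using List.reverseRecOn with
  | nil => exact ⟨[], by simp, sparse_of_nodup r List.nodup_nil, by simp⟩
  | append_singleton T B ih =>
    obtain ⟨S, h1, h2, h3⟩ := ih fun B hB => hT B (List.mem_append_left _ hB)
    obtain ⟨hBl, hBn⟩ := hT B (by simp)
    -- Greedy thinning: symbols among the last `r - 1` kept are deleted from the next block. As the
    -- block has no repetitions, at most `r - 1` entries go.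
    set D := S.drop (S.length - (r - 1)) with hD
    refine ⟨S ++ B.filter (· ∉ D), ?_, ?_, ?_⟩
    · rw [List.flatten_append, List.flatten_singleton]
      exact h1.append List.filter_sublist
    · refine h2.append (sparse_of_nodup r (hBn.filter _)) fun i j hi hj heq => ?_
      have hmem : (B.filter (· ∉ D))[j] ∉ D := by
        have := List.of_mem_filter (List.getElem_mem hj)
        simpa using this
      by_contra hlt
      refine hmem ?_
      rw [← heq, hD, List.mem_iff_getElem]
      refine ⟨i - (S.length - (r - 1)), by rw [List.length_drop]; omega, ?_⟩
      rw [List.getElem_drop]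
      congr 1
      omega
    · have hle : (B.filter (· ∈ D)).length ≤ r - 1 := by
        have h4 : (B.filter (· ∈ D)).length ≤ D.length := by
          refine (List.subperm_of_subset (hBn.filter _) fun a ha => ?_).length_le
          simpa using List.of_mem_filter ha
        have h5 : D.length ≤ r - 1 := by
          rw [hD, List.length_drop]
          omega
        omega
      have hsum := List.length_eq_length_filter_add (l := B) (fun a => decide (a ∈ D))
      have hneg : (B.filter fun a => !decide (a ∈ D)).length = (B.filter (· ∉ D)).length := by
        simp
      rw [List.length_append, List.length_append, List.length_singleton, add_mul, one_mul]
      omega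

theorem embeds_append {l : ℕ} {S S' : List ℕ} (hdisj : ∀ a ∈ S, a ∉ S')
    (h : Embeds (Z l) (S ++ S')) : Embeds (Z l) S ∨ Embeds (Z l) S' := by
  obtain ⟨f, hf, hsub⟩ := h
  obtain ⟨P, hP⟩ := exists_zigZagAt_of_sublist hf hsub
  have hmem : ∀ v ≤ l, ∀ i < 5, (f (v + 1) ∈ S ∧ P i v < S.length) ∨
      (f (v + 1) ∉ S ∧ f (v + 1) ∈ S' ∧ S.length ≤ P i v) := by
    intro v hv i hi
    have h1 := hP.occ i hi v hv
    rcases Nat.lt_or_ge (P i v) S.length with hlt | hge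
    · rw [List.getElem?_append_left hlt] at h1
      exact Or.inl ⟨List.mem_of_getElem? h1, hlt⟩
    · rw [List.getElem?_append_right hge] at h1
      have h2 := List.mem_of_getElem? h1
      exact Or.inr ⟨fun h3 => hdisj _ h3 h2, h2, hge⟩
  have hinj : ∀ (L : List ℕ) (x y b : ℕ), (if x ∈ L then some x else none) = some b →
      (if y ∈ L then some y else none) = some b → x = y := by
    intro L x y b hx hy
    simp only [Option.ite_none_right_eq_some, Option.some_inj] at hx hy
    rw [hx.2, hy.2]
  have hkeep : ∀ (L L' : List ℕ), (∀ a ∈ L', a ∈ L) →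
      L'.filterMap (fun a => if a ∈ L then some a else none) = L' := by
    intro L L' h
    conv_rhs => rw [← List.filterMap_some (l := L')]
    exact List.filterMap_congr fun a ha => if_pos (h a ha)
  have hdrop : ∀ (L L' : List ℕ), (∀ a ∈ L', a ∉ L) →
      L'.filterMap (fun a => if a ∈ L then some a else none) = [] := by
    intro L L' h
    rw [List.filterMap_eq_nil_iff]
    exact fun a ha => if_neg (h a ha)
  by_cases hall : ∀ v ≤ l, f (v + 1) ∈ S
  · left
    refine Embeds.of_filterMap hf hsub (fun a => if a ∈ S then some a else none) f ?_ (hinj S) ?_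
    · intro a ha
      obtain ⟨h1, h2⟩ := mem_Z.mp ha
      have := hall (a - 1) (by omega)
      rw [Nat.sub_add_cancel h1] at this
      exact if_pos this
    · rw [List.filterMap_append, hkeep S S (fun _ h => h), hdrop S S' (fun a ha ha' => hdisj a ha' ha),
        List.append_nil]
  · right
    push Not at hall
    obtain ⟨u, hu, hne⟩ := hall
    have hall' : ∀ v ≤ l, f (v + 1) ∈ S' := by
      intro v hv
      rcases hmem v hv 0 (by norm_num) with ⟨h1, h2⟩ | ⟨-, h2, -⟩
      · exfalso
        have u0 := hmem u hu 0 (by norm_num)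
        have u1 := hmem u hu 1 (by norm_num)
        have v1 := hmem v hv 1 (by norm_num)
        -- A symbol outside `S` comes after every symbol of `S`, but pass 0 places the smaller of
        -- `u`, `v` first and pass 1 places the larger first.
        rcases lt_trichotomy u v with huv | rfl | huv
        · have := hP.up₀ u v huv hv
          rcases u0 with h | h
          · exact hne h.1
          · omega
        · exact hne h1
        · have := hP.down₁ v u huv hu
          rcases u1 with h | h
          · exact hne h.1
          · rcases v1 with h' | h'
            · omega
            · exact h'.1 h1
      · exact h2
    refine Embeds.of_filterMap hf hsub (fun a => if a ∈ S' then some a else none) f ?_ (hinj S') ?_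
    · intro a ha
      obtain ⟨h1, h2⟩ := mem_Z.mp ha
      have := hall' (a - 1) (by omega)
      rw [Nat.sub_add_cancel h1] at this
      exact if_pos this
    · rw [List.filterMap_append, hkeep S' S' (fun _ h => h), hdrop S' S hdisj, List.nil_append]

theorem numSym_append_of_disjoint {S S' : List ℕ} (hdisj : ∀ a ∈ S, a ∉ S') :
    numSym (S ++ S') = numSym S + numSym S' := by
  rw [numSym, List.toFinset_append, Finset.card_union_of_disjoint]
  · rfl
  · rw [Finset.disjoint_left]
    intro a ha ha'
    exact hdisj a (by simpa using ha) (by simpa using ha')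

theorem exists_forall_lt (S : List ℕ) : ∃ c, ∀ a ∈ S, a < c :=
  ⟨S.sum + 1, fun _ ha => Nat.lt_succ_of_le (List.le_sum_of_mem ha)⟩

/-- `Ex` asks for exactly `n` symbols. Missing ones are appended once each as fresh symbols,
harmless for avoidance and sparseness. -/
theorem length_le_Ex {l n : ℕ} (hl : 1 ≤ l) {S : List ℕ} (hS : ¬ Embeds (Z l) S)
    (hsp : Sparse (l + 1) S) (hn : numSym S ≤ n) : S.length ≤ Ex (Z l) n := by
  obtain ⟨c, hc⟩ := exists_forall_lt S
  set F := List.range' c (n - numSym S) with hF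
  have hFn : F.Nodup := List.nodup_range'
  have hdisj : ∀ a ∈ S, a ∉ F := by
    intro a ha ha'
    have h1 := hc a ha
    have h2 := (List.mem_range'_1.mp ha').1
    omega
  have h1 : (S ++ F).length ≤ Ex (Z l) n := by
    refine le_csSup (bddAbove_admissibleLengths _ _) ⟨S ++ F, ?_, ?_, ?_, rfl⟩
    · intro h
      rcases embeds_append hdisj h with h | h
      · exact hS h
      · exact not_embeds_of_nodup hl hFn h
    · rw [numSym_append_of_disjoint hdisj]
      have : numSym F = n - numSym S := by
        rw [numSym, List.toFinset_card_of_nodup hFn, hF, List.length_range']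
      omega
    · rw [numSym_Z]
      exact hsp.append_of_disjoint (sparse_of_nodup _ hFn) hdisj
  rw [List.length_append] at h1
  omega

theorem exists_copies {l N : ℕ} (hl : 1 ≤ l) {S : List ℕ} (hS : ¬ Embeds (Z l) S)
    (hsp : Sparse (l + 1) S) (hN : numSym S ≤ N) (q : ℕ) :
    ∃ S' : List ℕ, ¬ Embeds (Z l) S' ∧ Sparse (l + 1) S' ∧ numSym S' ≤ q * N ∧
      S'.length = q * S.length := by
  induction q with
  | zero =>
    exact ⟨[], not_embeds_of_nodup hl List.nodup_nil, sparse_of_nodup _ List.nodup_nil,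
      by simp [numSym], by simp⟩
  | succ q ih =>
    obtain ⟨S', h1, h2, h3, h4⟩ := ih
    obtain ⟨c, hc⟩ := exists_forall_lt S'
    have hinj : Function.Injective (· + c) := add_left_injective c
    have hdisj : ∀ a ∈ S', a ∉ S.map (· + c) := by
      intro a ha ha'
      obtain ⟨b, -, rfl⟩ := List.mem_map.mp ha'
      have := hc _ ha
      omega
    refine ⟨S' ++ S.map (· + c), ?_, h2.append_of_disjoint (hsp.map hinj) hdisj, ?_, ?_⟩
    · intro h
      rcases embeds_append hdisj h with h | h
      · exact h1 h
      · exact hS (Embeds.of_map hinj.injOn h)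
    · rw [numSym_append_of_disjoint hdisj]
      have h5 : numSym (S.map (· + c)) = numSym S := by
        have : (S.map (· + c)).toFinset = S.toFinset.image (· + c) := by
          ext x
          simp only [List.mem_toFinset, List.mem_map, Finset.mem_image]
        rw [numSym, this, Finset.card_image_of_injective _ hinj]
        rfl
      rw [h5, add_mul, one_mul]
      omega
    · rw [List.length_append, List.length_map, h4]
      ring

/-- Copies of a thinned `U (zPattern k) i (2 * r)` over disjoint alphabets, where `i` is `α(n)`
minus a constant. Thinning loses at most half of the length and rounding `n` down to a multiple of
the number of symbols loses at most another half, hence the factor 4. -/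
theorem exists_mul_two_pow_choose_le_Ex (k : ℕ) : ∃ c : ℕ, ∀ n, 1 ≤ n →
    n * 2 ^ (alpha n - c + k).choose (k + 1) ≤ 4 * Ex (Z (3 ^ k)) n := by
  have hl : 1 ≤ 3 ^ k := Nat.one_le_pow _ _ (by norm_num)
  set r := 3 ^ k + 1 with hr
  -- With `j = 2 * r` the size bound uses column `6 * j + 2 = 12 * r + 2` of row `i + k + 2`.
  -- Raising the row to `i + k + 12 * r + 3` allows column 3, and that row is just below `α(n)`.
  refine ⟨k + 12 * r + 4, fun n hn => ?_⟩
  rcases Nat.lt_or_ge (alpha n) (k + 12 * r + 4) with hα | hα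
  -- For small `α(n)` the truncated subtraction makes the binomial coefficient vanish, and `n`
  -- distinct symbols suffice.
  · rw [Nat.sub_eq_zero_of_le hα.le, Nat.zero_add, Nat.choose_succ_self, pow_zero, mul_one]
    have h1 := length_le_Ex (n := n) hl (not_embeds_of_nodup hl (List.nodup_range (n := n)))
      (sparse_of_nodup _ List.nodup_range)
      ((List.toFinset_card_le _).trans List.length_range.le)
    rw [List.length_range] at h1
    omega
  · set i := alpha n - (k + 12 * r + 4) with hi
    set T := U (zPattern k) i (2 * r) with hT
    have hreg := zRegular_U k i (2 * r) (by omega)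
    have hN1 := one_le_numSym_U k i (2 * r) (by omega)
    rw [← hT] at hreg hN1
    set N := numSym T.flatten with hN
    have hNn : N ≤ n := by
      refine (size_U_le k i (2 * r) (by omega)).1.trans ?_
      refine (ackermannTable_mono_left (i := i + k + 1) (i' := i + k + 12 * r + 1) _ (by omega)
        (by omega)).trans ?_
      refine (ackermannTable_le_three (i + k + 12 * r + 1) _ (by omega) ?_).trans ?_
      · have : i + k + 12 * r + 1 + 3 < 2 ^ (i + k + 12 * r + 1 + 3) := Nat.lt_two_pow_self
        omega
      · exact (ackermannTable_lt_of_lt_alpha (i := i + k + 12 * r + 2) hn (by omega)).le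
    obtain ⟨S, hS1, hS2, hS3⟩ := exists_sparse_sublist r (2 * r) T fun B hB =>
      ⟨hreg.shaped.length_block B hB, hreg.shaped.nodup_block B hB⟩
    have hSfree : ¬ Embeds (Z (3 ^ k)) S := fun ⟨f, hf, hsub⟩ =>
      not_contained_U k i (2 * r) (by omega) ⟨f, hf, hsub.trans hS1⟩
    have hSN : numSym S ≤ N := Finset.card_le_card fun a ha => by
      rw [List.mem_toFinset] at ha ⊢
      exact hS1.subset ha
    obtain ⟨S', h1, h2, h3, h4⟩ := exists_copies hl hSfree hS2 hSN (n / N)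
    have h5 := length_le_Ex hl h1 h2 (h3.trans (Nat.div_mul_le_self n N))
    rw [h4] at h5
    set μ := 2 ^ (i + k).choose (k + 1) with hμ
    have h6 : N * μ ≤ 2 * S.length := by
      rw [← hreg.shaped.count]
      have : T.length * r ≤ T.length * (2 * r - (r - 1)) := Nat.mul_le_mul_left _ (by omega)
      calc T.length * (2 * r) = 2 * (T.length * r) := by ring
        _ ≤ _ := Nat.mul_le_mul_left 2 (this.trans hS3)
    have h7 : n ≤ 2 * (n / N * N) := by
      have a1 : 1 ≤ n / N := (Nat.one_le_div_iff (by omega)).mpr hNn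
      have a2 := Nat.lt_div_mul_add (a := n) (b := N) hN1
      have a3 : 1 * N ≤ n / N * N := Nat.mul_le_mul_right _ a1
      omega
    calc n * μ ≤ 2 * (n / N * N) * μ := Nat.mul_le_mul_right _ h7
      _ = 2 * (n / N) * (N * μ) := by ring
      _ ≤ 2 * (n / N) * (2 * S.length) := Nat.mul_le_mul_left _ h6
      _ = 4 * (n / N * S.length) := by ring
      _ ≤ _ := Nat.mul_le_mul_left _ h5

/-! ### Asymptotics -/

theorem descFactorial_bounds (x c k : ℕ) :
    (x - c) ^ (k + 1) ≤ (x - c + k).choose (k + 1) * (k + 1).factorial ∧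
      (x - c + k).choose (k + 1) * (k + 1).factorial ≤ (x + k) ^ (k + 1) := by
  rw [mul_comm, ← Nat.descFactorial_eq_factorial_mul_choose]
  constructor
  · have := Nat.pow_sub_le_descFactorial (x - c + k) (k + 1)
    rwa [show x - c + k + 1 - (k + 1) = x - c by omega] at this
  · exact (Nat.descFactorial_le_pow _ _).trans (Nat.pow_le_pow_left (by omega) _)

/-- Squeezing: the binomial coefficient times `(k+1)!` lies between `(x - c)^(k+1)` and `(x +
k)^(k+1)`. The `- 3` is the slack in the exponent used for a strict inequality. -/
theorem tendsto_choose_div_pow (c k : ℕ) :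
    Filter.Tendsto (fun x : ℕ => ((((x - c + k).choose (k + 1) : ℕ) : ℝ) - 3) *
      ((k + 1).factorial : ℝ) / (x : ℝ) ^ (k + 1)) Filter.atTop (nhds 1) := by
  have hinv : Filter.Tendsto (fun x : ℕ => ((x : ℝ))⁻¹) Filter.atTop (nhds 0) :=
    tendsto_inv_atTop_nhds_zero_nat
  have hlow : Filter.Tendsto (fun x : ℕ => (1 - (c : ℝ) * (x : ℝ)⁻¹) ^ (k + 1) -
      3 * ((k + 1).factorial : ℝ) * (x : ℝ)⁻¹ ^ (k + 1)) Filter.atTop (nhds 1) := by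
    have := (((hinv.const_mul (c : ℝ)).const_sub 1).pow (k + 1)).sub
      ((hinv.pow (k + 1)).const_mul (3 * ((k + 1).factorial : ℝ)))
    simpa using this
  have hup : Filter.Tendsto (fun x : ℕ => (1 + (k : ℝ) * (x : ℝ)⁻¹) ^ (k + 1) -
      3 * ((k + 1).factorial : ℝ) * (x : ℝ)⁻¹ ^ (k + 1)) Filter.atTop (nhds 1) := by
    have := (((hinv.const_mul (k : ℝ)).const_add 1).pow (k + 1)).sub
      ((hinv.pow (k + 1)).const_mul (3 * ((k + 1).factorial : ℝ)))
    simpa using this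
  have key : ∀ x : ℕ, 1 ≤ x → ∀ y : ℝ, (1 + y * (x : ℝ)⁻¹) ^ (k + 1) -
      3 * ((k + 1).factorial : ℝ) * (x : ℝ)⁻¹ ^ (k + 1) =
      (((x : ℝ) + y) ^ (k + 1) - 3 * ((k + 1).factorial : ℝ)) / (x : ℝ) ^ (k + 1) := by
    intro x hx y
    have hx' : (x : ℝ) ≠ 0 := by positivity
    rw [sub_div, ← div_pow, add_div, div_self hx', inv_pow]
    rfl
  refine tendsto_of_tendsto_of_tendsto_of_le_of_le' hlow hup ?_ ?_
  · filter_upwards [Filter.eventually_ge_atTop (c + 1)] with x hx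
    have h1 := (descFactorial_bounds x c k).1
    have h2 : ((x : ℝ) - c) ^ (k + 1) ≤
        ((x - c + k).choose (k + 1) : ℝ) * ((k + 1).factorial : ℝ) := by
      rw [← Nat.cast_sub (by omega : c ≤ x)]
      exact_mod_cast h1
    have h3 := key x (by omega) (-c)
    rw [neg_mul, ← sub_eq_add_neg, ← sub_eq_add_neg] at h3
    rw [h3]
    refine div_le_div_of_nonneg_right ?_ (by positivity)
    rw [sub_mul]
    linarith
  · filter_upwards [Filter.eventually_ge_atTop 1] with x hx
    have h1 := (descFactorial_bounds x c k).2
    have h2 : ((x - c + k).choose (k + 1) : ℝ) * ((k + 1).factorial : ℝ) ≤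
        ((x : ℝ) + k) ^ (k + 1) := by exact_mod_cast h1
    rw [key x hx k]
    refine div_le_div_of_nonneg_right ?_ (by positivity)
    rw [sub_mul]
    linarith

theorem exists_lt_Ex (k : ℕ) : ∃ ε : ℕ → ℝ, Filter.Tendsto ε Filter.atTop (nhds 0) ∧
    ∀ n : ℕ, 1 ≤ n → (n : ℝ) * (2 : ℝ) ^
      ((1 + ε n) * (alpha n : ℝ) ^ (k + 1) / (Nat.factorial (k + 1) : ℝ)) <
        (Ex (Z (3 ^ k)) n : ℝ) := by
  obtain ⟨c, hc⟩ := exists_mul_two_pow_choose_le_Ex k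
  -- The error term is defined so that the exponent becomes exactly the binomial coefficient minus
  -- 3; then `2 ^ b / 8` is strictly below the available `2 ^ b / 4`.
  refine ⟨fun n => ((((alpha n - c + k).choose (k + 1) : ℕ) : ℝ) - 3) *
      ((k + 1).factorial : ℝ) / (alpha n : ℝ) ^ (k + 1) - 1, ?_, ?_⟩
  · have := ((tendsto_choose_div_pow c k).comp tendsto_alpha_atTop).sub_const 1
    simpa using this
  · intro n hn
    have hα : (0 : ℝ) < alpha n := by exact_mod_cast (alpha_spec n hn).1
    have hfac : (0 : ℝ) < ((k + 1).factorial : ℝ) := by positivity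
    set b := (alpha n - c + k).choose (k + 1) with hb
    have hexp : (1 + (((b : ℝ) - 3) * ((k + 1).factorial : ℝ) / (alpha n : ℝ) ^ (k + 1) - 1)) *
        (alpha n : ℝ) ^ (k + 1) / ((k + 1).factorial : ℝ) = (b : ℝ) - 3 := by
      have : (alpha n : ℝ) ^ (k + 1) ≠ 0 := by positivity
      field_simp
      ring
    have h1 : (n : ℝ) * 2 ^ b ≤ 4 * (Ex (Z (3 ^ k)) n : ℝ) := by exact_mod_cast hc n hn
    have h2 : (0 : ℝ) < (n : ℝ) * 2 ^ b := by positivity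
    have h3 : (2 : ℝ) ^ ((b : ℝ) - 3) = 2 ^ b / 8 := by
      rw [Real.rpow_sub (by norm_num), Real.rpow_natCast]
      norm_num
    beta_reduce
    rw [hexp, h3]
    linarith

theorem eventually_le_choose (C s c t : ℕ) :
    ∀ᶠ x : ℕ in Filter.atTop, C * (x + 1) ^ s + t ≤ (x - c + s).choose (s + 1) := by
  -- The summand `2 * c + 1` gives `x + 1 ≤ 2 * (x - c)`; the rest makes one spare factor `x - c`
  -- beat all the constants.
  filter_upwards [Filter.eventually_ge_atTop (2 * c + 1 + (C + t) * 2 ^ s * (s + 1).factorial)]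
    with x hx
  have h1 := (descFactorial_bounds x c s).1
  have h2 : (x + 1) ^ s ≤ 2 ^ s * (x - c) ^ s := by
    rw [← mul_pow]
    exact Nat.pow_le_pow_left (by omega) _
  have h3 : (C + t) * 2 ^ s * (s + 1).factorial ≤ x - c := by omega
  have h4 : 1 ≤ (x + 1) ^ s := Nat.one_le_pow _ _ (by omega)
  have h5 : (C + t) * (x + 1) ^ s * (s + 1).factorial ≤
      (x - c + s).choose (s + 1) * (s + 1).factorial := by
    calc (C + t) * (x + 1) ^ s * (s + 1).factorial
        ≤ (C + t) * (2 ^ s * (x - c) ^ s) * (s + 1).factorial :=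
          Nat.mul_le_mul_right _ (Nat.mul_le_mul_left _ h2)
      _ = (x - c) ^ s * ((C + t) * 2 ^ s * (s + 1).factorial) := by ring
      _ ≤ (x - c) ^ s * (x - c) := Nat.mul_le_mul_left _ h3
      _ = (x - c) ^ (s + 1) := (pow_succ _ _).symm
      _ ≤ _ := h1
  have h6 := Nat.le_of_mul_le_mul_right h5 (Nat.factorial_pos _)
  have h7 : t * 1 ≤ t * (x + 1) ^ s := Nat.mul_le_mul_left _ h4
  rw [add_mul] at h6
  omega

theorem exists_isLittleO_Ex_Z (σ : List ℕ) : ∃ l : ℕ, 1 ≤ l ∧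
    (fun n : ℕ => (Ex σ n : ℝ)) =o[Filter.atTop] (fun n : ℕ => (Ex (Z l) n : ℝ)) := by
  obtain ⟨C, s, hσ⟩ := exists_Ex_le σ
  -- Taking `k = s`, the exponent of order `α ^ (s + 1)` exceeds `C * (α + 1) ^ s + t` for every
  -- fixed `t`, so the quotient falls below `4 / 2 ^ t`.
  obtain ⟨c, hc⟩ := exists_mul_two_pow_choose_le_Ex s
  refine ⟨3 ^ s, Nat.one_le_pow _ _ (by norm_num), ?_⟩
  rw [Asymptotics.isLittleO_iff]
  intro ε hε
  obtain ⟨t, ht⟩ := exists_pow_lt_of_lt_one (by positivity : 0 < ε / 4)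
    (by norm_num : (1 / 2 : ℝ) < 1)
  filter_upwards [tendsto_alpha_atTop.eventually (eventually_le_choose C s c t),
    Filter.eventually_ge_atTop 1] with n hn hn1
  have h1 : Ex σ n * 2 ^ t ≤ 4 * Ex (Z (3 ^ s)) n := by
    calc Ex σ n * 2 ^ t ≤ n * 2 ^ (C * (alpha n + 1) ^ s) * 2 ^ t :=
          Nat.mul_le_mul_right _ (hσ n hn1)
      _ = n * 2 ^ (C * (alpha n + 1) ^ s + t) := by rw [mul_assoc, ← pow_add]
      _ ≤ n * 2 ^ (alpha n - c + s).choose (s + 1) :=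
          Nat.mul_le_mul_left _ (Nat.pow_le_pow_right (by norm_num) hn)
      _ ≤ _ := hc n hn1
  have h2 : (Ex σ n : ℝ) * 2 ^ t ≤ 4 * (Ex (Z (3 ^ s)) n : ℝ) := by exact_mod_cast h1
  rw [Real.norm_natCast, Real.norm_natCast]
  have h3 : (Ex σ n : ℝ) ≤ 4 * (1 / 2) ^ t * (Ex (Z (3 ^ s)) n : ℝ) := by
    have h4 : (0 : ℝ) < 2 ^ t := by positivity
    rw [one_div, inv_pow, mul_assoc, inv_mul_eq_div, ← mul_div_assoc, le_div_iff₀ h4]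
    exact h2
  refine h3.trans (mul_le_mul_of_nonneg_right ?_ (Nat.cast_nonneg _))
  linarith

end ZigZag

theorem mainTheorem4 :
    (∀ k : ℕ,
      (∀ i j : ℕ, 1 ≤ j →
        ¬ ZigZag.Contained (ZigZag.Z (3 ^ k)) (ZigZag.U (ZigZag.zPattern k) i j).flatten) ∧
      ∃ ε : ℕ → ℝ, Filter.Tendsto ε Filter.atTop (nhds 0) ∧
        ∀ n : ℕ, 1 ≤ n →
          (n : ℝ) * (2 : ℝ) ^
              ((1 + ε n) * (ZigZag.alpha n : ℝ) ^ (k + 1) / (Nat.factorial (k + 1) : ℝ)) <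
            (ZigZag.Ex (ZigZag.Z (3 ^ k)) n : ℝ)) ∧
    ZigZag.CofinalForbidden {σ | ∃ l : ℕ, 1 ≤ l ∧ σ = ZigZag.Z l} ∧
    ∃ l : ℕ, 1 ≤ l ∧
      (fun n : ℕ => (ZigZag.DS 4 n : ℝ)) =o[Filter.atTop]
        (fun n : ℕ => (ZigZag.Ex (ZigZag.Z l) n : ℝ)) := by
  refine ⟨fun k => ⟨fun i j hj => ZigZag.not_contained_U k i j hj, ZigZag.exists_lt_Ex k⟩,
    fun σ => ?_, ZigZag.exists_isLittleO_Ex_Z _⟩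
  obtain ⟨l, hl, h⟩ := ZigZag.exists_isLittleO_Ex_Z σ
  exact ⟨ZigZag.Z l, ⟨l, hl, rfl⟩, h⟩
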